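/- **Optimal work of the multilevel double-loop randomized quasi-Monte Carlo (MLDLQMC) estimator with inexact sampling.** *Setting.* Let $d_1,d_2\ge 1$, let $D\subseteq\mathbb R$ be an open interval, $f\in C^2(D)$, and let $g$ and $g_h$ ($h>0$) be functions $[0,1]^{d_1}\times[0,1]^{d_2}\to\mathbb R$, with values in $D$ for $y\in(0,1)^{d_1}$. Write $\bar g(y)=\int_{[0,1]^{d_2}}g(y,x)\,dx$, $\bar g_h(y)=\int_{[0,1]^{d_2}}g_h(y,x)\,dx$ and $I=\int_{[0,1]^{d_1}}f(\bar g(y))\,dy$ (all these integrals are assumed to exist, and the functions to be measurable). Fix $\epsilon,\gamma,\eta_{\rm w},\eta_{\rm s}>0$, $\alpha\in(0,1)$, an integer $M_0\ge1$ and $h_0>0$. Put $h_\ell=h_02^{-\ell}$ and, for $\ell\ge1$, let $M_\ell$ be $M_0(2^{\eta_{\rm w}/(1-\epsilon)})^{\ell}$ rounded up to a power of two. Let $u^{(n)}$ and $t^{(m)}$ be Sobol' sequences in dimensions $d_1$ and $d_2$, let $\tau^{(\ell)}$ ($\ell\ge0$) and $\rho$ be independent Owen scramblings (nested uniform scramblings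 in base two) of $u$ and $t$, and put $$m_\ell(y)=\frac1{M_\ell}\sum_{m=1}^{M_\ell}g_{h_\ell}(y,t^{(m)}),\qquad m_\ell^{\rho}(y)=\frac1{M_\ell}\sum_{m=1}^{M_\ell}g_{h_\ell}(y,\rho(t^{(m)})),\qquad y^{(\ell,n)}=\tau^{(\ell)}(u^{(n)}).$$ For $L\ge1$ and $N_0,\dots,N_L\ge1$ the estimator is $$I_{\rm ML}=\frac1{N_0}\sum_{n=1}^{N_0}f(m_0(y^{(0,n)}))+\sum_{\ell=1}^{L-1}\frac1{N_\ell}\sum_{n=1}^{N_\ell}\big[f(m_\ell(y^{(\ell,n)}))-f(m_{\ell-1}(y^{(\ell,n)}))\big]+\frac1{N_L}\sum_{n=1}^{N_L}\big[f(m_L^{\rho}(y^{(L,n)}))-f(m_{L-1}(y^{(L,n)}))\big],$$ and its work is $W(L,N)=\sum_{\ell=0}^LN_\ell M_\ell h_\ell^{-\gamma}+\sum_{\ell=0}^LM_\ell h_\ell^{-\gamma}$. A choice $(L,N_0,\dots,N_L)$ is *admissible* for $TOL>0$ if $I_{\rm ML}$ is square integrable, $|\mathbb E[I_{\rm ML}]-I|\le\frac12TOL$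 and $\mathbb V[I_{\rm ML}]\le\big(\frac12TOL/C_\alpha\big)^2$ with $C_\alpha=1/\sqrt\alpha$. Let $W^\ast(TOL)$ be the infimum of $W$ over all admissible choices. *Growth conditions.* For $A\in\mathbb R^{d_1}$ let $A_{\max}=\max_iA_i$. A function $\varphi$ satisfies $\mathrm{BG}(B,A)$ if on $(0,1)^{d_1}$ it has continuous mixed partial derivatives $\partial^u\varphi$ (once in each variable $y_j$, $j\in u$) for all $u\subseteq\{1,\dots,d_1\}$ and $$|\partial^u\varphi(y)|\le B\prod_{i=1}^{d_1}\min(y_i,1-y_i)^{-A_i-\mathbf 1_{\{i\in u\}}}.$$ For $a,b\in D$ put $T_1(a,b)=f'(b)(a-b)$ and $T_2(a,b)=(a-b)^2\int_0^1f''(b+s(a-b))(1-s)\,ds$. *Assumptions.* There are constants $C_{\rm w},C_{d_2},C_{\rm s},b^{(0)},b^{(I)},b^{(II)},b^{(III)},b^{(IV)}>0$ and vectors $A^{(0)},A^{(I)},A^{(II)},A^{(III)},A^{(IV)}\in\mathbb R^{d_1}$, none of them depending on $\ell$, with $0<A^{(0)}_{\max},A^{(I)}_{\max},A^{(II)}_{\max}<\frac12$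 and $0<A^{(III)}_{\max},A^{(IV)}_{\max}<1$, such that 1. (weak rate) $f\circ\bar g_{h_\ell}$ is integrable and $\big|\int f(\bar g_{h_\ell}(y))\,dy-I\big|\le C_{\rm w}h_\ell^{\eta_{\rm w}}$ for all $\ell\ge1$; 2. $f\circ m_0$ satisfies $\mathrm{BG}(b^{(0)},A^{(0)})$; 3. $T_1(m_\ell,\bar g)$ satisfies $\mathrm{BG}\big((C_{d_2}M_\ell^{-1+\epsilon}+C_{\rm s}h_\ell^{\eta_{\rm s}})b^{(I)},A^{(I)}\big)$ for all $\ell\ge0$, and so does, almost surely, $T_1(m_\ell^\rho,\bar g)$ for every $\ell\ge1$; 4. $T_2(m_\ell,\bar g)$ satisfies $\mathrm{BG}\big((C_{d_2}^2M_\ell^{-2+2\epsilon}+C_{\rm s}^2h_\ell^{2\eta_{\rm s}})b^{(II)},A^{(II)}\big)$ for all $\ell\ge0$, and so does, almost surely, $T_2(m_\ell^\rho,\bar g)$ for every $\ell\ge1$; 5. for every $\ell\ge1$, almost surely, for all $y\in(0,1)^{d_1}$, $$|T_1(m_\ell^\rho,\bar g_{h_\ell})(y)|\le C_{d_2}M_\ell^{-1+\epsilon}b^{(III)}\prod_i\min(y_i,1-y_i)^{-A_i^{(III)}},\qquad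 |T_2(m_\ell^\rho,\bar g_{h_\ell})(y)|\le C_{d_2}^2M_\ell^{-2+2\epsilon}b^{(IV)}\prod_i\min(y_i,1-y_i)^{-A_i^{(IV)}}.$$ Let $A_{\max}=\max\{A^{(0)}_{\max},A^{(I)}_{\max},A^{(II)}_{\max}\}$ and assume $\epsilon<1-A_{\max}$. *Conclusion.* For all sufficiently small $TOL>0$ there is an admissible choice whose work equals $W^\ast(TOL)$ and for which $\mathbb P(|I_{\rm ML}-I|\le TOL)\ge1-\alpha$; and, as $TOL\to0$, $$W^\ast(TOL)=\mathcal O\Big(TOL^{-\left(\frac1{1-\epsilon}+\frac\gamma{\eta_{\rm w}}\right)}\Big)+\begin{cases}\mathcal O\Big(TOL^{-\frac1{1-\epsilon-A_{\max}}}\Big),&\text{if }\frac{\eta_{\rm s}}{\eta_{\rm w}(1-\epsilon-A_{\max})}>\frac1{1-\epsilon}+\frac\gamma{\eta_{\rm w}},\\[4pt]\mathcal O\Big(TOL^{-\frac1{1-\epsilon-A_{\max}}}\log_2\big(TOL^{-\max\{\frac1{\eta_{\rm w}},\frac1{1-\epsilon}\}}\big)\Big),&\text{if }\frac{\eta_{\rm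 s}}{\eta_{\rm w}(1-\epsilon-A_{\max})}=\frac1{1-\epsilon}+\frac\gamma{\eta_{\rm w}},\\[4pt]\mathcal O\Big(TOL^{-\frac1{1-\epsilon-A_{\max}}+\frac{\eta_{\rm s}}{\eta_{\rm w}(1-\epsilon-A_{\max})}-\left(\frac1{1-\epsilon}+\frac\gamma{\eta_{\rm w}}\right)}\Big),&\text{if }\frac{\eta_{\rm s}}{\eta_{\rm w}(1-\epsilon-A_{\max})}<\frac1{1-\epsilon}+\frac\gamma{\eta_{\rm w}}.\end{cases}$$ -/

import Mathlib

open Set Filter Topology MeasureTheory ProbabilityTheory Polynomial Asymptotics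

noncomputable section

/-! ### Sobol' sequences and Owen's scrambling -/

/-- A primitive polynomial over the field with two elements: it is irreducible and its root
generates the multiplicative group of the field obtained by adjoining that root. -/
def IsPrimitiveModTwo (p : (ZMod 2)[X]) : Prop :=
  Irreducible p ∧ orderOf (AdjoinRoot.root p) = 2 ^ p.natDegree - 1

/-- The data that determine a Sobol' sequence in dimension `d`. The entry `mat j r k` is the
binary digit number `r + 1` of the direction number number `k + 1` of coordinate `j`. The first
coordinate is the van der Corput sequence; every other coordinate belongs to a primitive
polynomial `x ^ s + a₁ x ^ (s - 1) + ⋯ + a_{s-1} x + 1`, distinct coordinates to distinct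
polynomials, and its direction numbers satisfy (in exclusive-or arithmetic)
`v_k = a₁ v_{k-1} + ⋯ + a_{s-1} v_{k-s+1} + v_{k-s} + v_{k-s} / 2 ^ s`.
The fields `diag` and `upper` say that `v_k = m_k / 2 ^ k` with `m_k < 2 ^ k` odd. -/
structure SobolGenerator (d : ℕ) where
  poly : Fin d → (ZMod 2)[X]
  mat : Fin d → ℕ → ℕ → ZMod 2
  primitive : ∀ j : Fin d, (j : ℕ) ≠ 0 → IsPrimitiveModTwo (poly j)
  distinct : ∀ i j : Fin d, (i : ℕ) ≠ 0 → (j : ℕ) ≠ 0 → poly i = poly j → i = j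
  diag : ∀ j k, mat j k k = 1
  upper : ∀ j r k, k < r → mat j r k = 0
  first : ∀ j : Fin d, (j : ℕ) = 0 → ∀ r k, r ≠ k → mat j r k = 0
  recurrence : ∀ j : Fin d, (j : ℕ) ≠ 0 → ∀ r k, (poly j).natDegree ≤ k →
    mat j r k =
      ∑ i ∈ Finset.Icc 1 (poly j).natDegree,
        (poly j).coeff ((poly j).natDegree - i) * mat j r (k - i)
      + if (poly j).natDegree ≤ r then
          mat j (r - (poly j).natDegree) (k - (poly j).natDegree) else 0

/-- The binary digits of coordinate `j` of point number `n` (counted from `0`). -/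
def SobolGenerator.digits {d : ℕ} (S : SobolGenerator d) (n : ℕ) (j : Fin d) : ℕ → ZMod 2 :=
  fun r => ∑ k ∈ Finset.range n, if n.testBit k then S.mat j r k else 0

/-- The real number in `[0, 1]` with the given binary digits. -/
def ofBinary (x : ℕ → ZMod 2) : ℝ := ∑' r, ((x r).val : ℝ) / 2 ^ (r + 1)

/-- Point number `n` (counted from `0`) of the Sobol' sequence. -/
def SobolGenerator.point {d : ℕ} (S : SobolGenerator d) (n : ℕ) : Fin d → ℝ :=
  fun j => ofBinary (S.digits n j)

/-- A nested scrambling in base two: for every coordinate and every finite string of preceding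
digits it says whether the next digit is flipped. -/
abbrev Scrambling (d : ℕ) : Type := Fin d × List (ZMod 2) → Bool

/-- The law of Owen's nested uniform scrambling: all flips are independent fair coins. -/
def owenLaw (d : ℕ) : Measure (Scrambling d) :=
  Measure.infinitePi fun _ => (PMF.uniformOfFintype Bool).toMeasure

/-- Point number `n` of the Sobol' sequence after the scrambling `σ`: digit number `r` is flipped
or not according to the unscrambled digits that precede it. -/
def SobolGenerator.scrambled {d : ℕ} (S : SobolGenerator d) (σ : Scrambling d) (n : ℕ) :
    Fin d → ℝ :=
  fun j => ofBinary fun r =>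
    S.digits n j r + if σ (j, List.ofFn fun i : Fin r => S.digits n j i) then 1 else 0

/-! ### The boundary growth condition -/

/-- The open unit cube. -/
def openCube (d : ℕ) : Set (Fin d → ℝ) := {y | ∀ i, 0 < y i ∧ y i < 1}

/-- `∏ i, min (y i) (1 - y i) ^ (-A i - 1_{i ∈ u})`. -/
def boundaryWeight {d : ℕ} (A : Fin d → ℝ) (u : Finset (Fin d)) (y : Fin d → ℝ) : ℝ :=
  ∏ i, (min (y i) (1 - y i)) ^ (-A i - if i ∈ u then 1 else 0)

/-- `φ` has continuous mixed partial derivatives `∂ u = (∏ j ∈ u, ∂/∂y_j) φ` of order at most one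
in each variable on the open cube, and `|∂ u y| ≤ B ∏ i, min (y i) (1 - y i) ^ (-A i - 1_{i ∈ u})`
for all sets `u` of coordinates. -/
def BoundaryGrowth {d : ℕ} (φ : (Fin d → ℝ) → ℝ) (B : ℝ) (A : Fin d → ℝ) : Prop :=
  ∃ D : Finset (Fin d) → (Fin d → ℝ) → ℝ,
    (∀ y ∈ openCube d, D ∅ y = φ y) ∧
    (∀ u, ContinuousOn (D u) (openCube d)) ∧
    (∀ u, ∀ j ∉ u, ∀ y ∈ openCube d,
      HasDerivAt (fun s => D u (Function.update y j s)) (D (insert j u) y) (y j)) ∧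
    ∀ u, ∀ y ∈ openCube d, |D u y| ≤ B * boundaryWeight A u y

/-- The largest of the exponents. -/
def maxExponent {d : ℕ} [NeZero d] (A : Fin d → ℝ) : ℝ :=
  Finset.univ.sup' Finset.univ_nonempty A

/-! ### The nested integral and its estimator -/

/-- The integrands `f`, `g`, the approximations `gh h` of `g`, the outer and inner Sobol'
sequences, and the numerical parameters of the method. -/
structure NestedData (d₁ d₂ : ℕ) where
  f : ℝ → ℝ
  g : (Fin d₁ → ℝ) → (Fin d₂ → ℝ) → ℝ
  gh : ℝ → (Fin d₁ → ℝ) → (Fin d₂ → ℝ) → ℝ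
  outer : SobolGenerator d₁
  inner : SobolGenerator d₂
  M₀ : ℕ
  h₀ : ℝ
  ηw : ℝ
  γ : ℝ
  ε : ℝ

/-- `∫_{[0,1]^{d₂}} G(y, x) dx`. -/
def innerIntegral {d₁ d₂ : ℕ} (G : (Fin d₁ → ℝ) → (Fin d₂ → ℝ) → ℝ) (y : Fin d₁ → ℝ) : ℝ :=
  ∫ x in Icc (0 : Fin d₂ → ℝ) 1, G y x

/-- `(1 / M) ∑_{m < M} G(y, x m)`. -/
def innerMean {d₁ d₂ : ℕ} (G : (Fin d₁ → ℝ) → (Fin d₂ → ℝ) → ℝ) (M : ℕ)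
    (x : ℕ → Fin d₂ → ℝ) (y : Fin d₁ → ℝ) : ℝ :=
  (1 / (M : ℝ)) * ∑ m ∈ Finset.range M, G y (x m)

/-- `f'(b) (a - b)`, the first-order term of the Taylor expansion of `f(a)` about `b`. -/
def taylorLinear (f : ℝ → ℝ) (a b : ℝ) : ℝ := deriv f b * (a - b)

/-- `(a - b)² ∫_0^1 f''(b + s (a - b)) (1 - s) ds`, the remainder of that expansion. -/
def taylorRemainder (f : ℝ → ℝ) (a b : ℝ) : ℝ :=
  (a - b) ^ 2 * ∫ s in (0 : ℝ)..1, deriv (deriv f) (b + s * (a - b)) * (1 - s)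

namespace NestedData

variable {d₁ d₂ : ℕ} (Q : NestedData d₁ d₂)

/-- The nested integral. -/
def integral : ℝ := ∫ y in Icc (0 : Fin d₁ → ℝ) 1, Q.f (innerIntegral Q.g y)

/-- `h_ℓ = h₀ 2^{-ℓ}`. -/
def h (l : ℕ) : ℝ := Q.h₀ / 2 ^ l

/-- `M_ℓ` is `M₀ (2^{η_w / (1 - ε)})^ℓ`, for `ℓ ≥ 1` rounded up to a power of two. -/
def M (l : ℕ) : ℕ :=
  if l = 0 then Q.M₀
  else 2 ^ ⌈Real.logb 2 (Q.M₀ * ((2 : ℝ) ^ (Q.ηw / (1 - Q.ε))) ^ l)⌉₊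

/-- The inner average at level `l` with the deterministic Sobol' points. -/
def detMean (l : ℕ) (y : Fin d₁ → ℝ) : ℝ :=
  innerMean (Q.gh (Q.h l)) (Q.M l) Q.inner.point y

/-- The inner average at level `l` with the Sobol' points scrambled by `ρ`. -/
def ranMean (l : ℕ) (ρ : Scrambling d₂) (y : Fin d₁ → ℝ) : ℝ :=
  innerMean (Q.gh (Q.h l)) (Q.M l) (Q.inner.scrambled ρ) y

/-- The sample space: one scrambling of the outer points for every level, and one scrambling of
the inner points. -/
abbrev Sample (d₁ d₂ : ℕ) : Type := (ℕ → Scrambling d₁) × Scrambling d₂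

/-- All scramblings are independent and follow Owen's law. -/
def law (d₁ d₂ : ℕ) : Measure (Sample d₁ d₂) :=
  (Measure.infinitePi fun _ : ℕ => owenLaw d₁).prod (owenLaw d₂)

/-- The multilevel double-loop estimator with finest level `L` and `N l` outer points on level
`l` (one randomization). -/
def estimator (L : ℕ) (N : ℕ → ℕ) (ω : Sample d₁ d₂) : ℝ :=
  (1 / (N 0 : ℝ)) * ∑ n ∈ Finset.range (N 0), Q.f (Q.detMean 0 (Q.outer.scrambled (ω.1 0) n))
  + ∑ l ∈ Finset.Ico 1 L, (1 / (N l : ℝ)) * ∑ n ∈ Finset.range (N l),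
      (Q.f (Q.detMean l (Q.outer.scrambled (ω.1 l) n))
        - Q.f (Q.detMean (l - 1) (Q.outer.scrambled (ω.1 l) n)))
  + (1 / (N L : ℝ)) * ∑ n ∈ Finset.range (N L),
      (Q.f (Q.ranMean L ω.2 (Q.outer.scrambled (ω.1 L) n))
        - Q.f (Q.detMean (L - 1) (Q.outer.scrambled (ω.1 L) n)))

/-- The computational work, one evaluation of `gh h` costing `h ^ (-γ)`. -/
def work (L : ℕ) (N : ℕ → ℕ) : ℝ :=
  ∑ l ∈ Finset.range (L + 1), (N l : ℝ) * (Q.M l : ℝ) * Q.h l ^ (-Q.γ)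
  + ∑ l ∈ Finset.range (L + 1), (Q.M l : ℝ) * Q.h l ^ (-Q.γ)

/-- `(L, N)` is admissible for the tolerance `TOL` at confidence level `1 - α`: the estimator is
square integrable, its bias is at most `TOL / 2` and its variance at most
`(TOL / (2 C_α))²` with `C_α = 1 / √α`. -/
def Admissible (α TOL : ℝ) (L : ℕ) (N : ℕ → ℕ) : Prop :=
  1 ≤ L ∧ (∀ l ≤ L, 1 ≤ N l) ∧
  MemLp (Q.estimator L N) 2 (law d₁ d₂) ∧
  |(∫ ω, Q.estimator L N ω ∂law d₁ d₂) - Q.integral| ≤ TOL / 2 ∧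
  variance (Q.estimator L N) (law d₁ d₂) ≤ (TOL / 2 / (1 / √α)) ^ 2

/-- The least work of an admissible choice. -/
def optimalWork (α TOL : ℝ) : ℝ :=
  sInf {w | ∃ L N, Q.Admissible α TOL L N ∧ w = Q.work L N}

/-- The second term of the work rate, as a function of the largest exponent `A` and of the strong
rate `ηs`. -/
def samplingRate (A ηs TOL : ℝ) : ℝ :=
  if 1 / (1 - Q.ε) + Q.γ / Q.ηw < ηs / (Q.ηw * (1 - Q.ε - A)) then
    TOL ^ (-(1 / (1 - Q.ε - A)))
  else if ηs / (Q.ηw * (1 - Q.ε - A)) = 1 / (1 - Q.ε) + Q.γ / Q.ηw then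
    TOL ^ (-(1 / (1 - Q.ε - A))) * Real.logb 2 (TOL ^ (-max (1 / Q.ηw) (1 / (1 - Q.ε))))
  else
    TOL ^ (-(1 / (1 - Q.ε - A)) + ηs / (Q.ηw * (1 - Q.ε - A))
      - (1 / (1 - Q.ε) + Q.γ / Q.ηw))

end NestedData

end

/-!
The mean square error of the estimator is bounded level by level, by a power of the number of
outer points that is slightly better than the one in the work rate; the rate then follows by
distributing the error over the levels.

*One level.* Owen's scrambling of a point is a string of independent fair coins in every
coordinate, so the scrambled points are uniform, and a function `φ` of the digits splits into Haar
components indexed by the vector `lev` of the binary resolutions in the coordinates. For `2 ^ m`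
points of a Sobol' sequence two facts hold.
* The points form a digital net (`SobolGenerator.card_scrambledBits_eq`): the rows of the
  generating matrices are linear recurring sequences whose characteristic polynomials are powers
  of distinct irreducible polynomials, hence the leading rows are independent. So the mean of the
  component `lev` vanishes, apart from the constant one, if `∑ j, lev j` is at most `m` minus a
  constant (`SobolGenerator.haarSum_eq_zero`).
* For finer components, flipping one coin changes the sign of one factor but not of the other
  unless the two points share their leading digits, and boundedly many points do. So the mean
  square is at most a constant times `2 ^ (-m)` times the square norm of the component
  (`SobolGenerator.integral_haarSum_sq_le`).

The square norm of a component is at most that of a mixed difference of `φ`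
(`integral_haarComponent_sq_le`). Under the boundary growth condition with exponents at most
`A < 1 / 2` these are bounded with geometric decay in the resolution, at any rate below the one
that the singularity allows (`exists_integral_mixedDifference_sq_le`). Summing the square roots
over `∑ j, lev j ≥ m - const` gives the root mean square error `C B (2 ^ m) ^ (-p)` for every
`p < 1 - A` (`SobolGenerator.exists_eLpNorm_scrambled_le`).

*All levels.* By Taylor's formula the level differences satisfy a growth condition with constant
of the order `2 ^ (-min ηw ηs l)`, and the total bias, conditional on the inner scrambling, is of
the order `2 ^ (-ηw L)`. The triangle inequality in `L²` bounds the root mean square error of the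
estimator by the sum of these contributions (`NestedData.exists_eLpNorm_estimator_sub_le`).

*Work.* Since `1 - ε - A < 1 - A`, the exponent `p` may be taken larger than `1 - ε - A`. This
slack allows to weight the error budgets of the levels geometrically, and it absorbs the number of
levels (`exists_levels_cost_le`). Only finitely many works lie below a bound, so the infimum is
attained, and Chebyshev's inequality gives the probability of reaching the tolerance.
-/

/-! ### Random binary digits -/

/-- The law of a fair coin. -/
noncomputable abbrev fairCoin : Measure Bool := (PMF.uniformOfFintype Bool).toMeasure

/-- The law of a sequence of independent fair coins. -/
noncomputable abbrev coinLaw : Measure (ℕ → Bool) := Measure.infinitePi fun _ => fairCoin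

/-- The law of `d` independent sequences of independent fair coins. -/
noncomputable abbrev digitLaw (d : ℕ) : Measure (Fin d → ℕ → Bool) := Measure.pi fun _ => coinLaw

theorem map_xor_fairCoin (a : Bool) : fairCoin.map (xor a) = fairCoin := by
  classical
  ext s hs
  rw [Measure.map_apply (by fun_prop) hs, PMF.toMeasure_uniformOfFintype_apply _ (by trivial),
    PMF.toMeasure_uniformOfFintype_apply _ hs]
  congr 2
  have hb : Function.Bijective (xor a) := by revert a; decide
  exact Fintype.card_congr ((Equiv.ofBijective (xor a) hb).subtypeEquiv fun b => Iff.rfl)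

/-- Reading independent coins along an injection, each of them turned or not, gives independent
coins. -/
theorem map_xor_infinitePi {ι κ : Type*} {e : ι → κ} (he : Function.Injective e) (a : ι → Bool) :
    (Measure.infinitePi fun _ : κ => fairCoin).map (fun σ i => xor (a i) (σ (e i))) =
      Measure.infinitePi fun _ : ι => fairCoin := by
  have h1 := Measure.map_infinitePi_infinitePi_of_inj (P := fun _ : κ => fairCoin) he
  have h2 := Measure.infinitePi_map_pi (fun _ : ι => fairCoin) (f := fun i => xor (a i))
    (fun i => by fun_prop)
  simp only [map_xor_fairCoin] at h2
  rw [← h1, Measure.map_map (by fun_prop) (by fun_prop), h1] at h2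
  exact h2

/-- The number in `[0, 1]` with the given binary digits. -/
noncomputable def binaryValue (x : ℕ → Bool) : ℝ := ofBinary fun r => if x r then 1 else 0

/-- The sequence with digit number `k` turned. -/
def flipDigit (k : ℕ) (x : ℕ → Bool) : ℕ → Bool := fun r => xor (decide (r = k)) (x r)

theorem binaryValue_eq_tsum (x : ℕ → Bool) :
    binaryValue x = ∑' r, (if x r then (1 : ℝ) else 0) / 2 ^ (r + 1) := by
  unfold binaryValue ofBinary
  congr 1; ext r
  cases h : x r <;> simp [h, show ((1 : ZMod 2).val) = 1 from rfl]

theorem summable_binary (x : ℕ → Bool) :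
    Summable fun r => (if x r then (1 : ℝ) else 0) / 2 ^ (r + 1) := by
  refine Summable.of_nonneg_of_le (fun r => by positivity) (fun r => ?_) summable_geometric_two
  split_ifs
  · rw [pow_succ, one_div, one_div, inv_pow]
    gcongr
    linarith [pow_pos (two_pos (α := ℝ)) r]
  · simp

theorem binaryValue_nonneg (x : ℕ → Bool) : 0 ≤ binaryValue x := by
  rw [binaryValue_eq_tsum]; exact tsum_nonneg fun r => by positivity

theorem tsum_geometric_half_succ : ∑' r : ℕ, (1 : ℝ) / 2 ^ (r + 1) = 1 := by
  have := tsum_geometric_two' (1 : ℝ)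
  refine Eq.trans (tsum_congr fun r => ?_) this
  rw [pow_succ', div_div]

theorem summable_geometric_half_succ : Summable fun r : ℕ => (1 : ℝ) / 2 ^ (r + 1) := by
  simpa using summable_binary fun _ => true

theorem binaryValue_le_one (x : ℕ → Bool) : binaryValue x ≤ 1 := by
  refine le_of_le_of_eq ?_ tsum_geometric_half_succ
  rw [binaryValue_eq_tsum]
  refine (summable_binary x).tsum_le_tsum (fun r => ?_) summable_geometric_half_succ
  gcongr; split_ifs <;> simp

theorem binaryValue_mem_Icc (x : ℕ → Bool) : binaryValue x ∈ Icc (0 : ℝ) 1 :=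
  ⟨binaryValue_nonneg x, binaryValue_le_one x⟩

theorem binaryValue_eq_add (x : ℕ → Bool) (n : ℕ) :
    binaryValue x = (∑ r ∈ Finset.range n, (if x r then (1 : ℝ) else 0) / 2 ^ (r + 1))
      + binaryValue (fun r => x (r + n)) / 2 ^ n := by
  rw [binaryValue_eq_tsum, binaryValue_eq_tsum, ← (summable_binary x).sum_add_tsum_nat_add n,
    ← tsum_div_const]
  congr 2; ext r
  rw [div_div, ← pow_add]; congr 2; ring

/-- Numbers that share their first `n` digits are close. -/
theorem abs_binaryValue_sub_le {x y : ℕ → Bool} {n : ℕ} (h : ∀ r < n, x r = y r) :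
    |binaryValue x - binaryValue y| ≤ 1 / 2 ^ n := by
  rw [binaryValue_eq_add x n, binaryValue_eq_add y n,
    Finset.sum_congr rfl fun r hr => by rw [h r (Finset.mem_range.1 hr)], add_sub_add_left_eq_sub,
    ← sub_div, abs_div, abs_of_pos (by positivity : (0 : ℝ) < 2 ^ n)]
  gcongr
  have hx := binaryValue_mem_Icc (fun r => x (r + n))
  have hy := binaryValue_mem_Icc (fun r => y (r + n))
  rw [abs_le]; constructor <;> linarith [hx.1, hx.2, hy.1, hy.2]

theorem abs_binaryValue_flipDigit_sub (k : ℕ) (x : ℕ → Bool) :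
    |binaryValue (flipDigit k x) - binaryValue x| = 1 / 2 ^ (k + 1) := by
  have hs : ∀ r, (if flipDigit k x r then (1 : ℝ) else 0) / 2 ^ (r + 1)
      - (if x r then (1 : ℝ) else 0) / 2 ^ (r + 1)
      = if r = k then (if x k then -1 else 1) / 2 ^ (k + 1) else 0 := by
    intro r
    rcases eq_or_ne r k with rfl | h
    · cases hx : x r <;> simp [flipDigit, hx, neg_div]
    · simp [flipDigit, h]
  rw [binaryValue_eq_tsum, binaryValue_eq_tsum,
    ← (summable_binary _).tsum_sub (summable_binary x)]
  simp_rw [hs]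
  rw [tsum_ite_eq, abs_div, abs_of_pos (by positivity : (0 : ℝ) < 2 ^ (k + 1))]
  split_ifs <;> simp

theorem measurable_binaryValue : Measurable binaryValue := by
  have : binaryValue = fun x => ∑' r, (if x r then (1 : ℝ) else 0) / 2 ^ (r + 1) :=
    funext binaryValue_eq_tsum
  rw [this]
  refine Measurable.tsum fun r => ?_
  refine (Measurable.ite ?_ measurable_const measurable_const).div_const _
  exact measurableSet_eq_fun (measurable_pi_apply r) measurable_const

theorem measurePreserving_flipDigit (k : ℕ) : MeasurePreserving (flipDigit k) coinLaw coinLaw := by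
  refine ⟨?_, map_xor_infinitePi Function.injective_id _⟩
  unfold flipDigit; fun_prop

theorem measurePreserving_shift : MeasurePreserving (fun x : ℕ → Bool => fun r => x (r + 1))
    coinLaw coinLaw :=
  ⟨by fun_prop, Measure.map_infinitePi_infinitePi_of_inj (P := fun _ : ℕ => fairCoin)
    (add_left_injective 1)⟩

/-- Conditioning on the first digit: the characteristic function of a random number with
independent fair digits is determined by its values near `0`. -/
theorem charFun_map_binaryValue (t : ℝ) : charFun (coinLaw.map binaryValue) t =
    (1 + Complex.exp (t / 2 * Complex.I)) / 2 * charFun (coinLaw.map binaryValue) (t / 2) := by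
  have hm : ∀ s : ℝ, charFun (coinLaw.map binaryValue) s =
      ∫ x, Complex.exp (s * binaryValue x * Complex.I) ∂coinLaw := by
    intro s
    rw [charFun_apply_real, integral_map measurable_binaryValue.aemeasurable
      (by fun_prop)]
  have hi : ∀ (s : ℝ) (u : (ℕ → Bool) → ℕ → Bool), Measurable u →
      Integrable (fun x => Complex.exp (s * binaryValue (u x) * Complex.I)) coinLaw := by
    intro s u hu
    refine Integrable.of_bound (C := 1) ?_ (ae_of_all _ fun x => ?_)
    · have := measurable_binaryValue.comp hu
      refine Measurable.aestronglyMeasurable ?_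
      simp only [Function.comp_def] at this
      fun_prop
    · rw [show (s : ℂ) * binaryValue (u x) * Complex.I = ((s * binaryValue (u x) : ℝ) : ℂ) *
        Complex.I by push_cast; ring, Complex.norm_exp_ofReal_mul_I]
  have hf := (measurePreserving_flipDigit 0).measurable
  have hflip : ∫ x, Complex.exp (t * binaryValue (flipDigit 0 x) * Complex.I) ∂coinLaw =
      ∫ x, Complex.exp (t * binaryValue x * Complex.I) ∂coinLaw := by
    rw [← hm, ← (measurePreserving_flipDigit 0).map_eq,
      Measure.map_map measurable_binaryValue hf, charFun_apply_real, integral_map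
      (measurable_binaryValue.comp hf).aemeasurable (by fun_prop),
      (measurePreserving_flipDigit 0).map_eq]
    rfl
  have hshift : ∫ x, Complex.exp ((t / 2 : ℝ) * binaryValue (fun r => x (r + 1)) * Complex.I)
      ∂coinLaw = charFun (coinLaw.map binaryValue) (t / 2) := by
    rw [← measurePreserving_shift.map_eq, Measure.map_map measurable_binaryValue
      measurePreserving_shift.measurable, charFun_apply_real, integral_map
      (measurable_binaryValue.comp measurePreserving_shift.measurable).aemeasurable
      (by fun_prop), measurePreserving_shift.map_eq]
    rfl
  have hsum : ∀ x, Complex.exp (t * binaryValue x * Complex.I)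
      + Complex.exp (t * binaryValue (flipDigit 0 x) * Complex.I)
      = (1 + Complex.exp (t / 2 * Complex.I))
        * Complex.exp ((t / 2 : ℝ) * binaryValue (fun r => x (r + 1)) * Complex.I) := by
    intro x
    rw [binaryValue_eq_add x 1, binaryValue_eq_add (flipDigit 0 x) 1]
    have : (fun r => flipDigit 0 x (r + 1)) = fun r => x (r + 1) := by
      ext r; simp [flipDigit]
    rw [this, add_mul, ← Complex.exp_add]
    cases hx : x 0
    · simp only [Finset.range_one, Finset.sum_singleton, hx, flipDigit]
      push_cast
      simp
      congr 1 <;> congr 1 <;> ring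
    · simp only [Finset.range_one, Finset.sum_singleton, hx, flipDigit]
      push_cast
      simp
      rw [add_comm]
      congr 1 <;> congr 1 <;> ring
  have h2 : 2 * charFun (coinLaw.map binaryValue) t =
      (1 + Complex.exp (t / 2 * Complex.I)) * charFun (coinLaw.map binaryValue) (t / 2) := by
    rw [two_mul]
    nth_rw 2 [hm t]
    rw [← hflip, hm t, ← integral_add (hi t (fun x => x) measurable_id) (hi t _ hf),
      ← hshift, ← integral_const_mul]
    exact integral_congr_ae (ae_of_all _ hsum)
  linear_combination h2 / 2

/-- The uniform distribution satisfies the same functional equation: `[0, 1]` is the union of two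
copies of itself, scaled by `1 / 2`. -/
theorem charFun_volume_unit (t : ℝ) : charFun (volume.restrict (Icc (0 : ℝ) 1)) t =
    (1 + Complex.exp (t / 2 * Complex.I)) / 2
      * charFun (volume.restrict (Icc (0 : ℝ) 1)) (t / 2) := by
  have hm : ∀ s : ℝ, charFun (volume.restrict (Icc (0 : ℝ) 1)) s =
      ∫ x in (0 : ℝ)..1, Complex.exp (s * x * Complex.I) := by
    intro s
    rw [charFun_apply_real, intervalIntegral.integral_of_le zero_le_one,
      integral_Icc_eq_integral_Ioc]
  have hi : ∀ a b : ℝ,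
      IntervalIntegrable (fun x : ℝ => Complex.exp (t * x * Complex.I)) volume a b :=
    fun a b => Continuous.intervalIntegrable (by fun_prop) _ _
  have h1 : ∫ x in (0 : ℝ)..(1 / 2), Complex.exp (t * x * Complex.I) =
      1 / 2 * ∫ x in (0 : ℝ)..1, Complex.exp ((t / 2 : ℝ) * x * Complex.I) := by
    have := intervalIntegral.integral_comp_mul_right (a := 0) (b := 1)
      (fun x : ℝ => Complex.exp (t * x * Complex.I)) (c := 1 / 2) (by norm_num)
    simp only [zero_mul, one_mul] at this
    have h' : ∫ x in (0 : ℝ)..1, Complex.exp ((t / 2 : ℝ) * x * Complex.I) =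
      ∫ x in (0 : ℝ)..1, Complex.exp (t * (x * (1 / 2) : ℝ) * Complex.I) := by
      congr 1; ext x; congr 1; push_cast; ring
    rw [h', this, Complex.real_smul]; push_cast; ring
  have h2 : ∫ x in (1 / 2 : ℝ)..1, Complex.exp (t * x * Complex.I) =
      Complex.exp (t / 2 * Complex.I) *
      (1 / 2 * ∫ x in (0 : ℝ)..1, Complex.exp ((t / 2 : ℝ) * x * Complex.I)) := by
    have := intervalIntegral.integral_comp_add_right (a := 0) (b := 1 / 2)
      (fun x : ℝ => Complex.exp (t * x * Complex.I)) (1 / 2)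
    rw [show (0 : ℝ) + 1 / 2 = 1 / 2 by norm_num, show (1 / 2 : ℝ) + 1 / 2 = 1 by norm_num] at this
    rw [← this, ← h1, ← intervalIntegral.integral_const_mul]
    congr 1; ext x; rw [← Complex.exp_add]; congr 1; push_cast; ring
  rw [hm, hm, ← intervalIntegral.integral_add_adjacent_intervals (hi 0 (1 / 2)) (hi (1 / 2) 1),
    h1, h2]
  ring

/-- A number with independent fair binary digits is uniformly distributed on `[0, 1]`. -/
theorem map_binaryValue : coinLaw.map binaryValue = volume.restrict (Icc (0 : ℝ) 1) := by
  have : IsProbabilityMeasure (coinLaw.map binaryValue) :=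
    Measure.isProbabilityMeasure_map measurable_binaryValue.aemeasurable
  have hp : IsProbabilityMeasure (volume.restrict (Icc (0 : ℝ) 1)) := ⟨by simp⟩
  refine Measure.ext_of_charFun (funext fun t => sub_eq_zero.1 ?_)
  set F : ℝ → ℂ := fun t => charFun (coinLaw.map binaryValue) t
    - charFun (volume.restrict (Icc (0 : ℝ) 1)) t with hF
  have hc : Continuous F := continuous_charFun.sub continuous_charFun
  have h0 : F 0 = 0 := by simp [hF]
  -- both functions solve the same equation, whose factor has norm at most one, so the difference
  -- is controlled by its values near `0`
  have hstep : ∀ s, ‖F s‖ ≤ ‖F (s / 2)‖ := by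
    intro s
    have : F s = (1 + Complex.exp (s / 2 * Complex.I)) / 2 * F (s / 2) := by
      simp only [hF]; rw [charFun_map_binaryValue s, charFun_volume_unit s]; ring
    rw [this, norm_mul]
    refine mul_le_of_le_one_left (norm_nonneg _) ?_
    rw [norm_div, Complex.norm_ofNat, div_le_one two_pos]
    refine (norm_add_le _ _).trans ?_
    rw [show ((s : ℂ) / 2 * Complex.I) = ((s / 2 : ℝ) : ℂ) * Complex.I by push_cast; ring,
      Complex.norm_exp_ofReal_mul_I]
    norm_num
  have hn : ∀ n : ℕ, ‖F t‖ ≤ ‖F (t / 2 ^ n)‖ := by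
    intro n
    induction n with
    | zero => simp
    | succ n ih => rw [pow_succ, ← div_div]; exact ih.trans (hstep _)
  have hlim : Tendsto (fun n : ℕ => ‖F (t / 2 ^ n)‖) atTop (𝓝 0) := by
    have h1 : Tendsto (fun n : ℕ => t / 2 ^ n) atTop (𝓝 0) :=
      tendsto_const_nhds.div_atTop (tendsto_pow_atTop_atTop_of_one_lt one_lt_two)
    have := (hc.tendsto 0).comp h1
    rw [h0] at this
    simpa using this.norm
  exact norm_le_zero_iff.1 (ge_of_tendsto' hlim hn)

/-! ### Digit vectors and scrambled points -/

/-- The point of the unit cube with the given binary digits. -/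
noncomputable def binaryPoint {d : ℕ} (x : Fin d → ℕ → Bool) : Fin d → ℝ :=
  fun j => binaryValue (x j)

theorem measurable_binaryPoint {d : ℕ} : Measurable (binaryPoint (d := d)) :=
  measurable_pi_lambda _ fun j => measurable_binaryValue.comp (measurable_pi_apply j)

theorem binaryPoint_mem_Icc {d : ℕ} (x : Fin d → ℕ → Bool) :
    binaryPoint x ∈ Icc (0 : Fin d → ℝ) 1 :=
  ⟨fun j => (binaryValue_mem_Icc (x j)).1, fun j => (binaryValue_mem_Icc (x j)).2⟩

theorem measurePreserving_binaryPoint (d : ℕ) : MeasurePreserving (binaryPoint (d := d))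
    (digitLaw d) (volume.restrict (Icc (0 : Fin d → ℝ) 1)) := by
  have h : volume.restrict (Icc (0 : Fin d → ℝ) 1)
      = Measure.pi fun _ : Fin d => volume.restrict (Icc (0 : ℝ) 1) := by
    rw [volume_pi, ← Measure.restrict_pi_pi, pi_univ_Icc]; rfl
  rw [h]
  exact measurePreserving_pi _ _ fun _ => ⟨measurable_binaryValue, map_binaryValue⟩

/-- Almost every point of the closed unit cube lies in the open unit cube. -/
theorem ae_mem_openCube (d : ℕ) : ∀ᵐ y ∂volume.restrict (Icc (0 : Fin d → ℝ) 1),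
    y ∈ openCube d := by
  have h : (openCube d) = pi univ fun _ : Fin d => Ioo (0 : ℝ) 1 := by
    ext y; simp [openCube]
  have h' : (openCube d : Set (Fin d → ℝ)) =ᵐ[volume] Icc (0 : Fin d → ℝ) 1 := by
    rw [h]; exact Measure.univ_pi_Ioo_ae_eq_Icc
  rw [← Measure.restrict_congr_set h']
  refine ae_restrict_mem ?_
  rw [h]
  exact MeasurableSet.univ_pi fun _ => measurableSet_Ioo

theorem isOpen_openCube (d : ℕ) : IsOpen (openCube d) := by
  have h : (openCube d) = pi univ fun _ : Fin d => Ioo (0 : ℝ) 1 := by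
    ext y; simp [openCube]
  rw [h]; exact isOpen_set_pi finite_univ fun _ _ => isOpen_Ioo

theorem openCube_subset_Icc (d : ℕ) : openCube d ⊆ Icc (0 : Fin d → ℝ) 1 :=
  fun _ hy => ⟨fun i => (hy i).1.le, fun i => (hy i).2.le⟩

theorem ae_binaryPoint_mem_openCube (d : ℕ) : ∀ᵐ x ∂digitLaw d, binaryPoint x ∈ openCube d :=
  (measurePreserving_binaryPoint d).quasiMeasurePreserving.ae (ae_mem_openCube d)

namespace SobolGenerator

variable {d : ℕ} (S : SobolGenerator d)

/-- The digits of point number `n` as bits. -/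
def bit (n : ℕ) (j : Fin d) (r : ℕ) : Bool := decide (S.digits n j r = 1)

/-- The digits of the scrambled point number `n`. -/
def scrambledBits (n : ℕ) (σ : Scrambling d) : Fin d → ℕ → Bool :=
  fun j r => xor (S.bit n j r) (σ (j, List.ofFn fun i : Fin r => S.digits n j i))

theorem zmod_two_add_ite (a : ZMod 2) (b : Bool) :
    (a + if b then 1 else 0) = if xor (decide (a = 1)) b then 1 else 0 := by
  revert a b; decide

theorem scrambled_eq (σ : Scrambling d) (n : ℕ) :
    S.scrambled σ n = binaryPoint (S.scrambledBits n σ) := by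
  ext j
  simp only [scrambled, binaryPoint, binaryValue]
  congr 1; ext r
  rw [zmod_two_add_ite]; rfl

theorem measurable_scrambledBits (n : ℕ) : Measurable (S.scrambledBits n) := by
  unfold scrambledBits; fun_prop

/-- Every scrambled point has independent fair digits. -/
theorem measurePreserving_scrambledBits (n : ℕ) :
    MeasurePreserving (S.scrambledBits n) (owenLaw d) (digitLaw d) := by
  refine ⟨S.measurable_scrambledBits n, ?_⟩
  have he : Function.Injective fun p : Fin d × ℕ =>
      ((p.1, List.ofFn fun i : Fin p.2 => S.digits n p.1 i) : Fin d × List (ZMod 2)) := by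
    rintro ⟨j, r⟩ ⟨j', r'⟩ h
    simp only [Prod.mk.injEq] at h
    have := congrArg List.length h.2
    simp only [List.length_ofFn] at this
    exact Prod.ext h.1 this
  have h1 := map_xor_infinitePi he fun p => S.bit n p.1 p.2
  have h2 := Measure.infinitePi_map_curry fun (_ : Fin d) (_ : ℕ) => fairCoin
  rw [← h1, Measure.map_map (MeasurableEquiv.measurable _) (by fun_prop),
    Measure.infinitePi_eq_pi (ι := Fin d)] at h2
  exact h2

/-- Every scrambled point is uniformly distributed on the unit cube. -/
theorem measurePreserving_scrambled (n : ℕ) : MeasurePreserving (fun σ => S.scrambled σ n)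
    (owenLaw d) (volume.restrict (Icc (0 : Fin d → ℝ) 1)) := by
  have := (measurePreserving_binaryPoint d).comp (S.measurePreserving_scrambledBits n)
  exact (funext fun σ => S.scrambled_eq σ n : (fun σ => S.scrambled σ n) = _) ▸ this

theorem scrambled_mem_Icc (σ : Scrambling d) (n : ℕ) :
    S.scrambled σ n ∈ Icc (0 : Fin d → ℝ) 1 := by
  rw [scrambled_eq]; exact binaryPoint_mem_Icc _

theorem point_mem_Icc (n : ℕ) : S.point n ∈ Icc (0 : Fin d → ℝ) 1 := by
  have : S.point n = S.scrambled (fun _ => false) n := by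
    ext j; simp [point, scrambled]
  rw [this]; exact S.scrambled_mem_Icc _ n

end SobolGenerator

/-! ### Haar components -/

section

/-- The kernel of the conditional expectation given the first `l` digits: `2 ^ l` if `x` and `y`
share these digits. -/
noncomputable def cellKernel (l : ℕ) (x y : ℕ → Bool) : ℝ :=
  if ∀ r < l, x r = y r then 2 ^ l else 0

/-- The kernel of the Haar projection of level `l`: the mean for `l = 0`, and the part of a
function that depends on the first `l` but not only on the first `l - 1` digits for `l ≥ 1`. -/
noncomputable def haarKernel : ℕ → (ℕ → Bool) → (ℕ → Bool) → ℝ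
  | 0, _, _ => 1
  | l + 1, x, y => cellKernel (l + 1) x y - cellKernel l x y

theorem cellKernel_zero (x y : ℕ → Bool) : cellKernel 0 x y = 1 := by simp [cellKernel]

theorem cellKernel_nonneg (l : ℕ) (x y : ℕ → Bool) : 0 ≤ cellKernel l x y := by
  unfold cellKernel; split_ifs <;> positivity

theorem cellKernel_le (l : ℕ) (x y : ℕ → Bool) : cellKernel l x y ≤ 2 ^ l := by
  unfold cellKernel; split_ifs <;> simp

theorem cellKernel_comm (l : ℕ) (x y : ℕ → Bool) : cellKernel l x y = cellKernel l y x := by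
  unfold cellKernel; simp only [eq_comm]

theorem haarKernel_comm (l : ℕ) (x y : ℕ → Bool) : haarKernel l x y = haarKernel l y x := by
  cases l with
  | zero => rfl
  | succ l => simp only [haarKernel, cellKernel_comm]

theorem sum_haarKernel (K : ℕ) (x y : ℕ → Bool) :
    ∑ l ∈ Finset.range (K + 1), haarKernel l x y = cellKernel K x y := by
  induction K with
  | zero => simp [haarKernel, cellKernel_zero]
  | succ K ih => rw [Finset.sum_range_succ, ih]; simp [haarKernel]

theorem haarKernel_succ (l : ℕ) (x y : ℕ → Bool) :
    haarKernel (l + 1) x y =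
      if ∀ r < l, x r = y r then (if x l = y l then 2 ^ l else - 2 ^ l) else 0 := by
  simp only [haarKernel, cellKernel]
  by_cases h : ∀ r < l, x r = y r
  · have : (∀ r < l + 1, x r = y r) ↔ x l = y l :=
      ⟨fun h' => h' l (Nat.lt_succ_self l), fun h' r hr => by
        rcases Nat.lt_succ_iff_lt_or_eq.1 hr with h1 | rfl
        exacts [h r h1, h']⟩
    rw [if_pos h, if_pos h]
    simp only [this]
    split_ifs <;> ring
  · have : ¬ ∀ r < l + 1, x r = y r := fun h' => h fun r hr => h' r (hr.trans (Nat.lt_succ_self l))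
    rw [if_neg this, if_neg h, if_neg h, sub_zero]

theorem abs_haarKernel (l : ℕ) (x y : ℕ → Bool) : |haarKernel l x y| = cellKernel (l - 1) x y := by
  cases l with
  | zero => simp [haarKernel, cellKernel_zero]
  | succ l =>
    rw [haarKernel_succ]
    simp only [cellKernel, Nat.add_sub_cancel]
    split_ifs <;> simp

theorem haarKernel_flipDigit (l : ℕ) (x y : ℕ → Bool) :
    haarKernel (l + 1) (flipDigit l x) y = - haarKernel (l + 1) x y := by
  rw [haarKernel_succ, haarKernel_succ]
  have h1 : (∀ r < l, flipDigit l x r = y r) ↔ ∀ r < l, x r = y r :=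
    forall₂_congr fun r hr => by simp [flipDigit, hr.ne]
  have h2 : flipDigit l x l = y l ↔ ¬ x l = y l := by
    cases h : x l <;> cases h' : y l <;> simp [flipDigit, h]
  simp only [h1, h2]
  split_ifs <;> simp_all

theorem measurable_cellKernel (l : ℕ) :
    Measurable fun p : (ℕ → Bool) × (ℕ → Bool) => cellKernel l p.1 p.2 := by
  unfold cellKernel
  refine Measurable.ite ?_ measurable_const measurable_const
  have : {p : (ℕ → Bool) × (ℕ → Bool) | ∀ r < l, p.1 r = p.2 r} =
      ⋂ r : ℕ, ⋂ _ : r < l, {p | p.1 r = p.2 r} := by ext; simp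
  rw [this]
  exact MeasurableSet.iInter fun r => MeasurableSet.iInter fun _ =>
    measurableSet_eq_fun (by fun_prop) (by fun_prop)

theorem measurable_haarKernel (l : ℕ) :
    Measurable fun p : (ℕ → Bool) × (ℕ → Bool) => haarKernel l p.1 p.2 := by
  cases l with
  | zero => exact measurable_const
  | succ l => exact (measurable_cellKernel (l + 1)).sub (measurable_cellKernel l)

theorem integral_cellKernel (l : ℕ) (x : ℕ → Bool) : ∫ y, cellKernel l x y ∂coinLaw = 1 := by
  have hset : {y : ℕ → Bool | ∀ r < l, x r = y r}
      = (Finset.range l : Set ℕ).pi fun r => {x r} := by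
    ext y; simp [Set.mem_pi, eq_comm]
  have hm : MeasurableSet {y : ℕ → Bool | ∀ r < l, x r = y r} := by
    rw [hset]
    exact MeasurableSet.pi (Finset.countable_toSet _) fun _ _ => measurableSet_singleton _
  have h1 : (fun y => cellKernel l x y) =
      {y : ℕ → Bool | ∀ r < l, x r = y r}.indicator fun _ => (2 : ℝ) ^ l := by
    ext y; simp [cellKernel, indicator]
  have hc : ∀ b : Bool, fairCoin {b} = 2⁻¹ := by
    intro b
    rw [PMF.toMeasure_apply_singleton _ _ (measurableSet_singleton b)]; simp
  rw [h1, integral_indicator_const _ hm, hset, Measure.real, Measure.infinitePi_pi _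
    (fun _ _ => measurableSet_singleton _)]
  simp only [hc, Finset.prod_const, Finset.card_range, ENNReal.toReal_pow, ENNReal.toReal_inv,
    ENNReal.toReal_ofNat, smul_eq_mul]
  rw [← mul_pow]; norm_num

variable {d : ℕ}

instance : IsProbabilityMeasure (digitLaw d) := Measure.pi.instIsProbabilityMeasure _

instance : SigmaFinite (digitLaw d) := IsFiniteMeasure.toSigmaFinite _

/-- The part of `Φ` that belongs to the Haar level `lev j` in coordinate `j`, for all `j`. -/
noncomputable def haarComponent (Φ : (Fin d → ℕ → Bool) → ℝ) (lev : Fin d → ℕ)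
    (x : Fin d → ℕ → Bool) : ℝ :=
  ∫ y, Φ y * ∏ j, haarKernel (lev j) (x j) (y j) ∂digitLaw d

/-- The product kernel that bounds the Haar kernel. -/
noncomputable def boxKernel (lev : Fin d → ℕ) (x y : Fin d → ℕ → Bool) : ℝ :=
  ∏ j, cellKernel (lev j) (x j) (y j)

theorem boxKernel_nonneg (lev : Fin d → ℕ) (x y : Fin d → ℕ → Bool) : 0 ≤ boxKernel lev x y :=
  Finset.prod_nonneg fun _ _ => cellKernel_nonneg _ _ _

theorem boxKernel_comm (lev : Fin d → ℕ) (x y : Fin d → ℕ → Bool) :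
    boxKernel lev x y = boxKernel lev y x :=
  Finset.prod_congr rfl fun _ _ => cellKernel_comm _ _ _

theorem boxKernel_le (lev : Fin d → ℕ) (x y : Fin d → ℕ → Bool) :
    boxKernel lev x y ≤ ∏ j, 2 ^ lev j :=
  Finset.prod_le_prod (fun _ _ => cellKernel_nonneg _ _ _) fun _ _ => cellKernel_le _ _ _

theorem boxKernel_of_forall {lev : Fin d → ℕ} {x y : Fin d → ℕ → Bool}
    (h : ∀ j, ∀ r < lev j, x j r = y j r) : boxKernel lev x y = ∏ j, 2 ^ lev j :=
  Finset.prod_congr rfl fun j _ => if_pos (h j)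

theorem boxKernel_of_not_forall {lev : Fin d → ℕ} {x y : Fin d → ℕ → Bool}
    (h : ¬ ∀ j, ∀ r < lev j, x j r = y j r) : boxKernel lev x y = 0 := by
  push Not at h
  obtain ⟨j, r, hr, hne⟩ := h
  exact Finset.prod_eq_zero (Finset.mem_univ j) (if_neg fun h => hne (h r hr))

theorem abs_prod_haarKernel (lev : Fin d → ℕ) (x y : Fin d → ℕ → Bool) :
    |∏ j, haarKernel (lev j) (x j) (y j)| = boxKernel (fun j => lev j - 1) x y := by
  rw [Finset.abs_prod]; exact Finset.prod_congr rfl fun j _ => abs_haarKernel _ _ _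

theorem measurable_boxKernel (lev : Fin d → ℕ) : Measurable
    fun p : (Fin d → ℕ → Bool) × (Fin d → ℕ → Bool) => boxKernel lev p.1 p.2 :=
  Finset.measurable_prod _ fun j _ => (measurable_cellKernel (lev j)).comp
    (f := fun p : (Fin d → ℕ → Bool) × (Fin d → ℕ → Bool) => (p.1 j, p.2 j)) (by fun_prop)

theorem measurable_prod_haarKernel (lev : Fin d → ℕ) : Measurable
    fun p : (Fin d → ℕ → Bool) × (Fin d → ℕ → Bool) =>
      ∏ j, haarKernel (lev j) (p.1 j) (p.2 j) :=
  Finset.measurable_prod _ fun j _ => (measurable_haarKernel (lev j)).comp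
    (f := fun p : (Fin d → ℕ → Bool) × (Fin d → ℕ → Bool) => (p.1 j, p.2 j)) (by fun_prop)

theorem integral_boxKernel (lev : Fin d → ℕ) (x : Fin d → ℕ → Bool) :
    ∫ y, boxKernel lev x y ∂digitLaw d = 1 := by
  have := integral_fintype_prod_eq_prod (μ := fun _ : Fin d => coinLaw)
    (fun j y => cellKernel (lev j) (x j) y)
  simp only [integral_cellKernel, Finset.prod_const_one] at this
  exact this

theorem integrable_mul_boxKernel {g : (Fin d → ℕ → Bool) → ℝ} (hg : Integrable g (digitLaw d))
    (lev : Fin d → ℕ) (x : Fin d → ℕ → Bool) :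
    Integrable (fun y => g y * boxKernel lev x y) (digitLaw d) := by
  refine hg.mul_bdd (c := ∏ j, 2 ^ lev j) ?_ (ae_of_all _ fun y => ?_)
  · exact ((measurable_boxKernel lev).comp measurable_prodMk_left).aestronglyMeasurable
  · rw [Real.norm_eq_abs, abs_of_nonneg (boxKernel_nonneg _ _ _)]
    exact boxKernel_le _ _ _

theorem integrable_mul_prod_haarKernel {g : (Fin d → ℕ → Bool) → ℝ}
    (hg : Integrable g (digitLaw d)) (lev : Fin d → ℕ) (x : Fin d → ℕ → Bool) :
    Integrable (fun y => g y * ∏ j, haarKernel (lev j) (x j) (y j)) (digitLaw d) := by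
  refine hg.mul_bdd (c := ∏ j, 2 ^ (lev j - 1)) ?_ (ae_of_all _ fun y => ?_)
  · exact ((measurable_prod_haarKernel lev).comp measurable_prodMk_left).aestronglyMeasurable
  · rw [Real.norm_eq_abs, abs_prod_haarKernel]
    exact boxKernel_le _ _ _

theorem measurable_haarComponent {Φ : (Fin d → ℕ → Bool) → ℝ} (hΦ : Measurable Φ)
    (lev : Fin d → ℕ) : Measurable (haarComponent Φ lev) := by
  have : Measurable fun p : (Fin d → ℕ → Bool) × (Fin d → ℕ → Bool) =>
      Φ p.2 * ∏ j, haarKernel (lev j) (p.1 j) (p.2 j) :=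
    (hΦ.comp measurable_snd).mul (measurable_prod_haarKernel lev)
  exact (this.stronglyMeasurable.integral_prod_right' (ν := digitLaw d)).measurable

theorem abs_haarComponent_le {Φ : (Fin d → ℕ → Bool) → ℝ} (hΦ : Integrable Φ (digitLaw d))
    (lev : Fin d → ℕ) (x : Fin d → ℕ → Bool) :
    |haarComponent Φ lev x| ≤ (∫ y, |Φ y| ∂digitLaw d) * ∏ j, 2 ^ (lev j - 1) := by
  rw [← integral_mul_const]
  refine (abs_integral_le_integral_abs).trans (integral_mono
    (integrable_mul_prod_haarKernel hΦ lev x).abs (hΦ.abs.mul_const _) fun y => ?_)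
  simp only [abs_mul, abs_prod_haarKernel]
  exact mul_le_mul_of_nonneg_left (boxKernel_le _ _ _) (abs_nonneg _)

/-- The Haar components of level at most `K` in every coordinate add up to the conditional
expectation given the first `K` digits of every coordinate. -/
theorem sum_haarComponent {Φ : (Fin d → ℕ → Bool) → ℝ} (hΦ : Integrable Φ (digitLaw d)) (K : ℕ)
    (x : Fin d → ℕ → Bool) :
    ∑ lev ∈ Fintype.piFinset fun _ : Fin d => Finset.range (K + 1), haarComponent Φ lev x =
      ∫ y, Φ y * boxKernel (fun _ => K) x y ∂digitLaw d := by
  unfold haarComponent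
  rw [← integral_finsetSum _ fun lev _ => integrable_mul_prod_haarKernel hΦ lev x]
  refine integral_congr_ae (ae_of_all _ fun y => ?_)
  simp only [boxKernel, ← Finset.mul_sum, ← sum_haarKernel]
  rw [Finset.prod_univ_sum]

theorem haarComponent_zero (Φ : (Fin d → ℕ → Bool) → ℝ) (x : Fin d → ℕ → Bool) :
    haarComponent Φ 0 x = ∫ y, Φ y ∂digitLaw d := by
  simp [haarComponent, haarKernel]

/-- The averages over the cells around a point tend to the value there if the function is
continuous at the point. -/
theorem tendsto_integral_boxKernel {φ : (Fin d → ℝ) → ℝ}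
    (hφ : Integrable (fun x => φ (binaryPoint x)) (digitLaw d)) {x : Fin d → ℕ → Bool}
    (hx : ContinuousAt φ (binaryPoint x)) :
    Tendsto (fun K : ℕ => ∫ y, φ (binaryPoint y) * boxKernel (fun _ => K) x y ∂digitLaw d) atTop
      (𝓝 (φ (binaryPoint x))) := by
  rw [Metric.tendsto_atTop]
  intro ε hε
  obtain ⟨δ, hδ, hc⟩ := Metric.continuousAt_iff.1 hx (ε / 2) (half_pos hε)
  obtain ⟨K₀, hK₀⟩ := exists_pow_lt_of_lt_one hδ (by norm_num : (1 / 2 : ℝ) < 1)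
  refine ⟨K₀, fun K hK => ?_⟩
  have h1 : φ (binaryPoint x) = ∫ y, φ (binaryPoint x) * boxKernel (fun _ => K) x y ∂digitLaw d := by
    rw [integral_const_mul, integral_boxKernel, mul_one]
  have hi := integrable_mul_boxKernel (integrable_const (μ := digitLaw d) (1 : ℝ)) (fun _ => K) x
  simp only [one_mul] at hi
  rw [Real.dist_eq, h1, ← integral_sub (integrable_mul_boxKernel hφ _ _) (hi.const_mul _)]
  have h2 : ∀ y, |φ (binaryPoint y) * boxKernel (fun _ => K) x y
      - φ (binaryPoint x) * boxKernel (fun _ => K) x y| ≤ ε / 2 * boxKernel (fun _ => K) x y := by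
    intro y
    rw [← sub_mul, abs_mul, abs_of_nonneg (boxKernel_nonneg _ _ _)]
    by_cases h : ∀ j, ∀ r < K, x j r = y j r
    · refine mul_le_mul_of_nonneg_right ?_ (boxKernel_nonneg _ _ _)
      rw [← Real.dist_eq]
      refine (hc ?_).le
      rw [dist_pi_lt_iff hδ]
      intro j
      rw [Real.dist_eq]
      refine (abs_binaryValue_sub_le (n := K) fun r hr => (h j r hr).symm).trans_lt ?_
      refine lt_of_le_of_lt ?_ hK₀
      rw [← one_div_pow]
      exact pow_le_pow_of_le_one (by norm_num) (by norm_num) hK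
    · rw [boxKernel_of_not_forall h]; simp
  calc |∫ y, (φ (binaryPoint y) * boxKernel (fun _ => K) x y
      - φ (binaryPoint x) * boxKernel (fun _ => K) x y) ∂digitLaw d|
      ≤ ∫ y, ε / 2 * boxKernel (fun _ => K) x y ∂digitLaw d :=
        abs_integral_le_integral_abs.trans (integral_mono
          (((integrable_mul_boxKernel hφ _ _).sub (hi.const_mul _)).abs) (hi.const_mul _) h2)
    _ = ε / 2 := by rw [integral_const_mul, integral_boxKernel, mul_one]
    _ < ε := half_lt_self hε

/-- For each coordinate `j ∈ v`, digit number `lev j` (counted from `1`) is turned. -/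
def flipDigits (lev : Fin d → ℕ) (v : Finset (Fin d)) (x : Fin d → ℕ → Bool) : Fin d → ℕ → Bool :=
  fun j => if j ∈ v then flipDigit (lev j - 1) (x j) else x j

theorem measurePreserving_flipDigits (lev : Fin d → ℕ) (v : Finset (Fin d)) :
    MeasurePreserving (flipDigits lev v) (digitLaw d) (digitLaw d) := by
  refine measurePreserving_pi (f := fun j x => if j ∈ v then flipDigit (lev j - 1) x else x)
    (fun _ => coinLaw) (fun _ => coinLaw) fun j => ?_
  by_cases h : j ∈ v
  · simpa only [h, if_true] using measurePreserving_flipDigit _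
  · simp only [h, if_false]
    exact MeasurePreserving.id coinLaw

/-- The alternating sum of the values of `Φ` over the turnings of the digits `lev j`, `j ∈ u`. -/
noncomputable def mixedDifference (Φ : (Fin d → ℕ → Bool) → ℝ) (lev : Fin d → ℕ)
    (u : Finset (Fin d)) (x : Fin d → ℕ → Bool) : ℝ :=
  ∑ v ∈ u.powerset, (-1) ^ v.card * Φ (flipDigits lev v x)

theorem prod_haarKernel_flipDigits {lev : Fin d → ℕ} {v : Finset (Fin d)}
    (hv : ∀ j ∈ v, lev j ≠ 0) (x y : Fin d → ℕ → Bool) :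
    ∏ j, haarKernel (lev j) (x j) (flipDigits lev v y j) =
      (-1) ^ v.card * ∏ j, haarKernel (lev j) (x j) (y j) := by
  have h : ∀ j, haarKernel (lev j) (x j) (flipDigits lev v y j) =
      (if j ∈ v then -1 else 1) * haarKernel (lev j) (x j) (y j) := by
    intro j
    by_cases hj : j ∈ v
    · obtain ⟨l, hl⟩ := Nat.exists_eq_succ_of_ne_zero (hv j hj)
      simp only [flipDigits, hj, if_true, hl, Nat.succ_eq_add_one, Nat.add_sub_cancel]
      rw [haarKernel_comm, haarKernel_flipDigit, haarKernel_comm]; ring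
    · simp [flipDigits, hj]
  simp_rw [h]
  rw [Finset.prod_mul_distrib, Finset.prod_ite_mem, Finset.univ_inter, Finset.prod_const]

theorem integrable_comp_flipDigits {Φ : (Fin d → ℕ → Bool) → ℝ} (hΦ : Integrable Φ (digitLaw d))
    (lev : Fin d → ℕ) (v : Finset (Fin d)) :
    Integrable (fun x => Φ (flipDigits lev v x)) (digitLaw d) :=
  (measurePreserving_flipDigits lev v).integrable_comp_of_integrable hΦ

/-- Turning a digit changes the sign of the Haar kernel, so that the Haar component is an average
of mixed differences. -/
theorem integral_mixedDifference_mul {Φ : (Fin d → ℕ → Bool) → ℝ} (hΦm : Measurable Φ)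
    (hΦ : Integrable Φ (digitLaw d)) (lev : Fin d → ℕ) {u : Finset (Fin d)}
    (hu : ∀ j ∈ u, lev j ≠ 0) (x : Fin d → ℕ → Bool) :
    ∫ y, mixedDifference Φ lev u y * ∏ j, haarKernel (lev j) (x j) (y j) ∂digitLaw d =
      2 ^ u.card * haarComponent Φ lev x := by
  unfold mixedDifference
  simp_rw [Finset.sum_mul]
  rw [integral_finsetSum]
  · have : ∀ v ∈ u.powerset, ∫ y, (-1) ^ v.card * Φ (flipDigits lev v y)
        * ∏ j, haarKernel (lev j) (x j) (y j) ∂digitLaw d = haarComponent Φ lev x := by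
      intro v hv
      have hmp := measurePreserving_flipDigits lev v
      unfold haarComponent
      have hmap := integral_map (μ := digitLaw d) hmp.measurable.aemeasurable
        (f := fun y => Φ y * ∏ j, haarKernel (lev j) (x j) (y j)) (hΦm.mul
        ((measurable_prod_haarKernel lev).comp measurable_prodMk_left)).aestronglyMeasurable
      rw [hmp.map_eq] at hmap
      rw [hmap]
      refine integral_congr_ae (ae_of_all _ fun y => ?_)
      dsimp only
      rw [prod_haarKernel_flipDigits fun j hj => hu j (Finset.mem_powerset.1 hv hj)]
      ring
    rw [Finset.sum_congr rfl this, Finset.sum_const, Finset.card_powerset, nsmul_eq_mul]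
    push_cast; rfl
  · intro v _
    exact integrable_mul_prod_haarKernel ((integrable_comp_flipDigits hΦ lev v).const_mul _) lev x

/-- The second moment of a Haar component is at most that of the mixed difference. -/
theorem integral_haarComponent_sq_le {Φ : (Fin d → ℕ → Bool) → ℝ} (hΦm : Measurable Φ)
    (hΦ : Integrable Φ (digitLaw d)) (lev : Fin d → ℕ) {u : Finset (Fin d)}
    (hu : ∀ j ∈ u, lev j ≠ 0)
    (hsq : Integrable (fun y => mixedDifference Φ lev u y ^ 2) (digitLaw d)) :
    ∫ x, haarComponent Φ lev x ^ 2 ∂digitLaw d ≤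
      ∫ y, mixedDifference Φ lev u y ^ 2 ∂digitLaw d := by
  set g := mixedDifference Φ lev u with hg
  set κ : Fin d → ℕ := fun j => lev j - 1
  have hgi : Integrable g (digitLaw d) :=
    integrable_finsetSum _ fun v _ => (integrable_comp_flipDigits hΦ lev v).const_mul _
  have hpt : ∀ x, haarComponent Φ lev x ^ 2 ≤ ∫ y, g y ^ 2 * boxKernel κ x y ∂digitLaw d := by
    intro x
    set c := ∫ y, |g y| * boxKernel κ x y ∂digitLaw d with hc
    have h1 : |haarComponent Φ lev x| ≤ c := by
      have h2 : |2 ^ u.card * haarComponent Φ lev x| ≤ c := by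
        rw [← integral_mixedDifference_mul hΦm hΦ lev hu x]
        refine abs_integral_le_integral_abs.trans (le_of_eq ?_)
        simp_rw [abs_mul, abs_prod_haarKernel]; rfl
      refine le_trans ?_ h2
      rw [abs_mul]
      refine le_mul_of_one_le_left (abs_nonneg _) ?_
      rw [abs_of_pos (by positivity)]
      exact one_le_pow₀ one_le_two
    have hi1 := integrable_mul_boxKernel hgi.abs κ x
    have hi2 := integrable_mul_boxKernel hsq κ x
    have hi0 := integrable_mul_boxKernel (integrable_const (μ := digitLaw d) (1 : ℝ)) κ x
    simp only [one_mul] at hi0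
    -- the variance with respect to the probability density `boxKernel κ x` is nonnegative
    have h3 : 0 ≤ ∫ y, (|g y| - c) ^ 2 * boxKernel κ x y ∂digitLaw d :=
      integral_nonneg fun y => mul_nonneg (sq_nonneg _) (boxKernel_nonneg _ _ _)
    have h4 : ∀ y, (|g y| - c) ^ 2 * boxKernel κ x y = g y ^ 2 * boxKernel κ x y
        - 2 * c * (|g y| * boxKernel κ x y) + c ^ 2 * boxKernel κ x y := by
      intro y; rw [sub_sq, sq_abs]; ring
    simp_rw [h4] at h3
    rw [integral_add (f := fun y => g y ^ 2 * boxKernel κ x y - 2 * c * (|g y| * boxKernel κ x y))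
      (hi2.sub (hi1.const_mul _)) (hi0.const_mul _), integral_sub hi2 (hi1.const_mul _),
      integral_const_mul, integral_const_mul, integral_boxKernel, ← hc] at h3
    have h5 : haarComponent Φ lev x ^ 2 ≤ c ^ 2 := by
      rw [← sq_abs]; exact pow_le_pow_left₀ (abs_nonneg _) h1 2
    linarith
  have hprod : Integrable (fun p : (Fin d → ℕ → Bool) × (Fin d → ℕ → Bool) =>
      g p.2 ^ 2 * boxKernel κ p.1 p.2) ((digitLaw d).prod (digitLaw d)) := by
    refine (hsq.comp_snd (digitLaw d)).mul_bdd (c := ∏ j, 2 ^ κ j)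
      (measurable_boxKernel κ).aestronglyMeasurable (ae_of_all _ fun p => ?_)
    rw [Real.norm_eq_abs, abs_of_nonneg (boxKernel_nonneg _ _ _)]
    exact boxKernel_le _ _ _
  have hbd : Integrable (fun x => haarComponent Φ lev x ^ 2) (digitLaw d) := by
    refine Integrable.of_bound (C := ((∫ y, |Φ y| ∂digitLaw d) * ∏ j, 2 ^ (lev j - 1)) ^ 2)
      ((measurable_haarComponent hΦm lev).pow_const 2).aestronglyMeasurable
      (ae_of_all _ fun x => ?_)
    rw [Real.norm_eq_abs, abs_pow]
    exact pow_le_pow_left₀ (abs_nonneg _) (abs_haarComponent_le hΦ lev x) 2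
  calc ∫ x, haarComponent Φ lev x ^ 2 ∂digitLaw d
      ≤ ∫ x, ∫ y, g y ^ 2 * boxKernel κ x y ∂digitLaw d ∂digitLaw d :=
        integral_mono hbd hprod.integral_prod_left hpt
    _ = ∫ y, ∫ x, g y ^ 2 * boxKernel κ x y ∂digitLaw d ∂digitLaw d :=
        integral_integral_swap hprod
    _ = ∫ y, g y ^ 2 ∂digitLaw d := by
        refine integral_congr_ae (ae_of_all _ fun y => ?_)
        simp only [integral_const_mul, boxKernel_comm κ _ y, integral_boxKernel, mul_one]

end

/-! ### Mixed differences under the boundary growth condition -/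

/-- The distance of `s ∈ [0, 1]` to the boundary of the unit interval. -/
noncomputable def boundaryDist (s : ℝ) : ℝ := min s (1 - s)

theorem boundaryDist_pos {s : ℝ} (hs : 0 < s ∧ s < 1) : 0 < boundaryDist s :=
  lt_min hs.1 (by linarith [hs.2])

theorem boundaryDist_le_one {s : ℝ} (hs : 0 < s ∧ s < 1) : boundaryDist s ≤ 1 :=
  (min_le_left _ _).trans hs.2.le

theorem boundaryWeight_pos {d : ℕ} (A : Fin d → ℝ) (u : Finset (Fin d)) {y : Fin d → ℝ}
    (hy : y ∈ openCube d) : 0 < boundaryWeight A u y :=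
  Finset.prod_pos fun i _ => Real.rpow_pos_of_pos (boundaryDist_pos (hy i)) _

theorem boundaryWeight_mono {d : ℕ} {A A' : Fin d → ℝ} (h : ∀ i, A i ≤ A' i) (u : Finset (Fin d))
    {y : Fin d → ℝ} (hy : y ∈ openCube d) : boundaryWeight A u y ≤ boundaryWeight A' u y := by
  refine Finset.prod_le_prod (fun i _ => (Real.rpow_pos_of_pos (boundaryDist_pos (hy i)) _).le)
    fun i _ => Real.rpow_le_rpow_of_exponent_ge (boundaryDist_pos (hy i))
      (boundaryDist_le_one (hy i)) ?_
  linarith [h i]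

theorem BoundaryGrowth.mono {d : ℕ} {φ : (Fin d → ℝ) → ℝ} {B B' : ℝ} {A A' : Fin d → ℝ}
    (hφ : BoundaryGrowth φ B A) (hB' : 0 ≤ B') (hB : B ≤ B') (h : ∀ i, A i ≤ A' i) :
    BoundaryGrowth φ B' A' := by
  obtain ⟨D, h1, h2, h3, h4⟩ := hφ
  refine ⟨D, h1, h2, h3, fun u y hy => (h4 u y hy).trans ?_⟩
  exact mul_le_mul hB (boundaryWeight_mono h u hy) (boundaryWeight_pos A u hy).le hB'

theorem BoundaryGrowth.congr {d : ℕ} {φ ψ : (Fin d → ℝ) → ℝ} {B : ℝ} {A : Fin d → ℝ}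
    (hφ : BoundaryGrowth φ B A) (h : ∀ y ∈ openCube d, ψ y = φ y) : BoundaryGrowth ψ B A := by
  obtain ⟨D, h1, h2, h3, h4⟩ := hφ
  exact ⟨D, fun y hy => (h1 y hy).trans (h y hy).symm, h2, h3, h4⟩

theorem BoundaryGrowth.continuousOn {d : ℕ} {φ : (Fin d → ℝ) → ℝ} {B : ℝ} {A : Fin d → ℝ}
    (hφ : BoundaryGrowth φ B A) : ContinuousOn φ (openCube d) := by
  obtain ⟨D, h1, h2, -, -⟩ := hφ
  exact (h2 ∅).congr fun y hy => (h1 y hy).symm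

theorem BoundaryGrowth.abs_le {d : ℕ} {φ : (Fin d → ℝ) → ℝ} {B : ℝ} {A : Fin d → ℝ}
    (hφ : BoundaryGrowth φ B A) {y : Fin d → ℝ} (hy : y ∈ openCube d) :
    |φ y| ≤ B * boundaryWeight A ∅ y := by
  obtain ⟨D, h1, -, -, h4⟩ := hφ
  rw [← h1 y hy]; exact h4 ∅ y hy

/-- The mean value theorem controls the increment by `|a - b| m ^ (-A - 1)`, where `m` is the
distance of the interval to the boundary, and the values themselves by `m ^ (-A)`; the bound
interpolates between the two. -/
theorem abs_sub_le_of_growth {F F' : ℝ → ℝ} {C A θ a b : ℝ} (hA : 0 ≤ A)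
    (hθ : θ ∈ Icc (0 : ℝ) 1) (ha : 0 < a ∧ a < 1) (hb : 0 < b ∧ b < 1)
    (hF : ∀ s, 0 < s ∧ s < 1 → HasDerivAt F (F' s) s)
    (h0 : ∀ s, 0 < s ∧ s < 1 → |F s| ≤ C * boundaryDist s ^ (-A))
    (h1 : ∀ s, 0 < s ∧ s < 1 → |F' s| ≤ C * boundaryDist s ^ (-A - 1)) :
    |F a - F b| ≤
      C * (2 * |a - b| ^ θ * (min (boundaryDist a) (boundaryDist b)) ^ (-A - θ)) := by
  set m := min (boundaryDist a) (boundaryDist b) with hm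
  have hmp : 0 < m := lt_min (boundaryDist_pos ha) (boundaryDist_pos hb)
  have hC : 0 ≤ C := by
    have := (abs_nonneg _).trans (h0 a ha)
    exact nonneg_of_mul_nonneg_left this (Real.rpow_pos_of_pos (boundaryDist_pos ha) _)
  have hms : ∀ s ∈ uIcc a b, (0 < s ∧ s < 1) ∧ m ≤ boundaryDist s := by
    intro s hs
    have hle : min a b ≤ s ∧ s ≤ max a b := hs
    have e1 : m ≤ min a b := le_min ((min_le_left _ _).trans (min_le_left _ _))
      ((min_le_right _ _).trans (min_le_left _ _))
    have e2 : m ≤ 1 - max a b := by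
      have f1 : m ≤ 1 - a := (min_le_left _ _).trans (min_le_right _ _)
      have f2 : m ≤ 1 - b := (min_le_right _ _).trans (min_le_right _ _)
      rcases max_cases a b with h | h <;> linarith
    exact ⟨⟨by linarith, by linarith⟩, le_min (by linarith) (by linarith)⟩
  have hneg : ∀ {s p : ℝ}, m ≤ s → p ≤ 0 → s ^ p ≤ m ^ p := fun hs hp =>
    Real.rpow_le_rpow_of_nonpos hmp hs hp
  have key1 : |F a - F b| ≤ C * m ^ (-A - 1) * |a - b| := by
    have := (convex_uIcc a b).norm_image_sub_le_of_norm_hasDerivWithin_le (f := F) (f' := F')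
      (C := C * m ^ (-A - 1)) (x := b) (y := a) (fun s hs => (hF s (hms s hs).1).hasDerivWithinAt)
      (fun s hs => (h1 s (hms s hs).1).trans
        (mul_le_mul_of_nonneg_left (hneg (hms s hs).2 (by linarith)) hC))
      right_mem_uIcc left_mem_uIcc
    simpa only [Real.norm_eq_abs] using this
  have key2 : |F a - F b| ≤ 2 * (C * m ^ (-A)) := by
    have e1 := (h0 a ha).trans (mul_le_mul_of_nonneg_left
      (hneg (hms a left_mem_uIcc).2 (by linarith : -A ≤ 0)) hC)
    have e2 := (h0 b hb).trans (mul_le_mul_of_nonneg_left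
      (hneg (hms b right_mem_uIcc).2 (by linarith : -A ≤ 0)) hC)
    have := abs_sub (F a) (F b)
    linarith
  set q := |a - b| / m with hq
  have hq0 : 0 ≤ q := by positivity
  have hrew : C * (2 * |a - b| ^ θ * m ^ (-A - θ)) = 2 * (C * m ^ (-A)) * q ^ θ := by
    rw [hq, Real.div_rpow (abs_nonneg _) hmp.le, Real.rpow_sub hmp]; ring
  have hCm : 0 ≤ C * m ^ (-A) := by positivity
  rw [hrew]
  rcases le_total q 1 with h | h
  · calc |F a - F b| ≤ C * m ^ (-A - 1) * |a - b| := key1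
      _ = C * m ^ (-A) * q := by
        rw [hq, Real.rpow_sub hmp, Real.rpow_one]; ring
      _ ≤ C * m ^ (-A) * q ^ θ := by
        refine mul_le_mul_of_nonneg_left ?_ hCm
        rcases hq0.eq_or_lt with h0 | h0
        · rw [← h0]; exact Real.rpow_nonneg le_rfl _
        · simpa using Real.rpow_le_rpow_of_exponent_ge h0 h hθ.2
      _ ≤ 2 * (C * m ^ (-A)) * q ^ θ := by
        have : 0 ≤ q ^ θ := by positivity
        nlinarith
  · exact key2.trans (le_mul_of_one_le_right (by positivity) (Real.one_le_rpow h hθ.1))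

theorem piecewise_mem_openCube {d : ℕ} {x x' : Fin d → ℝ} (hx : x ∈ openCube d)
    (hx' : x' ∈ openCube d) (v : Finset (Fin d)) : v.piecewise x' x ∈ openCube d := by
  intro i
  by_cases h : i ∈ v
  · simpa [Finset.piecewise_eq_of_mem _ _ _ h] using hx' i
  · simpa [Finset.piecewise_eq_of_notMem _ _ _ h] using hx i

/-- The factor of coordinate `j` in the bound of the mixed difference over `u` of the mixed
partial derivative over `v`. -/
noncomputable def growthFactor {d : ℕ} (A θ : ℝ) (x' : Fin d → ℝ) (u v : Finset (Fin d))
    (x : Fin d → ℝ) (j : Fin d) : ℝ :=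
  if j ∈ u then 2 * |x j - x' j| ^ θ * (min (boundaryDist (x j)) (boundaryDist (x' j))) ^ (-A - θ)
  else boundaryDist (x j) ^ (-A - if j ∈ v then 1 else 0)

/-- Taking one difference after the other, each of them bounded by the growth of the derivative
in its coordinate, bounds the mixed difference by a product over the coordinates. -/
theorem abs_mixedDifference_le_prod {d : ℕ} {D : Finset (Fin d) → (Fin d → ℝ) → ℝ} {B A θ : ℝ}
    (hA : 0 ≤ A) (hθ : θ ∈ Icc (0 : ℝ) 1)
    (hD : ∀ u, ∀ j ∉ u, ∀ y ∈ openCube d,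
      HasDerivAt (fun s => D u (Function.update y j s)) (D (insert j u) y) (y j))
    (hB : ∀ u, ∀ y ∈ openCube d, |D u y| ≤ B * boundaryWeight (fun _ => A) u y)
    {x' : Fin d → ℝ} (hx' : x' ∈ openCube d) (u : Finset (Fin d)) :
    ∀ v : Finset (Fin d), Disjoint u v → ∀ x ∈ openCube d,
      |∑ w ∈ u.powerset, (-1) ^ w.card * D v (w.piecewise x' x)| ≤
        B * ∏ j, growthFactor A θ x' u v x j := by
  induction u using Finset.induction_on with
  | empty =>
    intro v _ x hx
    have : ∏ j, growthFactor A θ x' ∅ v x j = boundaryWeight (fun _ => A) v x := by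
      refine Finset.prod_congr rfl fun j _ => ?_
      simp [growthFactor, boundaryDist]
    rw [this]
    simpa using hB v x hx
  | insert j u hj ih =>
    intro v hdis x hx
    have hjv : j ∉ v := fun h => Finset.disjoint_left.1 hdis (Finset.mem_insert_self j u) h
    have hdv : Disjoint u v := hdis.mono_left (Finset.subset_insert j u)
    have hdjv : Disjoint u (insert j v) := Finset.disjoint_insert_right.2 ⟨hj, hdv⟩
    have hup : ∀ s, 0 < s ∧ s < 1 → Function.update x j s ∈ openCube d := by
      intro s hs i
      rcases eq_or_ne i j with rfl | h
      · simpa using hs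
      · simpa [h] using hx i
    -- the difference over `u` as a function of coordinate `j`, to which the mean value theorem
    -- is applied
    set Δ : Finset (Fin d) → (Fin d → ℝ) → ℝ := fun v x =>
      ∑ w ∈ u.powerset, (-1) ^ w.card * D v (w.piecewise x' x) with hΔ
    have hpw : ∀ w ∈ u.powerset, ∀ s, w.piecewise x' (Function.update x j s) =
        Function.update (w.piecewise x' x) j s := by
      intro w hw s
      have hjw : j ∉ w := fun h => hj (Finset.mem_powerset.1 hw h)
      ext i
      rcases eq_or_ne i j with rfl | h
      · simp [Finset.piecewise, hjw]
      · simp [Finset.piecewise, h]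
    have hsplit : ∑ w ∈ (insert j u).powerset, (-1) ^ w.card * D v (w.piecewise x' x) =
        Δ v (Function.update x j (x j)) - Δ v (Function.update x j (x' j)) := by
      rw [Finset.sum_powerset_insert hj, Function.update_eq_self, sub_eq_add_neg,
        ← Finset.sum_neg_distrib]
      congr 1
      refine Finset.sum_congr rfl fun w hw => ?_
      have hjw : j ∉ w := fun h => hj (Finset.mem_powerset.1 hw h)
      rw [Finset.card_insert_of_notMem hjw, hpw w hw, pow_succ]
      have : (insert j w).piecewise x' x = Function.update (w.piecewise x' x) j (x' j) :=
        Finset.piecewise_insert _ _ _ _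
      rw [this]; ring
    have hderiv : ∀ s, 0 < s ∧ s < 1 → HasDerivAt (fun s => Δ v (Function.update x j s))
        (Δ (insert j v) (Function.update x j s)) s := by
      intro s hs
      refine HasDerivAt.fun_sum fun w hw => HasDerivAt.const_mul _ ?_
      have := hD v j hjv (w.piecewise x' (Function.update x j s))
        (piecewise_mem_openCube (hup s hs) hx' w)
      rw [hpw w hw] at this ⊢
      simp only [Function.update_idem, Function.update_self] at this
      refine this.congr_of_eventuallyEq (Eventually.of_forall fun t => ?_)
      dsimp only
      rw [hpw w hw]
    set C := B * ∏ i ∈ Finset.univ.erase j, growthFactor A θ x' u v x i with hC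
    have hfac : ∀ v', (∀ i, i ≠ j → (i ∈ v' ↔ i ∈ v)) → ∀ s,
        B * ∏ i, growthFactor A θ x' u v' (Function.update x j s) i =
        C * boundaryDist s ^ (-A - if j ∈ v' then 1 else 0) := by
      intro v' hv' s
      rw [← Finset.mul_prod_erase _ _ (Finset.mem_univ j), hC]
      have e1 : growthFactor A θ x' u v' (Function.update x j s) j =
          boundaryDist s ^ (-A - if j ∈ v' then 1 else 0) := by simp [growthFactor, hj]
      have e2 : ∏ i ∈ Finset.univ.erase j, growthFactor A θ x' u v' (Function.update x j s) i =
          ∏ i ∈ Finset.univ.erase j, growthFactor A θ x' u v x i := by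
        refine Finset.prod_congr rfl fun i hi => ?_
        have hne := Finset.ne_of_mem_erase hi
        simp [growthFactor, hne, hv' i hne]
      rw [e1, e2]; ring
    have hmain := abs_sub_le_of_growth (C := C) hA hθ (hx j) (hx' j) hderiv
      (fun s hs => by
        have := ih v hdv _ (hup s hs)
        rw [hfac v (fun _ _ => Iff.rfl) s] at this
        simpa [hjv] using this)
      (fun s hs => by
        have := ih (insert j v) hdjv _ (hup s hs)
        rw [hfac (insert j v) (fun i hi => by simp [hi]) s] at this
        simpa using this)
    rw [hsplit]
    refine hmain.trans (le_of_eq ?_)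
    rw [← Finset.mul_prod_erase _ _ (Finset.mem_univ j), hC]
    have e1 : growthFactor A θ x' (insert j u) v x j = 2 * |x j - x' j| ^ θ *
        (min (boundaryDist (x j)) (boundaryDist (x' j))) ^ (-A - θ) := by simp [growthFactor]
    have e2 : ∏ i ∈ Finset.univ.erase j, growthFactor A θ x' (insert j u) v x i =
        ∏ i ∈ Finset.univ.erase j, growthFactor A θ x' u v x i := by
      refine Finset.prod_congr rfl fun i hi => ?_
      have hne := Finset.ne_of_mem_erase hi
      simp [growthFactor, hne]
    rw [e1, e2]; ring

/-- The singularity of the boundary growth condition is integrable if the exponent is less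
than `1`. -/
theorem integrableOn_boundaryDist_rpow {s : ℝ} (hs : s < 1) :
    IntegrableOn (fun x => boundaryDist x ^ (-s)) (Icc (0 : ℝ) 1) := by
  rw [integrableOn_Icc_iff_integrableOn_Ioo]
  have h1 : IntegrableOn (fun x : ℝ => x ^ (-s)) (Ioo 0 1) :=
    (intervalIntegral.integrableOn_Ioo_rpow_iff one_pos).2 (by linarith)
  have h2 : IntegrableOn (fun x : ℝ => (1 - x) ^ (-s)) (Ioo 0 1) := by
    have := (intervalIntegral.intervalIntegrable_rpow' (a := 0) (b := 1)
      (by linarith : -1 < -s)).comp_sub_left 1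
    simp only [sub_zero, sub_self] at this
    have := (intervalIntegrable_iff_integrableOn_Ioo_of_le zero_le_one).1 this.symm
    exact this
  refine (h1.add h2).mono' ?_ ?_
  · refine Measurable.aestronglyMeasurable ?_
    unfold boundaryDist; fun_prop
  · refine (ae_restrict_iff' measurableSet_Ioo).2 (ae_of_all _ fun x hx => ?_)
    have e1 : 0 ≤ x ^ (-s) := Real.rpow_nonneg hx.1.le _
    have e2 : 0 ≤ (1 - x) ^ (-s) := Real.rpow_nonneg (by linarith [hx.2]) _
    rw [Real.norm_eq_abs, abs_of_nonneg (Real.rpow_nonneg (boundaryDist_pos hx).le _)]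
    simp only [Pi.add_apply]
    unfold boundaryDist
    rcases min_choice x (1 - x) with h | h <;> rw [h] <;> linarith

theorem integrable_boundaryDist_binaryValue {s : ℝ} (hs : s < 1) :
    Integrable (fun x => boundaryDist (binaryValue x) ^ (-s)) coinLaw := by
  have h := integrableOn_boundaryDist_rpow hs
  rw [IntegrableOn, ← map_binaryValue] at h
  exact h.comp_measurable measurable_binaryValue

theorem integrable_boundaryWeight_binaryPoint {d : ℕ} {A : ℝ} (hA : A < 1) :
    Integrable (fun x : Fin d → ℕ → Bool => boundaryWeight (fun _ => A) ∅ (binaryPoint x))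
      (digitLaw d) := by
  have := Integrable.fintype_prod (ι := Fin d) (μ := fun _ => coinLaw)
    (f := fun _ x => boundaryDist (binaryValue x) ^ (-A))
    fun _ => integrable_boundaryDist_binaryValue hA
  refine this.congr (ae_of_all _ fun x => ?_)
  simp [boundaryWeight, boundaryDist, binaryPoint]

theorem integrableOn_boundaryWeight {d : ℕ} {A : ℝ} (hA : A < 1) :
    IntegrableOn (fun y : Fin d → ℝ => boundaryWeight (fun _ => A) ∅ y) (Icc 0 1) := by
  rw [IntegrableOn, ← (measurePreserving_binaryPoint d).map_eq]
  refine (integrable_map_measure ?_ measurable_binaryPoint.aemeasurable).2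
    (integrable_boundaryWeight_binaryPoint hA)
  refine Measurable.aestronglyMeasurable ?_
  unfold boundaryWeight; fun_prop

/-- A function that satisfies the growth condition is integrable on the unit cube. -/
theorem BoundaryGrowth.integrableOn {d : ℕ} {φ : (Fin d → ℝ) → ℝ} {B A : ℝ}
    (hφ : BoundaryGrowth φ B fun _ => A) (hA : A < 1) :
    IntegrableOn φ (Icc 0 1) := by
  refine ((integrableOn_boundaryWeight hA).const_mul B).mono' ?_ ?_
  · have h1 : AEStronglyMeasurable φ (volume.restrict (openCube d)) :=
      hφ.continuousOn.aestronglyMeasurable (isOpen_openCube d).measurableSet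
    have h2 := (ae_mem_openCube d)
    rw [show volume.restrict (Icc (0 : Fin d → ℝ) 1) =
      (volume.restrict (Icc (0 : Fin d → ℝ) 1)).restrict (openCube d) from
      (Measure.restrict_eq_self_of_ae_mem h2).symm,
      Measure.restrict_restrict (isOpen_openCube d).measurableSet,
      inter_eq_left.2 (openCube_subset_Icc d)]
    exact h1
  · filter_upwards [ae_mem_openCube d] with y hy using hφ.abs_le hy

/-- The second moment of the mixed difference decays geometrically in the levels, at any rate
below that of the function `x ^ (-A)`. -/
theorem exists_integral_mixedDifference_sq_le (d : ℕ) {A θ : ℝ} (hA : 0 ≤ A) (hθ : 0 ≤ θ)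
    (hAθ : A + θ < 1 / 2) : ∃ C, 0 < C ∧ ∀ {φ : (Fin d → ℝ) → ℝ} {B : ℝ}, Measurable φ →
      BoundaryGrowth φ B (fun _ => A) → ∀ lev : Fin d → ℕ,
      Integrable (fun y => mixedDifference (fun x => φ (binaryPoint x)) lev
        (Finset.univ.filter fun j => lev j ≠ 0) y ^ 2) (digitLaw d) ∧
      ∫ y, mixedDifference (fun x => φ (binaryPoint x)) lev
        (Finset.univ.filter fun j => lev j ≠ 0) y ^ 2 ∂digitLaw d ≤
          B ^ 2 * (C * ∏ j, ((2 : ℝ) ^ (-(2 * θ))) ^ lev j) := by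
  set s := 2 * A + 2 * θ with hs
  set W : (ℕ → Bool) → ℝ := fun x => boundaryDist (binaryValue x) ^ (-s) with hW
  have hWi : Integrable W coinLaw := integrable_boundaryDist_binaryValue (by linarith)
  set c := ∫ x, W x ∂coinLaw with hc
  have hc0 : 0 ≤ c := integral_nonneg_of_ae (by
    have : ∀ᵐ x ∂coinLaw, binaryValue x ∈ Icc (0 : ℝ) 1 := ae_of_all _ binaryValue_mem_Icc
    filter_upwards [this] with x hx
    exact Real.rpow_nonneg (le_min hx.1 (by linarith [hx.2])) _)
  refine ⟨(8 * c + 1) ^ d, by positivity, fun {φ B} hm hφ lev => ?_⟩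
  set u := Finset.univ.filter fun j => lev j ≠ 0 with hu
  -- the factor of coordinate `j` in the pointwise bound of the squared mixed difference
  set f : Fin d → (ℕ → Bool) → ℝ := fun j x =>
    4 * ((2 : ℝ) ^ (-(2 * θ))) ^ lev j * (W x + W (flipDigit (lev j - 1) x)) with hf
  have hflip : ∀ k, Integrable (fun x => W (flipDigit k x)) coinLaw ∧
      ∫ x, W (flipDigit k x) ∂coinLaw = c := by
    intro k
    have hmp := measurePreserving_flipDigit k
    refine ⟨hmp.integrable_comp_of_integrable hWi, ?_⟩
    have := integral_map (μ := coinLaw) hmp.measurable.aemeasurable (f := W)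
      (by rw [hmp.map_eq]; exact hWi.aestronglyMeasurable)
    rw [hmp.map_eq] at this
    exact this.symm
  have hfi : ∀ j, Integrable (f j) coinLaw := fun j => (hWi.add (hflip _).1).const_mul _
  have hfint : ∀ j, ∫ x, f j x ∂coinLaw = 8 * c * ((2 : ℝ) ^ (-(2 * θ))) ^ lev j := by
    intro j
    rw [hf]
    simp only
    rw [integral_const_mul, integral_add hWi (hflip _).1, (hflip _).2]; ring
  have hpi : Integrable (fun x : Fin d → ℕ → Bool => ∏ j, f j (x j)) (digitLaw d) :=
    Integrable.fintype_prod_dep hfi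
  have hbound : ∀ᵐ x ∂digitLaw d, mixedDifference (fun x => φ (binaryPoint x)) lev u x ^ 2 ≤
      B ^ 2 * ∏ j, f j (x j) := by
    have h1 := ae_binaryPoint_mem_openCube d
    have h2 := (measurePreserving_flipDigits lev Finset.univ).quasiMeasurePreserving.ae h1
    filter_upwards [h1, h2] with x hx hx'
    set z := binaryPoint x
    set z' := binaryPoint (flipDigits lev Finset.univ x)
    obtain ⟨D, hD0, -, hD2, hD3⟩ := hφ
    have hpt : ∀ v : Finset (Fin d), binaryPoint (flipDigits lev v x) = v.piecewise z' z := by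
      intro v; ext j
      by_cases hj : j ∈ v <;> simp [Finset.piecewise, hj, z', z, binaryPoint, flipDigits]
    have hdiff : mixedDifference (fun x => φ (binaryPoint x)) lev u x =
        ∑ w ∈ u.powerset, (-1) ^ w.card * D ∅ (w.piecewise z' z) := by
      refine Finset.sum_congr rfl fun w _ => ?_
      dsimp only
      rw [hpt, hD0 _ (piecewise_mem_openCube hx hx' w)]
    have hkey := abs_mixedDifference_le_prod hA (θ := θ) ⟨hθ, by linarith⟩ hD2 hD3 hx' u ∅
      (Finset.disjoint_empty_right u) z hx
    rw [hdiff, ← sq_abs]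
    refine (pow_le_pow_left₀ (abs_nonneg _) hkey 2).trans ?_
    rw [mul_pow, ← Finset.prod_pow]
    refine mul_le_mul_of_nonneg_left (Finset.prod_le_prod (fun j _ => sq_nonneg _)
      fun j _ => ?_) (sq_nonneg B)
    have hzj := boundaryDist_pos (hx j)
    have hzj' := boundaryDist_pos (hx' j)
    have hWz : W (x j) = boundaryDist (z j) ^ (-s) := rfl
    have hWz' : W (flipDigit (lev j - 1) (x j)) = boundaryDist (z' j) ^ (-s) := by
      simp [hW, z', binaryPoint, flipDigits]
    have hp1 : 0 ≤ boundaryDist (z j) ^ (-s) := Real.rpow_nonneg hzj.le _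
    have hp2 : 0 ≤ boundaryDist (z' j) ^ (-s) := Real.rpow_nonneg hzj'.le _
    by_cases hj : lev j = 0
    · have hju : j ∉ u := by simp [hu, hj]
      simp only [growthFactor, hju, if_false, Finset.notMem_empty, sub_zero, hf, hj, pow_zero,
        mul_one]
      rw [hj] at hWz'
      rw [hWz, hWz', ← Real.rpow_natCast, ← Real.rpow_mul hzj.le]
      have : boundaryDist (z j) ^ (-A * (2 : ℕ)) ≤ boundaryDist (z j) ^ (-s) :=
        Real.rpow_le_rpow_of_exponent_ge hzj (boundaryDist_le_one (hx j)) (by push_cast; linarith)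
      linarith
    · have hju : j ∈ u := by simp [hu, hj]
      have hdist : |z j - z' j| = (2 : ℝ) ^ (-(lev j : ℝ)) := by
        obtain ⟨l, hl⟩ := Nat.exists_eq_succ_of_ne_zero hj
        rw [abs_sub_comm]
        simp only [z, z', binaryPoint, flipDigits, Finset.mem_univ, if_true,
          abs_binaryValue_flipDigit_sub, hl, Nat.succ_eq_add_one, Nat.add_sub_cancel]
        rw [Real.rpow_neg two_pos.le, Real.rpow_natCast, one_div]
      simp only [growthFactor, hju, if_true, hf]
      have hm0 : 0 < min (boundaryDist (z j)) (boundaryDist (z' j)) := lt_min hzj hzj'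
      have e1 : ((2 : ℝ) ^ (-(lev j : ℝ))) ^ θ = ((2 : ℝ) ^ (-θ)) ^ lev j := by
        rw [← Real.rpow_mul two_pos.le, ← Real.rpow_natCast, ← Real.rpow_mul two_pos.le]
        congr 1; ring
      have e2 : (((2 : ℝ) ^ (-θ)) ^ lev j) ^ 2 = ((2 : ℝ) ^ (-(2 * θ))) ^ lev j := by
        rw [← pow_mul, mul_comm, pow_mul]
        congr 1
        rw [← Real.rpow_natCast, ← Real.rpow_mul two_pos.le]
        congr 1; push_cast; ring
      have e3 : (min (boundaryDist (z j)) (boundaryDist (z' j)) ^ (-A - θ)) ^ 2 =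
          min (boundaryDist (z j)) (boundaryDist (z' j)) ^ (-s) := by
        rw [← Real.rpow_natCast, ← Real.rpow_mul hm0.le]
        congr 1; rw [hs]; push_cast; ring
      have e4 : min (boundaryDist (z j)) (boundaryDist (z' j)) ^ (-s) ≤
          boundaryDist (z j) ^ (-s) + boundaryDist (z' j) ^ (-s) := by
        rcases min_choice (boundaryDist (z j)) (boundaryDist (z' j)) with h | h <;> rw [h] <;>
          linarith
      rw [mul_pow, mul_pow, e3, hdist, e1, e2, hWz, hWz']
      have hp : (0 : ℝ) ≤ ((2 : ℝ) ^ (-(2 * θ))) ^ lev j := by positivity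
      calc (2 : ℝ) ^ 2 * ((2 : ℝ) ^ (-(2 * θ))) ^ lev j
            * min (boundaryDist (z j)) (boundaryDist (z' j)) ^ (-s)
          ≤ (2 : ℝ) ^ 2 * ((2 : ℝ) ^ (-(2 * θ))) ^ lev j
            * (boundaryDist (z j) ^ (-s) + boundaryDist (z' j) ^ (-s)) := by gcongr
        _ = _ := by ring
  have hmeas : AEStronglyMeasurable (fun y => mixedDifference (fun x => φ (binaryPoint x)) lev
        u y ^ 2) (digitLaw d) := by
    refine Measurable.aestronglyMeasurable ?_
    unfold mixedDifference
    refine Measurable.pow_const (Finset.measurable_sum _ fun v _ => Measurable.const_mul ?_ _) 2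
    exact (hm.comp measurable_binaryPoint).comp (measurePreserving_flipDigits lev v).measurable
  have hint : Integrable (fun y => mixedDifference (fun x => φ (binaryPoint x)) lev u y ^ 2)
      (digitLaw d) := by
    refine (hpi.const_mul (B ^ 2)).mono' hmeas ?_
    filter_upwards [hbound] with x hx
    rwa [Real.norm_eq_abs, abs_of_nonneg (sq_nonneg _)]
  refine ⟨hint, (integral_mono_ae hint (hpi.const_mul _) hbound).trans ?_⟩
  rw [integral_const_mul, integral_fintype_prod_eq_prod]
  refine mul_le_mul_of_nonneg_left ?_ (sq_nonneg B)
  simp_rw [hfint]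
  rw [Finset.prod_mul_distrib, Finset.prod_const, Finset.card_univ, Fintype.card_fin]
  gcongr
  linarith

/-! ### Sobol' points form digital nets -/

/-- The shift of sequences over the field with two elements. -/
def seqShift : (ℕ → ZMod 2) →ₗ[ZMod 2] (ℕ → ZMod 2) where
  toFun c := fun k => c (k + 1)
  map_add' _ _ := rfl
  map_smul' _ _ := rfl

theorem seqShift_pow_apply (i : ℕ) (c : ℕ → ZMod 2) (k : ℕ) : (seqShift ^ i) c k = c (k + i) := by
  induction i generalizing c with
  | zero => rfl
  | succ i ih => rw [pow_succ, Module.End.mul_apply, ih]; exact congrArg c (by ring)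

theorem aeval_seqShift_apply (p : (ZMod 2)[X]) (c : ℕ → ZMod 2) (k : ℕ) :
    aeval seqShift p c k = ∑ i ∈ Finset.range (p.natDegree + 1), p.coeff i * c (k + i) := by
  rw [aeval_eq_sum_range, LinearMap.sum_apply, Finset.sum_apply]
  refine Finset.sum_congr rfl fun i _ => ?_
  rw [LinearMap.smul_apply, Pi.smul_apply, seqShift_pow_apply, smul_eq_mul]

theorem monic_of_ne_zero_zmod_two {p : (ZMod 2)[X]} (hp : p ≠ 0) : p.Monic := by
  have h : p.leadingCoeff ≠ 0 := leadingCoeff_ne_zero.2 hp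
  have key : ∀ a : ZMod 2, a ≠ 0 → a = 1 := by decide
  exact key _ h

/-- A linear recurring sequence is determined by its first terms. -/
theorem eq_zero_of_aeval_seqShift_eq_zero {p : (ZMod 2)[X]} (hp : p.Monic) {c : ℕ → ZMod 2}
    (h : aeval seqShift p c = 0) (h0 : ∀ k < p.natDegree, c k = 0) : c = 0 := by
  ext k
  induction k using Nat.strong_induction_on with
  | _ k ih =>
    rcases lt_or_ge k p.natDegree with hk | hk
    · exact h0 k hk
    · have h1 := congrFun h (k - p.natDegree)
      rw [aeval_seqShift_apply, Finset.sum_range_succ, Finset.sum_eq_zero, zero_add,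
        hp.coeff_natDegree, one_mul, Nat.sub_add_cancel hk] at h1
      · exact h1
      · intro i hi
        rw [ih (k - p.natDegree + i) (by have := Finset.mem_range.1 hi; omega)]
        simp

namespace SobolGenerator

variable {d : ℕ} (S : SobolGenerator d)

/-- The polynomial that governs coordinate `j`; it is `X` for the van der Corput coordinate. -/
noncomputable def rowPoly (j : Fin d) : (ZMod 2)[X] := if (j : ℕ) = 0 then X else S.poly j

theorem irreducible_rowPoly (j : Fin d) : Irreducible (S.rowPoly j) := by
  unfold rowPoly
  split_ifs with h
  · exact irreducible_X
  · exact (S.primitive j h).1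

theorem monic_rowPoly (j : Fin d) : (S.rowPoly j).Monic :=
  monic_of_ne_zero_zmod_two (S.irreducible_rowPoly j).ne_zero

theorem not_isPrimitiveModTwo_X : ¬ IsPrimitiveModTwo (X : (ZMod 2)[X]) := by
  rintro ⟨h1, h2⟩
  have : Fact (Irreducible (X : (ZMod 2)[X])) := ⟨h1⟩
  have h0 : AdjoinRoot.root (X : (ZMod 2)[X]) = 0 := by
    have := AdjoinRoot.mk_self (f := (X : (ZMod 2)[X]))
    rwa [AdjoinRoot.mk_X] at this
  rw [h0, natDegree_X] at h2
  have : orderOf (0 : AdjoinRoot (X : (ZMod 2)[X])) = 0 := by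
    rw [orderOf_eq_zero_iff']
    intro n hn h
    rw [zero_pow hn.ne'] at h
    exact zero_ne_one h
  omega

theorem rowPoly_injective : Function.Injective S.rowPoly := by
  intro i j h
  unfold rowPoly at h
  split_ifs at h with hi hj hj
  · exact Fin.ext (hi.trans hj.symm)
  · exact absurd (h ▸ S.primitive j hj) not_isPrimitiveModTwo_X
  · exact absurd (h ▸ S.primitive i hi) not_isPrimitiveModTwo_X
  · exact S.distinct i j hi hj h

theorem isCoprime_rowPoly {i j : Fin d} (h : i ≠ j) : IsCoprime (S.rowPoly i) (S.rowPoly j) := by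
  rw [(S.irreducible_rowPoly i).coprime_iff_not_dvd]
  intro hd
  have := (S.irreducible_rowPoly i).associated_of_dvd (S.irreducible_rowPoly j) hd
  exact h (S.rowPoly_injective
    (eq_of_monic_of_associated (S.monic_rowPoly i) (S.monic_rowPoly j) this))

/-- Applied to the rows of the generating matrix, the polynomial of the coordinate acts as a shift
of the rows by its degree. -/
theorem aeval_rowPoly_mat (j : Fin d) (r : ℕ) :
    aeval seqShift (S.rowPoly j) (S.mat j r) =
      if (S.rowPoly j).natDegree ≤ r then S.mat j (r - (S.rowPoly j).natDegree) else 0 := by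
  by_cases h : (j : ℕ) = 0
  · have hX : S.rowPoly j = X := by simp [rowPoly, h]
    rw [hX, natDegree_X, aeval_X]
    ext k
    change S.mat j r (k + 1) = _
    rcases eq_or_ne r (k + 1) with rfl | hr
    · simp [S.diag]
    · rw [S.first j h r (k + 1) hr]
      split_ifs with h1
      · rw [S.first j h (r - 1) k (by omega)]
      · rfl
  · have hP : S.rowPoly j = S.poly j := by simp [rowPoly, h]
    have hm := S.monic_rowPoly j
    rw [hP] at hm ⊢
    ext k
    set s := (S.poly j).natDegree with hs
    have hrec := S.recurrence j h r (k + s) (by omega)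
    rw [← hs] at hrec
    have hsum : ∑ i ∈ Finset.Icc 1 s, (S.poly j).coeff (s - i) * S.mat j r (k + s - i) =
        ∑ i ∈ Finset.range s, (S.poly j).coeff i * S.mat j r (k + i) := by
      refine Finset.sum_bij' (fun i _ => s - i) (fun i _ => s - i) ?_ ?_ ?_ ?_ ?_
      · intro i hi; simp at hi ⊢; omega
      · intro i hi; simp at hi ⊢; omega
      · intro i hi; simp at hi; omega
      · intro i hi; simp at hi; omega
      · intro i hi
        simp at hi
        rw [show k + s - i = k + (s - i) by omega]
    rw [hsum] at hrec
    rw [aeval_seqShift_apply, ← hs, Finset.sum_range_succ, hs, hm.coeff_natDegree, ← hs, one_mul,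
      hrec]
    have e : ∀ a b : ZMod 2, a + (a + b) = b := by decide
    rw [e]
    split_ifs <;> simp

theorem aeval_rowPoly_pow_mat (j : Fin d) (q : ℕ) :
    ∀ r < q * (S.rowPoly j).natDegree, aeval seqShift (S.rowPoly j ^ q) (S.mat j r) = 0 := by
  induction q with
  | zero => intro r hr; simp at hr
  | succ q ih =>
    intro r hr
    rw [pow_succ, map_mul, Module.End.mul_apply, aeval_rowPoly_mat]
    split_ifs with h
    · refine ih _ ?_
      rw [add_mul, one_mul] at hr
      omega
    · exact map_zero _

/-- A quality parameter of the nets formed by the points: the dyadic boxes of volume at least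
`2 ^ (netQuality - m)` contain their fair share of the first `2 ^ m` points. -/
noncomputable def netQuality : ℕ := ∑ j, (S.rowPoly j).natDegree

/-- The first rows of the generating matrices, cut off after `m` columns, are linearly
independent: they lie in the kernels of powers of coprime polynomials in the shift. -/
theorem mat_rows_independent {m : ℕ} {κ : Fin d → ℕ} (hκ : ∑ j, κ j + S.netQuality ≤ m)
    (β : Fin d → ℕ → ZMod 2)
    (h : ∀ k < m, ∑ j, ∑ r ∈ Finset.range (κ j), β j r * S.mat j r k = 0) :
    ∀ j, ∀ r < κ j, β j r = 0 := by
  set s : Fin d → ℕ := fun j => (S.rowPoly j).natDegree with hs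
  have hspos : ∀ j, 0 < s j := fun j => (S.irreducible_rowPoly j).natDegree_pos
  set q : Fin d → ℕ := fun j => κ j / s j + 1 with hq
  have hq1 : ∀ j, κ j ≤ q j * s j := fun j => by
    have := Nat.lt_div_mul_add (a := κ j) (hspos j)
    simp only [hq, add_mul, one_mul]
    exact this.le
  have hq2 : ∀ j, q j * s j ≤ κ j + s j := fun j => by
    have := Nat.div_mul_le_self (κ j) (s j)
    simp only [hq, add_mul, one_mul]; omega
  -- the part of the vanishing combination that belongs to coordinate `j`; it is annihilated by
  -- the power `q j` of the polynomial of the coordinate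
  set v : Fin d → ℕ → ZMod 2 := fun j => ∑ r ∈ Finset.range (κ j), β j r • S.mat j r with hv
  have hvker : ∀ j, aeval seqShift (S.rowPoly j ^ q j) (v j) = 0 := by
    intro j
    rw [hv, map_sum]
    refine Finset.sum_eq_zero fun r hr => ?_
    rw [map_smul, S.aeval_rowPoly_pow_mat j (q j) r
      ((Finset.mem_range.1 hr).trans_le (hq1 j)), smul_zero]
  have hker : ∀ (t : Finset (Fin d)) (j), j ∈ t →
      aeval seqShift (∏ i ∈ t, S.rowPoly i ^ q i) (v j) = 0 := by
    intro t j hj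
    rw [← Finset.prod_erase_mul _ _ hj, map_mul, Module.End.mul_apply, hvker, map_zero]
  -- the sum is a recurring sequence of order at most `m` whose first `m` terms vanish
  have hsum : ∑ j, v j = 0 := by
    have hmon : (∏ j, S.rowPoly j ^ q j).Monic :=
      monic_prod_of_monic _ _ fun j _ => (S.monic_rowPoly j).pow _
    refine eq_zero_of_aeval_seqShift_eq_zero hmon ?_ fun k hk => ?_
    · rw [map_sum]
      exact Finset.sum_eq_zero fun j hj => hker Finset.univ j hj
    · have hdeg : (∏ j, S.rowPoly j ^ q j).natDegree ≤ m := by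
        rw [natDegree_prod_of_monic _ _ fun j _ => (S.monic_rowPoly j).pow _]
        refine le_trans (Finset.sum_le_sum fun j _ => ?_)
          (hκ.trans' (le_of_eq Finset.sum_add_distrib))
        rw [natDegree_pow]; exact hq2 j
      have := h k (hk.trans_le hdeg)
      simpa [hv, Finset.sum_apply] using this
  -- the kernels of the coprime polynomials are in direct sum
  have hv0 : ∀ j, v j = 0 := by
    intro j
    have hcop : IsCoprime (S.rowPoly j ^ q j) (∏ i ∈ Finset.univ.erase j, S.rowPoly i ^ q i) :=
      IsCoprime.prod_right fun i hi =>
        (S.isCoprime_rowPoly (Finset.ne_of_mem_erase hi).symm).pow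
    have hd := disjoint_ker_aeval_of_isCoprime seqShift hcop
    refine (Submodule.disjoint_def.1 hd) (v j) (LinearMap.mem_ker.2 (hvker j))
      (LinearMap.mem_ker.2 ?_)
    have : v j = - ∑ i ∈ Finset.univ.erase j, v i := by
      rw [eq_neg_iff_add_eq_zero, Finset.add_sum_erase _ _ (Finset.mem_univ j), hsum]
    rw [this, map_neg, map_sum, Finset.sum_eq_zero, neg_zero]
    intro i hi
    exact hker _ i hi
  -- the rows of a single coordinate form a unitriangular matrix
  intro j r
  induction r using Nat.strong_induction_on with
  | _ r ih =>
    intro hr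
    have h1 := congrFun (hv0 j) r
    simp only [hv, Finset.sum_apply, Pi.smul_apply, smul_eq_mul, Pi.zero_apply] at h1
    rw [Finset.sum_eq_single r] at h1
    · simpa [S.diag] using h1
    · intro b hb hne
      rcases lt_or_gt_of_ne hne with hlt | hgt
      · rw [ih b hlt (Finset.mem_range.1 hb), zero_mul]
      · rw [S.upper j b r hgt, mul_zero]
    · intro hn; exact absurd (Finset.mem_range.2 hr) hn

/-- The digits of the points with number less than `2 ^ m` are linear in the digits of the
number. -/
theorem digits_eq_sum {m n : ℕ} (hn : n < 2 ^ m) (j : Fin d) (r : ℕ) :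
    S.digits n j r = ∑ k : Fin m, S.mat j r k * if n.testBit k then 1 else 0 := by
  rw [Fin.sum_univ_eq_sum_range (fun k => S.mat j r k * if n.testBit k then (1 : ZMod 2) else 0)]
  simp only [digits, mul_ite, mul_one, mul_zero]
  have h : ∀ k, n.testBit k = true → k < n ∧ k < m := by
    intro k hk
    have h1 := Nat.ge_two_pow_of_testBit hk
    exact ⟨Nat.lt_two_pow_self.trans_le h1, (Nat.pow_lt_pow_iff_right one_lt_two).1
      (h1.trans_lt hn)⟩
  rw [← Finset.sum_filter, ← Finset.sum_filter]
  refine Finset.sum_congr ?_ fun _ _ => rfl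
  ext k
  simp only [Finset.mem_filter, Finset.mem_range]
  exact ⟨fun hk => ⟨(h k hk.2).2, hk.2⟩, fun hk => ⟨(h k hk.2).1, hk.2⟩⟩

/-- The first `2 ^ m` points are equidistributed over the dyadic boxes that are not too small. -/
theorem card_digits_eq {m : ℕ} {κ : Fin d → ℕ} (hκ : ∑ j, κ j + S.netQuality ≤ m)
    (b : Fin d → ℕ → ZMod 2) :
    ((Finset.range (2 ^ m)).filter fun n => ∀ j, ∀ r < κ j, S.digits n j r = b j r).card =
      2 ^ (m - ∑ j, κ j) := by
  classical
  set M : Matrix (Σ j : Fin d, Fin (κ j)) (Fin m) (ZMod 2) :=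
    Matrix.of fun p k => S.mat p.1 p.2 k with hM
  have hind : LinearIndependent (ZMod 2) M.row := by
    rw [Fintype.linearIndependent_iff]
    intro g hg
    set β : Fin d → ℕ → ZMod 2 := fun j r => if h : r < κ j then g ⟨j, r, h⟩ else 0 with hβ
    have := S.mat_rows_independent hκ β (by
      intro k hk
      have h1 := congrFun hg ⟨k, hk⟩
      rw [Finset.sum_apply, Fintype.sum_sigma] at h1
      refine Eq.trans (Finset.sum_congr rfl fun j _ => ?_) h1
      rw [← Fin.sum_univ_eq_sum_range (fun r => β j r * S.mat j r k)]
      refine Finset.sum_congr rfl fun r _ => ?_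
      simp [hβ, hM])
    rintro ⟨j, r, hr⟩
    have h2 := this j r hr
    simpa [hβ, hr] using h2
  have hcard : Fintype.card (Σ j : Fin d, Fin (κ j)) = ∑ j, κ j := by simp
  -- the points in the box correspond to the solutions of a linear system of full rank
  have hrank : M.rank = ∑ j, κ j := by rw [hind.rank_matrix, hcard]
  have htop : LinearMap.range M.mulVecLin = ⊤ := by
    refine Submodule.eq_top_of_finrank_eq ?_
    rw [Module.finrank_fintype_fun_eq_card, hcard]; exact hrank
  have hkerdim : Module.finrank (ZMod 2) (LinearMap.ker M.mulVecLin) = m - ∑ j, κ j := by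
    have h1 := LinearMap.finrank_range_add_finrank_ker M.mulVecLin
    rw [Module.finrank_fintype_fun_eq_card, Fintype.card_fin] at h1
    have h2 : Module.finrank (ZMod 2) (LinearMap.range M.mulVecLin) = ∑ j, κ j := hrank
    omega
  obtain ⟨x₀, hx₀⟩ := LinearMap.range_eq_top.1 htop fun p => b p.1 p.2
  set e : Fin (2 ^ m) → (Fin m → ZMod 2) := fun n k => if (n : ℕ).testBit k then 1 else 0 with he
  have hinj : Function.Injective e := by
    intro n n' h
    refine Fin.ext (Nat.eq_of_testBit_eq fun k => ?_)
    rcases lt_or_ge k m with hk | hk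
    · have h1 := congrFun h ⟨k, hk⟩
      simp only [he] at h1
      cases h2 : (n : ℕ).testBit k <;> cases h3 : (n' : ℕ).testBit k <;> simp_all
    · rw [Nat.testBit_eq_false_of_lt (n.2.trans_le (Nat.pow_le_pow_right two_pos hk)),
        Nat.testBit_eq_false_of_lt (n'.2.trans_le (Nat.pow_le_pow_right two_pos hk))]
  have hbij : Function.Bijective e :=
    (Fintype.bijective_iff_injective_and_card e).2 ⟨hinj, by simp [ZMod.card]⟩
  have h1 : ((Finset.range (2 ^ m)).filter fun n => ∀ j, ∀ r < κ j, S.digits n j r = b j r).card =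
      (Finset.univ.filter fun x : Fin m → ZMod 2 => M.mulVecLin x = M.mulVecLin x₀).card := by
    refine Finset.card_bij (fun n hn => e ⟨n, Finset.mem_range.1 (Finset.mem_filter.1 hn).1⟩)
      ?_ ?_ ?_
    · intro n hn
      obtain ⟨hn1, hn2⟩ := Finset.mem_filter.1 hn
      refine Finset.mem_filter.2 ⟨Finset.mem_univ _, ?_⟩
      rw [hx₀]
      ext ⟨j, r, hr⟩
      rw [← hn2 j r hr, S.digits_eq_sum (Finset.mem_range.1 hn1)]
      rfl
    · intro n hn n' hn' h
      exact congrArg Fin.val (hinj h)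
    · intro x hx
      obtain ⟨n, rfl⟩ := hbij.2 x
      refine ⟨n, Finset.mem_filter.2 ⟨Finset.mem_range.2 n.2, fun j r hr => ?_⟩, rfl⟩
      have h2 := congrFun ((Finset.mem_filter.1 hx).2.trans hx₀) ⟨j, r, hr⟩
      rw [S.digits_eq_sum n.2, ← h2]
      rfl
  have h2 : (Finset.univ.filter fun x : Fin m → ZMod 2 => M.mulVecLin x = M.mulVecLin x₀).card =
      Fintype.card (LinearMap.ker M.mulVecLin) := by
    rw [Fintype.card_subtype]
    refine Finset.card_bij (fun x _ => x - x₀) ?_ ?_ ?_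
    · intro x hx
      refine Finset.mem_filter.2 ⟨Finset.mem_univ _, ?_⟩
      rw [LinearMap.mem_ker, map_sub, (Finset.mem_filter.1 hx).2, sub_self]
    · intro x _ y _ h
      exact sub_left_injective h
    · intro x hx
      refine ⟨x + x₀, Finset.mem_filter.2 ⟨Finset.mem_univ _, ?_⟩, by simp⟩
      rw [map_add, LinearMap.mem_ker.1 (Finset.mem_filter.1 hx).2, zero_add]
  rw [h1, h2, Module.card_eq_pow_finrank (K := ZMod 2), hkerdim, ZMod.card]

/-- The scrambling acts on the first digits by a bijection. -/
theorem exists_unscramble (τ : List (ZMod 2) → Bool) (y : ℕ → Bool) (K : ℕ) :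
    ∃ b : ℕ → ZMod 2, ∀ a : ℕ → ZMod 2,
      (∀ r < K, xor (decide (a r = 1)) (τ (List.ofFn fun i : Fin r => a i)) = y r) ↔
        ∀ r < K, a r = b r := by
  induction K with
  | zero => exact ⟨0, by simp⟩
  | succ K ih =>
    obtain ⟨b, hb⟩ := ih
    set c : Bool := xor (τ (List.ofFn fun i : Fin K => b i)) (y K) with hc
    refine ⟨Function.update b K (if c then 1 else 0), fun a => ?_⟩
    have hlt : ∀ P : ℕ → Prop, (∀ r < K + 1, P r) ↔ (∀ r < K, P r) ∧ P K := fun P =>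
      ⟨fun h => ⟨fun r hr => h r (by omega), h K (by omega)⟩, fun h r hr => by
        rcases Nat.lt_succ_iff_lt_or_eq.1 hr with h1 | rfl
        exacts [h.1 r h1, h.2]⟩
    rw [hlt, hlt, hb a]
    have hup : (∀ r < K, a r = Function.update b K (if c then 1 else 0) r) ↔
        ∀ r < K, a r = b r :=
      forall₂_congr fun r hr => by rw [Function.update_of_ne hr.ne]
    rw [hup, Function.update_self]
    refine and_congr_right fun h => ?_
    have hpre : (List.ofFn fun i : Fin K => a i) = List.ofFn fun i : Fin K => b i :=
      congrArg List.ofFn (funext fun i => h i i.2)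
    rw [hpre, hc]
    generalize τ (List.ofFn fun i : Fin K => b i) = t
    generalize y K = z
    generalize a K = x
    revert t z x; decide

/-- Equidistribution is preserved by the scrambling. -/
theorem card_scrambledBits_eq {m : ℕ} {κ : Fin d → ℕ} (hκ : ∑ j, κ j + S.netQuality ≤ m)
    (σ : Scrambling d) (y : Fin d → ℕ → Bool) :
    ((Finset.range (2 ^ m)).filter fun n =>
      ∀ j, ∀ r < κ j, S.scrambledBits n σ j r = y j r).card = 2 ^ (m - ∑ j, κ j) := by
  choose b hb using fun j => exists_unscramble (fun l => σ (j, l)) (y j) (κ j)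
  rw [← S.card_digits_eq hκ b]
  congr 1
  refine Finset.filter_congr fun n _ => forall_congr' fun j => ?_
  exact hb j (S.digits n j)

theorem exists_le_sum_eq {κ : Fin d → ℕ} {s : ℕ} (hs : s ≤ ∑ j, κ j) :
    ∃ κ' : Fin d → ℕ, (∀ j, κ' j ≤ κ j) ∧ ∑ j, κ' j = s := by
  induction s with
  | zero => exact ⟨0, fun _ => Nat.zero_le _, by simp⟩
  | succ s ih =>
    obtain ⟨κ', h1, h2⟩ := ih (by omega)
    obtain ⟨j, hj⟩ : ∃ j, κ' j < κ j := by
      by_contra! h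
      have := Finset.sum_le_sum fun j (_ : j ∈ Finset.univ) => h j
      omega
    refine ⟨Function.update κ' j (κ' j + 1), fun i => ?_, ?_⟩
    · rcases eq_or_ne i j with rfl | h
      · simpa using hj
      · simpa [h] using h1 i
    · rw [Finset.sum_update_of_mem (Finset.mem_univ j), ← h2,
        ← Finset.add_sum_erase _ κ' (Finset.mem_univ j), Finset.sdiff_singleton_eq_erase]
      ring

/-- No dyadic box contains many more points than its volume suggests. -/
theorem card_digits_le {m s : ℕ} {κ : Fin d → ℕ} (hs : S.netQuality ≤ s)
    (hκ : m ≤ ∑ j, κ j + s) (b : Fin d → ℕ → ZMod 2) :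
    ((Finset.range (2 ^ m)).filter fun n => ∀ j, ∀ r < κ j, S.digits n j r = b j r).card ≤
      2 ^ s := by
  rcases le_total m s with h | h
  · exact (Finset.card_filter_le _ _).trans
      (by rw [Finset.card_range]; exact Nat.pow_le_pow_right two_pos h)
  -- a larger box, coarse enough for exact equidistribution, contains `2 ^ s` points
  · obtain ⟨κ', h1, h2⟩ := exists_le_sum_eq (κ := κ) (s := m - s) (by omega)
    refine (Finset.card_le_card fun n hn => ?_).trans
      ((S.card_digits_eq (m := m) (κ := κ') (by omega) b).le.trans
        (Nat.pow_le_pow_right two_pos (by omega)))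
    obtain ⟨hn1, hn2⟩ := Finset.mem_filter.1 hn
    exact Finset.mem_filter.2 ⟨hn1, fun j r hr => hn2 j r (hr.trans_le (h1 j))⟩

end SobolGenerator

/-! ### The mean square error of scrambled Sobol' points -/

section

theorem eLpNorm_two_le_of_integral_sq_le {Ω : Type*} [MeasurableSpace Ω] {μ : Measure Ω}
    {f : Ω → ℝ} (hf : MemLp f 2 μ) {c : ℝ} (hc : 0 ≤ c) (h : ∫ x, f x ^ 2 ∂μ ≤ c ^ 2) :
    eLpNorm f 2 μ ≤ ENNReal.ofReal c := by
  rw [hf.eLpNorm_eq_integral_rpow_norm two_ne_zero ENNReal.ofNat_ne_top]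
  refine ENNReal.ofReal_le_ofReal ?_
  simp only [ENNReal.toReal_ofNat, Real.norm_eq_abs]
  have e : ∀ x, |f x| ^ (2 : ℝ) = f x ^ 2 := fun x => by
    rw [show (2 : ℝ) = ((2 : ℕ) : ℝ) by norm_num, Real.rpow_natCast, sq_abs]
  simp_rw [e]
  rw [← one_div, ← Real.sqrt_eq_rpow]
  exact (Real.sqrt_le_sqrt h).trans_eq (Real.sqrt_sq hc)

variable {d : ℕ}

theorem haarComponent_flipDigits (Φ : (Fin d → ℕ → Bool) → ℝ) {lev : Fin d → ℕ} {j : Fin d}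
    (hj : lev j ≠ 0) (x : Fin d → ℕ → Bool) :
    haarComponent Φ lev (flipDigits lev {j} x) = - haarComponent Φ lev x := by
  unfold haarComponent
  rw [← integral_neg]
  refine integral_congr_ae (ae_of_all _ fun y => ?_)
  have := prod_haarKernel_flipDigits (lev := lev) (v := {j}) (by simpa using hj) y x
  simp only [haarKernel_comm _ (y _)] at this
  simp only [this, Finset.card_singleton]
  ring

namespace SobolGenerator

variable (S : SobolGenerator d)

/-- The sum of a Haar component of `Φ` over the first `2 ^ m` scrambled points. -/
noncomputable def haarSum (Φ : (Fin d → ℕ → Bool) → ℝ) (lev : Fin d → ℕ) (m : ℕ)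
    (σ : Scrambling d) : ℝ :=
  ∑ n ∈ Finset.range (2 ^ m), haarComponent Φ lev (S.scrambledBits n σ)

/-- Equidistribution, expressed by the box kernel. -/
theorem sum_boxKernel {m : ℕ} {κ : Fin d → ℕ} (hκ : ∑ j, κ j + S.netQuality ≤ m)
    (σ : Scrambling d) (y : Fin d → ℕ → Bool) :
    ∑ n ∈ Finset.range (2 ^ m), boxKernel κ (S.scrambledBits n σ) y = 2 ^ m := by
  classical
  have h : ∀ n ∈ Finset.range (2 ^ m), boxKernel κ (S.scrambledBits n σ) y =
      if ∀ j, ∀ r < κ j, S.scrambledBits n σ j r = y j r then (∏ j, 2 ^ κ j : ℝ) else 0 := by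
    intro n _
    split_ifs with h
    exacts [boxKernel_of_forall h, boxKernel_of_not_forall h]
  rw [Finset.sum_congr rfl h, ← Finset.sum_filter, Finset.sum_const,
    S.card_scrambledBits_eq hκ, nsmul_eq_mul, Finset.prod_pow_eq_pow_sum]
  push_cast
  rw [← pow_add]
  congr 1; omega

/-- Net points integrate the coarse Haar components exactly. -/
theorem haarSum_eq_zero {Φ : (Fin d → ℕ → Bool) → ℝ} (hΦ : Integrable Φ (digitLaw d)) {m : ℕ}
    {lev : Fin d → ℕ} (h0 : lev ≠ 0) (hlev : ∑ j, lev j + S.netQuality ≤ m) (σ : Scrambling d) :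
    S.haarSum Φ lev m σ = 0 := by
  classical
  unfold haarSum haarComponent
  rw [← integral_finsetSum _ fun n _ => integrable_mul_prod_haarKernel hΦ lev _]
  have hker : ∀ y : Fin d → ℕ → Bool, ∑ n ∈ Finset.range (2 ^ m),
      ∏ j, haarKernel (lev j) (S.scrambledBits n σ j) (y j) = 0 := by
    intro y
    -- the Haar kernel is a combination of box kernels, each of which is integrated exactly, so
    -- that the sum is the one for the uniform distribution
    set c : Fin d → ℝ := fun j => if lev j = 0 then 0 else -1 with hc
    have hk : ∀ (j : Fin d) (x z : ℕ → Bool), haarKernel (lev j) x z =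
        cellKernel (lev j) x z + c j * cellKernel (lev j - 1) x z := by
      intro j x z
      simp only [hc]
      cases lev j with
      | zero => simp [haarKernel, cellKernel_zero]
      | succ l => simp [haarKernel]; ring
    have hexp : ∀ n, ∏ j, haarKernel (lev j) (S.scrambledBits n σ j) (y j) =
        ∑ s ∈ Finset.univ.powerset, (∏ j ∈ Finset.univ \ s, c j) *
          boxKernel (fun j => if j ∈ s then lev j else lev j - 1) (S.scrambledBits n σ) y := by
      intro n
      simp_rw [hk]
      rw [Finset.prod_add]
      refine Finset.sum_congr rfl fun s hs => ?_
      rw [Finset.prod_mul_distrib]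
      have hbox : boxKernel (fun j => if j ∈ s then lev j else lev j - 1)
          (S.scrambledBits n σ) y =
          (∏ j ∈ s, cellKernel (lev j) (S.scrambledBits n σ j) (y j)) *
          ∏ j ∈ Finset.univ \ s, cellKernel (lev j - 1) (S.scrambledBits n σ j) (y j) := by
        unfold boxKernel
        rw [← Finset.prod_sdiff (Finset.subset_univ s), mul_comm]
        congr 1
        · exact Finset.prod_congr rfl fun j hj => by simp only [if_pos hj]
        · exact Finset.prod_congr rfl fun j hj => by
            simp only [if_neg (Finset.mem_sdiff.1 hj).2]
      rw [hbox]; ring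
    simp_rw [hexp]
    rw [Finset.sum_comm]
    have hs : ∀ s ∈ (Finset.univ : Finset (Fin d)).powerset,
        ∑ n ∈ Finset.range (2 ^ m), (∏ j ∈ Finset.univ \ s, c j) *
          boxKernel (fun j => if j ∈ s then lev j else lev j - 1) (S.scrambledBits n σ) y =
        2 ^ m * ((∏ j ∈ s, (1 : ℝ)) * ∏ j ∈ Finset.univ \ s, c j) := by
      intro s _
      rw [← Finset.mul_sum, S.sum_boxKernel]
      · simp; ring
      · have : ∑ j, (if j ∈ s then lev j else lev j - 1) ≤ ∑ j, lev j :=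
          Finset.sum_le_sum fun j _ => by split_ifs <;> omega
        omega
    rw [Finset.sum_congr rfl hs, ← Finset.mul_sum, ← Finset.prod_add]
    obtain ⟨j, hj⟩ : ∃ j, lev j ≠ 0 := Function.ne_iff.1 h0
    rw [Finset.prod_eq_zero (Finset.mem_univ j) (by simp [hc, hj]), mul_zero]
  simp_rw [← Finset.mul_sum, hker, mul_zero, integral_zero]

/-- The coin of a scrambling at the position `p` is turned. -/
def flipCoin (p : Fin d × List (ZMod 2)) (σ : Scrambling d) : Scrambling d :=
  fun q => xor (decide (q = p)) (σ q)

theorem measurePreserving_flipCoin (p : Fin d × List (ZMod 2)) :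
    MeasurePreserving (flipCoin p) (owenLaw d) (owenLaw d) := by
  refine ⟨?_, map_xor_infinitePi Function.injective_id _⟩
  unfold flipCoin; fun_prop

theorem integrable_haarComponent_mul {Φ : (Fin d → ℕ → Bool) → ℝ} (hΦm : Measurable Φ)
    (hΦ : Integrable Φ (digitLaw d)) (lev : Fin d → ℕ) (n n' : ℕ) :
    Integrable (fun σ => haarComponent Φ lev (S.scrambledBits n σ) *
      haarComponent Φ lev (S.scrambledBits n' σ)) (owenLaw d) := by
  have hm := measurable_haarComponent hΦm lev
  have : IsProbabilityMeasure (owenLaw d) := by unfold owenLaw; infer_instance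
  refine Integrable.of_bound (C := ((∫ y, |Φ y| ∂digitLaw d) * ∏ j, 2 ^ (lev j - 1)) *
    ((∫ y, |Φ y| ∂digitLaw d) * ∏ j, 2 ^ (lev j - 1)))
    ((hm.comp (S.measurable_scrambledBits n)).mul
      (hm.comp (S.measurable_scrambledBits n'))).aestronglyMeasurable (ae_of_all _ fun σ => ?_)
  rw [norm_mul]
  have h := fun x => abs_haarComponent_le hΦ lev x
  exact mul_le_mul (h _) (h _) (abs_nonneg _) ((abs_nonneg _).trans (h (S.scrambledBits n σ)))

/-- Haar components at two points are uncorrelated unless the points share all the digits that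
precede the level: some coin acts on the sign of the one component only. -/
theorem integral_haarComponent_mul_eq_zero {Φ : (Fin d → ℕ → Bool) → ℝ} (hΦm : Measurable Φ)
    (hΦ : Integrable Φ (digitLaw d)) {lev : Fin d → ℕ} {n n' : ℕ}
    (h : ¬ ∀ j, ∀ r < lev j - 1, S.digits n' j r = S.digits n j r) :
    ∫ σ, haarComponent Φ lev (S.scrambledBits n σ) *
      haarComponent Φ lev (S.scrambledBits n' σ) ∂owenLaw d = 0 := by
  push Not at h
  obtain ⟨j, r₀, hr₀, hne⟩ := h
  have hj : lev j ≠ 0 := by omega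
  -- the coin that decides about digit `lev j` of point `n`; it is not used for point `n'`
  set p : Fin d × List (ZMod 2) := (j, List.ofFn fun i : Fin (lev j - 1) => S.digits n j i) with hp
  have e1 : ∀ σ, S.scrambledBits n (flipCoin p σ) = flipDigits lev {j} (S.scrambledBits n σ) := by
    intro σ; ext i r
    by_cases hi : i = j
    · subst hi
      by_cases hr : r = lev i - 1
      · subst hr; simp [scrambledBits, flipCoin, flipDigits, flipDigit, hp]
      · have : ¬ (List.ofFn fun k : Fin r => S.digits n i k) =
            List.ofFn fun k : Fin (lev i - 1) => S.digits n i k := fun h => by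
          have := congrArg List.length h
          simp at this; exact hr this
        simp [scrambledBits, flipCoin, flipDigits, flipDigit, hp, this, hr]
    · simp [scrambledBits, flipCoin, flipDigits, hp, hi]
  have e2 : ∀ σ, S.scrambledBits n' (flipCoin p σ) = S.scrambledBits n' σ := by
    intro σ; ext i r
    have : ((i, List.ofFn fun k : Fin r => S.digits n' i k) : Fin d × List (ZMod 2)) ≠ p := by
      intro h
      simp only [hp, Prod.mk.injEq] at h
      obtain ⟨rfl, h2⟩ := h
      have hl := congrArg List.length h2
      simp only [List.length_ofFn] at hl
      subst hl
      exact hne (congrFun (List.ofFn_injective h2) ⟨r₀, hr₀⟩)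
    simp [scrambledBits, flipCoin, this]
  have hmp := measurePreserving_flipCoin p
  have hmap := integral_map (μ := owenLaw d) hmp.measurable.aemeasurable
    (f := fun σ => haarComponent Φ lev (S.scrambledBits n σ) *
      haarComponent Φ lev (S.scrambledBits n' σ))
    (by rw [hmp.map_eq]; exact (S.integrable_haarComponent_mul hΦm hΦ lev n n').1)
  rw [hmp.map_eq] at hmap
  simp only [e1, e2, haarComponent_flipDigits Φ hj, neg_mul, integral_neg] at hmap
  linarith

theorem integral_haarComponent_sq {Φ : (Fin d → ℕ → Bool) → ℝ} (hΦm : Measurable Φ)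
    (lev : Fin d → ℕ) (n : ℕ) :
    ∫ σ, haarComponent Φ lev (S.scrambledBits n σ) ^ 2 ∂owenLaw d =
      ∫ x, haarComponent Φ lev x ^ 2 ∂digitLaw d := by
  have hmp := S.measurePreserving_scrambledBits n
  rw [← hmp.map_eq, integral_map hmp.measurable.aemeasurable
    ((measurable_haarComponent hΦm lev).pow_const 2).aestronglyMeasurable]

/-- The sum over the points of a fine Haar component: every point is correlated with boundedly many
points only, those in the same dyadic box. -/
theorem integral_haarSum_sq_le {Φ : (Fin d → ℕ → Bool) → ℝ} (hΦm : Measurable Φ)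
    (hΦ : Integrable Φ (digitLaw d)) {m : ℕ} {lev : Fin d → ℕ}
    (hlev : m ≤ ∑ j, lev j + S.netQuality) :
    ∫ σ, S.haarSum Φ lev m σ ^ 2 ∂owenLaw d ≤
      2 ^ m * 2 ^ (S.netQuality + d) * ∫ x, haarComponent Φ lev x ^ 2 ∂digitLaw d := by
  classical
  set V := ∫ x, haarComponent Φ lev x ^ 2 ∂digitLaw d with hV
  have hV0 : 0 ≤ V := integral_nonneg fun _ => sq_nonneg _
  have hi := S.integrable_haarComponent_mul hΦm hΦ lev
  have hterm : ∀ n n', ∫ σ, haarComponent Φ lev (S.scrambledBits n σ) *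
      haarComponent Φ lev (S.scrambledBits n' σ) ∂owenLaw d ≤
      if ∀ j, ∀ r < lev j - 1, S.digits n' j r = S.digits n j r then V else 0 := by
    intro n n'
    split_ifs with h
    · have hsq : ∀ k, Integrable (fun σ => haarComponent Φ lev (S.scrambledBits k σ) ^ 2)
          (owenLaw d) := fun k => by simpa only [sq] using hi k k
      calc _ ≤ ∫ σ, (1 / 2 * haarComponent Φ lev (S.scrambledBits n σ) ^ 2 +
            1 / 2 * haarComponent Φ lev (S.scrambledBits n' σ) ^ 2) ∂owenLaw d :=
            integral_mono (hi n n') (((hsq n).const_mul _).add ((hsq n').const_mul _)) fun σ => by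
              dsimp only
              nlinarith [sq_nonneg (haarComponent Φ lev (S.scrambledBits n σ)
                - haarComponent Φ lev (S.scrambledBits n' σ))]
        _ = V := by
            rw [integral_add ((hsq n).const_mul _) ((hsq n').const_mul _), integral_const_mul,
              integral_const_mul, S.integral_haarComponent_sq hΦm,
              S.integral_haarComponent_sq hΦm]
            ring
    · exact (S.integral_haarComponent_mul_eq_zero hΦm hΦ h).le
  have hexp : ∀ σ, S.haarSum Φ lev m σ ^ 2 = ∑ n ∈ Finset.range (2 ^ m),
      ∑ n' ∈ Finset.range (2 ^ m), haarComponent Φ lev (S.scrambledBits n σ) *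
        haarComponent Φ lev (S.scrambledBits n' σ) := fun σ => by
    rw [haarSum, sq, Finset.sum_mul_sum]
  simp_rw [hexp]
  rw [integral_finsetSum _ fun n _ => integrable_finsetSum _ fun n' _ => hi n n']
  have hrow : ∀ n ∈ Finset.range (2 ^ m), ∫ σ, ∑ n' ∈ Finset.range (2 ^ m),
      haarComponent Φ lev (S.scrambledBits n σ) * haarComponent Φ lev (S.scrambledBits n' σ)
        ∂owenLaw d ≤ 2 ^ (S.netQuality + d) * V := by
    intro n _
    rw [integral_finsetSum _ fun n' _ => hi n n']
    refine (Finset.sum_le_sum fun n' _ => hterm n n').trans ?_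
    rw [← Finset.sum_filter, Finset.sum_const, nsmul_eq_mul]
    refine mul_le_mul_of_nonneg_right ?_ hV0
    have hcount := S.card_digits_le (m := m) (s := S.netQuality + d)
      (κ := fun j => lev j - 1) (by omega) (by
        have : ∑ j, lev j ≤ ∑ j : Fin d, ((lev j - 1) + 1) :=
          Finset.sum_le_sum fun j _ => by omega
        rw [Finset.sum_add_distrib] at this
        simp only [Finset.sum_const, Finset.card_univ, Fintype.card_fin, smul_eq_mul,
          mul_one] at this
        omega) (S.digits n)
    exact_mod_cast hcount
  refine (Finset.sum_le_sum hrow).trans (le_of_eq ?_)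
  rw [Finset.sum_const, Finset.card_range, nsmul_eq_mul]
  push_cast; ring

theorem measurable_haarSum {Φ : (Fin d → ℕ → Bool) → ℝ} (hΦm : Measurable Φ) (lev : Fin d → ℕ)
    (m : ℕ) : Measurable (S.haarSum Φ lev m) :=
  Finset.measurable_sum _ fun n _ =>
    (measurable_haarComponent hΦm lev).comp (S.measurable_scrambledBits n)

theorem memLp_haarSum {Φ : (Fin d → ℕ → Bool) → ℝ} (hΦm : Measurable Φ)
    (hΦ : Integrable Φ (digitLaw d)) (lev : Fin d → ℕ) (m : ℕ) :
    MemLp (S.haarSum Φ lev m) 2 (owenLaw d) := by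
  have : IsProbabilityMeasure (owenLaw d) := by unfold owenLaw; infer_instance
  refine MemLp.of_bound (S.measurable_haarSum hΦm lev m).aestronglyMeasurable
    (∑ _n ∈ Finset.range (2 ^ m), (∫ y, |Φ y| ∂digitLaw d) * ∏ j, 2 ^ (lev j - 1))
    (ae_of_all _ fun σ => ?_)
  exact (norm_sum_le _ _).trans (Finset.sum_le_sum fun n _ => abs_haarComponent_le hΦ lev _)

end SobolGenerator

theorem BoundaryGrowth.nonneg {φ : (Fin d → ℝ) → ℝ} {B : ℝ} {A : Fin d → ℝ}
    (hφ : BoundaryGrowth φ B A) : 0 ≤ B := by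
  have hy : (fun _ => 1 / 2 : Fin d → ℝ) ∈ openCube d := fun i => by norm_num
  exact nonneg_of_mul_nonneg_left ((abs_nonneg _).trans (hφ.abs_le hy))
    (boundaryWeight_pos A ∅ hy)

theorem sum_piFinset_prod_pow_le {q : ℝ} (hq0 : 0 ≤ q) (hq : q < 1) (K : ℕ) :
    ∑ lev ∈ Fintype.piFinset fun _ : Fin d => Finset.range K, ∏ j, q ^ lev j ≤
      ((1 - q)⁻¹) ^ d := by
  rw [← Finset.prod_univ_sum (fun _ : Fin d => Finset.range K) (fun _ l => q ^ l),
    Finset.prod_const, Finset.card_univ, Fintype.card_fin]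
  refine pow_le_pow_left₀ (Finset.sum_nonneg fun _ _ => by positivity) ?_ d
  exact (summable_geometric_of_lt_one hq0 hq).sum_le_tsum _ (fun _ _ => by positivity) |>.trans_eq
    (tsum_geometric_of_lt_one hq0 hq)

namespace SobolGenerator

variable (S : SobolGenerator d)

/-- The bound for measurable integrands; see `exists_eLpNorm_scrambled_le`. -/
theorem exists_eLpNorm_scrambled_le_of_measurable {A p : ℝ} (hA : 0 ≤ A) (hp : 1 / 2 ≤ p)
    (hAp : p < 1 - A) : ∃ C, 0 < C ∧ ∀ {φ : (Fin d → ℝ) → ℝ} {B : ℝ}, Measurable φ →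
      BoundaryGrowth φ B (fun _ => A) → ∀ m : ℕ,
      eLpNorm (fun σ => (1 / 2 ^ m : ℝ) * ∑ n ∈ Finset.range (2 ^ m), φ (S.scrambled σ n)
        - ∫ y in Icc (0 : Fin d → ℝ) 1, φ y) 2 (owenLaw d) ≤
      ENNReal.ofReal (C * B * ((2 : ℝ) ^ m) ^ (-p)) := by
  -- the levels decay at the rate `θ`, of which `β` is spent on summing over all levels
  set θ' := p - 1 / 2 with hθ'
  set θ := (θ' + (1 / 2 - A)) / 2 with hθ
  set β := θ - θ' with hβ
  have hβ0 : 0 < β := by linarith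
  obtain ⟨C₀, hC₀, hdiff⟩ := exists_integral_mixedDifference_sq_le d (A := A) (θ := θ) hA
    (by linarith) (by linarith)
  set t := S.netQuality with ht
  set q : ℝ := (2 : ℝ) ^ (-β) with hq
  have hq0 : 0 < q := by positivity
  have hq1 : q < 1 := Real.rpow_lt_one_of_one_lt_of_neg one_lt_two (by linarith)
  set C := √(2 ^ (t + d)) * √C₀ * (2 : ℝ) ^ (θ' * t) * ((1 - q)⁻¹) ^ d with hC
  have h1q : 0 < (1 - q)⁻¹ := inv_pos.2 (by linarith)
  refine ⟨C, by positivity, fun {φ B} hm hφ m => ?_⟩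
  have hB := hφ.nonneg
  set Φ : (Fin d → ℕ → Bool) → ℝ := fun x => φ (binaryPoint x) with hΦdef
  have hΦm : Measurable Φ := hm.comp measurable_binaryPoint
  have hΦ : Integrable Φ (digitLaw d) :=
    (measurePreserving_binaryPoint d).integrable_comp_of_integrable
      (hφ.integrableOn (by linarith))
  have hint : ∫ y in Icc (0 : Fin d → ℝ) 1, φ y = ∫ x, Φ x ∂digitLaw d := by
    rw [← (measurePreserving_binaryPoint d).map_eq,
      integral_map measurable_binaryPoint.aemeasurable hm.aestronglyMeasurable]
  -- the bound for a single Haar level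
  have hlevel : ∀ lev : Fin d → ℕ, lev ≠ 0 → eLpNorm (S.haarSum Φ lev m) 2 (owenLaw d) ≤
      ENNReal.ofReal (B * (√(2 ^ m) * √(2 ^ (t + d)) * √C₀ * (2 : ℝ) ^ (θ' * t)
        * (2 : ℝ) ^ (-(θ' * m)) * ∏ j, q ^ lev j)) := by
    intro lev h0
    rcases le_or_gt (∑ j, lev j + t) m with hle | hgt
    · have : S.haarSum Φ lev m = 0 := funext fun σ => S.haarSum_eq_zero hΦ h0 hle σ
      rw [this, eLpNorm_zero]; exact zero_le
    · have hc : 0 ≤ B * (√(2 ^ m) * √(2 ^ (t + d)) * √C₀ * (2 : ℝ) ^ (θ' * t)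
        * (2 : ℝ) ^ (-(θ' * m)) * ∏ j, q ^ lev j) := by positivity
      refine eLpNorm_two_le_of_integral_sq_le (S.memLp_haarSum hΦm hΦ lev m) hc ?_
      refine (S.integral_haarSum_sq_le hΦm hΦ hgt.le).trans ?_
      obtain ⟨hsq, hle⟩ := hdiff hm hφ lev
      have h1 := (integral_haarComponent_sq_le hΦm hΦ lev (fun j hj => (Finset.mem_filter.1 hj).2)
        hsq).trans hle
      have h2 : ∏ j, ((2 : ℝ) ^ (-(2 * θ))) ^ lev j ≤
          ((2 : ℝ) ^ (θ' * t) * (2 : ℝ) ^ (-(θ' * m)) * ∏ j, q ^ lev j) ^ 2 := by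
        rw [Finset.prod_pow_eq_pow_sum, Finset.prod_pow_eq_pow_sum, hq]
        simp only [← Real.rpow_natCast, ← Real.rpow_mul two_pos.le, ← Real.rpow_add two_pos]
        refine Real.rpow_le_rpow_of_exponent_le one_le_two ?_
        have h3 : (m : ℝ) ≤ ((∑ j, lev j : ℕ) : ℝ) + t := by exact_mod_cast hgt.le
        have h4 : θ = θ' + β := by rw [hβ]; ring
        rw [h4]
        have h5 : θ' * m ≤ θ' * (((∑ j, lev j : ℕ) : ℝ) + t) :=
          mul_le_mul_of_nonneg_left h3 (by linarith)
        push_cast at h5 ⊢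
        nlinarith
      calc (2 : ℝ) ^ m * 2 ^ (t + d) * ∫ x, haarComponent Φ lev x ^ 2 ∂digitLaw d
          ≤ 2 ^ m * 2 ^ (t + d) * (B ^ 2 * (C₀ * ((2 : ℝ) ^ (θ' * t) * (2 : ℝ) ^ (-(θ' * m))
            * ∏ j, q ^ lev j) ^ 2)) := by
            refine mul_le_mul_of_nonneg_left (h1.trans ?_) (by positivity)
            gcongr
        _ = _ := by
            have e1 : (√(2 ^ m) : ℝ) ^ 2 = 2 ^ m := Real.sq_sqrt (by positivity)
            have e2 : (√(2 ^ (t + d)) : ℝ) ^ 2 = 2 ^ (t + d) := Real.sq_sqrt (by positivity)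
            have e3 : √C₀ ^ 2 = C₀ := Real.sq_sqrt hC₀.le
            conv_lhs => rw [← e1, ← e2, ← e3]
            ring
  -- the error of the conditional expectation given the first `K` digits, which tends to the error
  -- of the function itself; Fatou's lemma carries the bound over
  set F : ℕ → Scrambling d → ℝ := fun K σ => (1 / 2 ^ m : ℝ) *
    ∑ lev ∈ (Fintype.piFinset fun _ : Fin d => Finset.range (K + 1)).erase 0,
      S.haarSum Φ lev m σ with hF
  have hFeq : ∀ K σ, F K σ = (1 / 2 ^ m : ℝ) * ∑ n ∈ Finset.range (2 ^ m),
      (∫ y, Φ y * boxKernel (fun _ => K) (S.scrambledBits n σ) y ∂digitLaw d)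
      - ∫ x, Φ x ∂digitLaw d := by
    intro K σ
    simp_rw [← sum_haarComponent hΦ]
    rw [Finset.sum_comm, ← Finset.add_sum_erase _ _ (show (0 : Fin d → ℕ) ∈
      Fintype.piFinset fun _ : Fin d => Finset.range (K + 1) by simp)]
    simp only [haarComponent_zero, Finset.sum_const, Finset.card_range, nsmul_eq_mul, hF, haarSum]
    push_cast
    rw [mul_add, ← mul_assoc, one_div, inv_mul_cancel₀ (by positivity : (2 : ℝ) ^ m ≠ 0)]
    ring
  have hFm : ∀ K, Measurable (F K) := fun K =>
    (Finset.measurable_sum _ fun lev _ => S.measurable_haarSum hΦm lev m).const_mul _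
  have hFle : ∀ K, eLpNorm (F K) 2 (owenLaw d) ≤
      ENNReal.ofReal (C * B * ((2 : ℝ) ^ m) ^ (-p)) := by
    intro K
    set s := (Fintype.piFinset fun _ : Fin d => Finset.range (K + 1)).erase 0
    have e1 : F K = (1 / 2 ^ m : ℝ) • ∑ lev ∈ s, S.haarSum Φ lev m := by
      ext σ; simp [hF, s, Finset.sum_apply]
    have e2 : ‖(1 / 2 ^ m : ℝ)‖ₑ = ENNReal.ofReal (1 / 2 ^ m) :=
      Real.enorm_of_nonneg (by positivity)
    rw [e1, eLpNorm_const_smul, e2]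
    have e3 : eLpNorm (∑ lev ∈ s, S.haarSum Φ lev m) 2 (owenLaw d) ≤
        ENNReal.ofReal (B * (√(2 ^ m) * √(2 ^ (t + d)) * √C₀ * (2 : ℝ) ^ (θ' * t)
        * (2 : ℝ) ^ (-(θ' * m)) * ((1 - q)⁻¹) ^ d)) := by
      refine (eLpNorm_sum_le (fun lev _ => (S.measurable_haarSum hΦm lev m).aestronglyMeasurable)
        (by norm_num)).trans ?_
      refine (Finset.sum_le_sum fun lev hlev => hlevel lev (Finset.ne_of_mem_erase hlev)).trans ?_
      rw [← ENNReal.ofReal_sum_of_nonneg fun lev _ => by positivity]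
      refine ENNReal.ofReal_le_ofReal ?_
      rw [← Finset.mul_sum, ← Finset.mul_sum]
      have hsum : ∑ lev ∈ s, ∏ j, q ^ lev j ≤ ((1 - q)⁻¹) ^ d :=
        (Finset.sum_le_sum_of_subset_of_nonneg (Finset.erase_subset _ _)
          fun _ _ _ => by positivity).trans (sum_piFinset_prod_pow_le hq0.le hq1 (K + 1))
      gcongr
    refine (mul_le_mul_right e3 _).trans ?_
    rw [← ENNReal.ofReal_mul (by positivity)]
    refine ENNReal.ofReal_le_ofReal (le_of_eq ?_)
    have e4 : (1 / 2 ^ m : ℝ) * √(2 ^ m) * (2 : ℝ) ^ (-(θ' * m)) = ((2 : ℝ) ^ m) ^ (-p) := by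
      rw [Real.sqrt_eq_rpow, one_div, ← Real.rpow_natCast, ← Real.rpow_neg two_pos.le,
        ← Real.rpow_mul two_pos.le, ← Real.rpow_mul two_pos.le, ← Real.rpow_add two_pos,
        ← Real.rpow_add two_pos]
      congr 1; rw [hθ']; ring
    rw [← e4, hC]; ring
  have hlim : ∀ᵐ σ ∂owenLaw d, Tendsto (fun K => F K σ) atTop (𝓝 ((1 / 2 ^ m : ℝ) *
      ∑ n ∈ Finset.range (2 ^ m), φ (S.scrambled σ n) - ∫ y in Icc (0 : Fin d → ℝ) 1, φ y)) := by
    have hall : ∀ᵐ σ ∂owenLaw d, ∀ n, binaryPoint (S.scrambledBits n σ) ∈ openCube d :=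
      ae_all_iff.2 fun n => (S.measurePreserving_scrambledBits n).quasiMeasurePreserving.ae
        (ae_binaryPoint_mem_openCube d)
    filter_upwards [hall] with σ hσ
    simp_rw [hFeq, hint]
    refine ((tendsto_finsetSum _ fun n _ => ?_).const_mul _).sub_const _
    rw [scrambled_eq]
    exact tendsto_integral_boxKernel hΦ
      (hφ.continuousOn.continuousAt ((isOpen_openCube d).mem_nhds (hσ n)))
  refine (Lp.eLpNorm_lim_le_liminf_eLpNorm (fun K => (hFm K).aestronglyMeasurable) _ hlim).trans ?_
  exact (liminf_le_liminf (Eventually.of_forall hFle)).trans_eq (liminf_const _)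

/-- The root mean square error of the mean over `N = 2 ^ m` scrambled Sobol' points is
`O (N ^ (-p))` for every `p < 1 - A`, uniformly over the integrands with the boundary growth
exponent `A < 1 / 2`. -/
theorem exists_eLpNorm_scrambled_le {A p : ℝ} (hA : 0 ≤ A) (hp : 1 / 2 ≤ p)
    (hAp : p < 1 - A) : ∃ C, 0 < C ∧ ∀ {φ : (Fin d → ℝ) → ℝ} {B : ℝ},
      BoundaryGrowth φ B (fun _ => A) → ∀ m : ℕ,
      eLpNorm (fun σ => (1 / 2 ^ m : ℝ) * ∑ n ∈ Finset.range (2 ^ m), φ (S.scrambled σ n)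
        - ∫ y in Icc (0 : Fin d → ℝ) 1, φ y) 2 (owenLaw d) ≤
      ENNReal.ofReal (C * B * ((2 : ℝ) ^ m) ^ (-p)) := by
  -- the values outside of the open cube do not matter, so the function may be assumed measurable
  classical
  obtain ⟨C, hC, h⟩ := S.exists_eLpNorm_scrambled_le_of_measurable hA hp hAp
  refine ⟨C, hC, fun {φ B} hφ m => ?_⟩
  have hmc := (isOpen_openCube d).measurableSet
  set ψ := (openCube d).indicator φ with hψ
  have hψφ : ∀ y ∈ openCube d, ψ y = φ y := fun y hy => indicator_of_mem hy φ
  have hψm : Measurable ψ := by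
    have := hφ.continuousOn.measurable_piecewise (continuousOn_const (c := (0 : ℝ))) hmc
    rwa [show (fun _ : Fin d → ℝ => (0 : ℝ)) = 0 from rfl, piecewise_eq_indicator] at this
  have hI : ∫ y in Icc (0 : Fin d → ℝ) 1, ψ y = ∫ y in Icc (0 : Fin d → ℝ) 1, φ y :=
    integral_congr_ae (by filter_upwards [ae_mem_openCube d] with y hy using hψφ y hy)
  refine le_of_eq_of_le (eLpNorm_congr_ae ?_) (h hψm (hφ.congr hψφ) m)
  have hall : ∀ᵐ σ ∂owenLaw d, ∀ n, S.scrambled σ n ∈ openCube d :=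
    ae_all_iff.2 fun n => (S.measurePreserving_scrambled n).quasiMeasurePreserving.ae
      (ae_mem_openCube d)
  filter_upwards [hall] with σ hσ
  simp only [hI, hψφ _ (hσ _)]

end SobolGenerator

end

/-! ### The mean square error of a multilevel estimator -/

section

variable {d : ℕ}

theorem BoundaryGrowth.add {φ ψ : (Fin d → ℝ) → ℝ} {B B' : ℝ} {A : Fin d → ℝ}
    (hφ : BoundaryGrowth φ B A) (hψ : BoundaryGrowth ψ B' A) :
    BoundaryGrowth (fun y => φ y + ψ y) (B + B') A := by
  obtain ⟨D, h1, h2, h3, h4⟩ := hφ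
  obtain ⟨D', h1', h2', h3', h4'⟩ := hψ
  refine ⟨fun u y => D u y + D' u y, fun y hy => by
    dsimp only; rw [h1 y hy, h1' y hy],
    fun u => (h2 u).add (h2' u), fun u j hj y hy => (h3 u j hj y hy).add (h3' u j hj y hy),
    fun u y hy => (abs_add_le _ _).trans ?_⟩
  rw [add_mul]
  exact add_le_add (h4 u y hy) (h4' u y hy)

theorem BoundaryGrowth.neg {φ : (Fin d → ℝ) → ℝ} {B : ℝ} {A : Fin d → ℝ}
    (hφ : BoundaryGrowth φ B A) : BoundaryGrowth (fun y => - φ y) B A := by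
  obtain ⟨D, h1, h2, h3, h4⟩ := hφ
  exact ⟨fun u y => - D u y, fun y hy => by dsimp only; rw [h1 y hy], fun u => (h2 u).neg,
    fun u j hj y hy => (h3 u j hj y hy).neg, fun u y hy => by rw [abs_neg]; exact h4 u y hy⟩

/-- If almost all sections of a function on a product have norm at most `c`, so has the function. -/
theorem eLpNorm_prod_le_of_ae {Ω Ω' : Type*} [MeasurableSpace Ω] [MeasurableSpace Ω']
    {μ : Measure Ω} {ν : Measure Ω'} [SFinite μ] [IsProbabilityMeasure ν] {F : Ω × Ω' → ℝ}
    (hF : AEStronglyMeasurable F (μ.prod ν)) {c : ENNReal}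
    (h : ∀ᵐ ρ ∂ν, eLpNorm (fun τ => F (τ, ρ)) 2 μ ≤ c) : eLpNorm F 2 (μ.prod ν) ≤ c := by
  rw [eLpNorm_eq_lintegral_rpow_enorm_toReal two_ne_zero ENNReal.ofNat_ne_top]
  simp only [ENNReal.toReal_ofNat]
  rw [one_div, ENNReal.rpow_inv_le_iff two_pos, lintegral_prod_symm _ (hF.enorm.pow_const _)]
  refine (lintegral_mono_ae (g := fun _ => c ^ (2 : ℝ)) ?_).trans (by simp)
  filter_upwards [h] with ρ hρ
  rw [eLpNorm_eq_lintegral_rpow_enorm_toReal two_ne_zero ENNReal.ofNat_ne_top] at hρ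
  simp only [ENNReal.toReal_ofNat] at hρ
  rwa [one_div, ENNReal.rpow_inv_le_iff two_pos] at hρ

instance (d : ℕ) : IsProbabilityMeasure (owenLaw d) := by unfold owenLaw; infer_instance

instance (d₁ d₂ : ℕ) : IsProbabilityMeasure (NestedData.law d₁ d₂) := by
  unfold NestedData.law; infer_instance

theorem isProbabilityMeasure_unitCube (d : ℕ) :
    IsProbabilityMeasure (volume.restrict (Icc (0 : Fin d → ℝ) 1)) := by
  rw [← (measurePreserving_binaryPoint d).map_eq]
  exact Measure.isProbabilityMeasure_map measurable_binaryPoint.aemeasurable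

theorem measurePreserving_outer (d₁ d₂ l : ℕ) :
    MeasurePreserving (fun ω : NestedData.Sample d₁ d₂ => ω.1 l) (NestedData.law d₁ d₂)
      (owenLaw d₁) :=
  (measurePreserving_eval_infinitePi (fun _ : ℕ => owenLaw d₁) l).comp measurePreserving_fst

theorem measurePreserving_outer_inner (d₁ d₂ l : ℕ) :
    MeasurePreserving (fun ω : NestedData.Sample d₁ d₂ => (ω.1 l, ω.2)) (NestedData.law d₁ d₂)
      ((owenLaw d₁).prod (owenLaw d₂)) :=
  (measurePreserving_eval_infinitePi (fun _ : ℕ => owenLaw d₁) l).prod (MeasurePreserving.id _)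

namespace SobolGenerator

variable {d₁ d₂ : ℕ} (S : SobolGenerator d₁)

/-- The mean of `φ` over the first `N` scrambled points. -/
noncomputable def scrambledMean (N : ℕ) (φ : (Fin d₁ → ℝ) → ℝ) (σ : Scrambling d₁) : ℝ :=
  (1 / (N : ℝ)) * ∑ n ∈ Finset.range N, φ (S.scrambled σ n)

theorem aestronglyMeasurable_scrambledMean {φ : (Fin d₁ → ℝ) → ℝ}
    (hφ : AEStronglyMeasurable φ (volume.restrict (Icc 0 1))) (N : ℕ) :
    AEStronglyMeasurable (S.scrambledMean N φ) (owenLaw d₁) := by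
  refine AEStronglyMeasurable.const_mul ?_ _
  exact Finset.aestronglyMeasurable_fun_sum _ fun n _ =>
    hφ.comp_measurePreserving (S.measurePreserving_scrambled n)

/-- The error of a multilevel estimator whose levels use independent scramblings and whose last
level depends on a further random scrambling: by the triangle inequality it is bounded by the
errors of the levels and the distance of the sum of the exact integrals to the limit `I`. -/
theorem eLpNorm_multilevel_le {A p C : ℝ} (hA : A < 1)
    (hC : ∀ {φ : (Fin d₁ → ℝ) → ℝ} {B : ℝ}, BoundaryGrowth φ B (fun _ => A) → ∀ m : ℕ,
      eLpNorm (fun σ => (1 / 2 ^ m : ℝ) * ∑ n ∈ Finset.range (2 ^ m), φ (S.scrambled σ n)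
        - ∫ y in Icc (0 : Fin d₁ → ℝ) 1, φ y) 2 (owenLaw d₁) ≤
      ENNReal.ofReal (C * B * ((2 : ℝ) ^ m) ^ (-p)))
    {L : ℕ} {ψ : ℕ → (Fin d₁ → ℝ) → ℝ} {ψL : Scrambling d₂ → (Fin d₁ → ℝ) → ℝ} {B : ℕ → ℝ}
    (hC0 : 0 ≤ C) (hB : ∀ l, 0 ≤ B l)
    (hψ : ∀ l < L, BoundaryGrowth (ψ l) (B l) fun _ => A)
    (hψL : ∀ᵐ ρ ∂owenLaw d₂, BoundaryGrowth (ψL ρ) (B L) fun _ => A)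
    (hm : AEStronglyMeasurable (fun z : (Fin d₁ → ℝ) × Scrambling d₂ => ψL z.2 z.1)
      ((volume.restrict (Icc 0 1)).prod (owenLaw d₂))) {I c : ℝ} (hc : 0 ≤ c)
    (hbias : ∀ᵐ ρ ∂owenLaw d₂, |∑ l ∈ Finset.range L, (∫ y in Icc (0 : Fin d₁ → ℝ) 1, ψ l y)
      + (∫ y in Icc (0 : Fin d₁ → ℝ) 1, ψL ρ y) - I| ≤ c) (k : ℕ → ℕ) :
    AEStronglyMeasurable (fun ω : NestedData.Sample d₁ d₂ =>
      ∑ l ∈ Finset.range L, S.scrambledMean (2 ^ k l) (ψ l) (ω.1 l)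
        + S.scrambledMean (2 ^ k L) (ψL ω.2) (ω.1 L)) (NestedData.law d₁ d₂) ∧
    eLpNorm (fun ω : NestedData.Sample d₁ d₂ =>
      ∑ l ∈ Finset.range L, S.scrambledMean (2 ^ k l) (ψ l) (ω.1 l)
        + S.scrambledMean (2 ^ k L) (ψL ω.2) (ω.1 L) - I) 2 (NestedData.law d₁ d₂) ≤
      ENNReal.ofReal (C * (∑ l ∈ Finset.range (L + 1), B l * ((2 : ℝ) ^ k l) ^ (-p)) + c) := by
  have hp := isProbabilityMeasure_unitCube d₁
  set J : ℕ → ℝ := fun l => ∫ y in Icc (0 : Fin d₁ → ℝ) 1, ψ l y with hJ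
  set JL : Scrambling d₂ → ℝ := fun ρ => ∫ y in Icc (0 : Fin d₁ → ℝ) 1, ψL ρ y with hJL
  -- the errors of the levels below the finest one, of the finest level, and the remaining bias
  set E : ℕ → NestedData.Sample d₁ d₂ → ℝ := fun l ω =>
    S.scrambledMean (2 ^ k l) (ψ l) (ω.1 l) - J l with hE
  set EL : NestedData.Sample d₁ d₂ → ℝ := fun ω =>
    S.scrambledMean (2 ^ k L) (ψL ω.2) (ω.1 L) - JL ω.2 with hEL
  set R : NestedData.Sample d₁ d₂ → ℝ := fun ω => ∑ l ∈ Finset.range L, J l + JL ω.2 - I with hR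
  have hJm : AEStronglyMeasurable JL (owenLaw d₂) := by
    have := hm.prod_swap
    exact this.integral_prod_right'
  have hmL : AEStronglyMeasurable (fun z : Scrambling d₁ × Scrambling d₂ =>
      S.scrambledMean (2 ^ k L) (ψL z.2) z.1) ((owenLaw d₁).prod (owenLaw d₂)) := by
    refine AEStronglyMeasurable.const_mul ?_ _
    exact Finset.aestronglyMeasurable_fun_sum _ fun n _ =>
      hm.comp_measurePreserving ((S.measurePreserving_scrambled n).prod (MeasurePreserving.id _))
  have hml : ∀ l < L, AEStronglyMeasurable (S.scrambledMean (2 ^ k l) (ψ l)) (owenLaw d₁) :=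
    fun l hl => S.aestronglyMeasurable_scrambledMean ((hψ l hl).integrableOn hA).1 _
  have hmean : ∀ (m : ℕ) (φ : (Fin d₁ → ℝ) → ℝ) (σ : Scrambling d₁), S.scrambledMean (2 ^ m) φ σ =
      (1 / 2 ^ m : ℝ) * ∑ n ∈ Finset.range (2 ^ m), φ (S.scrambled σ n) := fun m φ σ => by
    simp [scrambledMean]
  have hEm : ∀ l < L, AEStronglyMeasurable (E l) (NestedData.law d₁ d₂) := fun l hl =>
    ((hml l hl).comp_measurePreserving (measurePreserving_outer d₁ d₂ l)).sub
      aestronglyMeasurable_const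
  have hEle : ∀ l < L, eLpNorm (E l) 2 (NestedData.law d₁ d₂) ≤
      ENNReal.ofReal (C * B l * ((2 : ℝ) ^ k l) ^ (-p)) := by
    intro l hl
    have := hC (hψ l hl) (k l)
    simp_rw [← hmean] at this
    exact (eLpNorm_comp_measurePreserving (p := 2) ((hml l hl).sub aestronglyMeasurable_const)
      (measurePreserving_outer d₁ d₂ l)).trans_le this
  have hELm' : AEStronglyMeasurable (fun z : Scrambling d₁ × Scrambling d₂ =>
      S.scrambledMean (2 ^ k L) (ψL z.2) z.1 - JL z.2) ((owenLaw d₁).prod (owenLaw d₂)) :=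
    hmL.sub hJm.comp_snd
  have hELm : AEStronglyMeasurable EL (NestedData.law d₁ d₂) :=
    hELm'.comp_measurePreserving (measurePreserving_outer_inner d₁ d₂ L)
  have hELle : eLpNorm EL 2 (NestedData.law d₁ d₂) ≤
      ENNReal.ofReal (C * B L * ((2 : ℝ) ^ k L) ^ (-p)) := by
    have h1 : eLpNorm (fun z : Scrambling d₁ × Scrambling d₂ =>
        S.scrambledMean (2 ^ k L) (ψL z.2) z.1 - JL z.2) 2 ((owenLaw d₁).prod (owenLaw d₂)) ≤
        ENNReal.ofReal (C * B L * ((2 : ℝ) ^ k L) ^ (-p)) := by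
      refine eLpNorm_prod_le_of_ae hELm' ?_
      filter_upwards [hψL] with ρ hρ
      have := hC hρ (k L)
      simp_rw [← hmean] at this
      exact this
    rwa [← eLpNorm_comp_measurePreserving hELm' (measurePreserving_outer_inner d₁ d₂ L)] at h1
  have hRm : AEStronglyMeasurable R (NestedData.law d₁ d₂) :=
    (aestronglyMeasurable_const.add (hJm.comp_measurePreserving measurePreserving_snd)).sub
      aestronglyMeasurable_const
  have hRle : eLpNorm R 2 (NestedData.law d₁ d₂) ≤ ENNReal.ofReal c := by
    have h1 : ∀ᵐ ω ∂NestedData.law d₁ d₂, ‖R ω‖ ≤ c :=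
      (measurePreserving_snd (μ := Measure.infinitePi fun _ : ℕ => owenLaw d₁)
        (ν := owenLaw d₂)).quasiMeasurePreserving.ae hbias
    refine (eLpNorm_le_of_ae_bound h1).trans ?_
    simp
  have hdecomp : (fun ω : NestedData.Sample d₁ d₂ =>
      ∑ l ∈ Finset.range L, S.scrambledMean (2 ^ k l) (ψ l) (ω.1 l)
        + S.scrambledMean (2 ^ k L) (ψL ω.2) (ω.1 L) - I) =
      ∑ l ∈ Finset.range L, E l + EL + R := by
    ext ω
    simp only [Pi.add_apply, Finset.sum_apply, hE, hEL, hR, Finset.sum_sub_distrib]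
    ring
  have hsm : AEStronglyMeasurable (∑ l ∈ Finset.range L, E l) (NestedData.law d₁ d₂) :=
    Finset.aestronglyMeasurable_sum _ fun l hl => hEm l (Finset.mem_range.1 hl)
  refine ⟨?_, ?_⟩
  · have h2 := ((hsm.add hELm).add hRm).add (aestronglyMeasurable_const (b := I))
    refine h2.congr (ae_of_all _ fun ω => ?_)
    have := congrFun hdecomp ω
    simp only [Pi.add_apply] at this ⊢
    linarith
  · rw [hdecomp]
    have hterm : ∀ l, 0 ≤ C * B l * ((2 : ℝ) ^ k l) ^ (-p) := fun l => by
      have := hB l; positivity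
    refine (eLpNorm_add_le (hsm.add hELm) hRm (by norm_num)).trans ?_
    rw [ENNReal.ofReal_add (mul_nonneg hC0 (Finset.sum_nonneg fun l _ => by
      have := hB l; positivity)) hc]
    refine add_le_add ((eLpNorm_add_le hsm hELm (by norm_num)).trans ?_) hRle
    rw [Finset.sum_range_succ, mul_add, ENNReal.ofReal_add (mul_nonneg hC0
      (Finset.sum_nonneg fun l _ => by have := hB l; positivity))
      (by have := hterm L; rwa [mul_assoc] at this), ← mul_assoc]
    refine add_le_add ((eLpNorm_sum_le (fun l hl => hEm l (Finset.mem_range.1 hl))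
      (by norm_num)).trans ?_) hELle
    rw [Finset.mul_sum]
    simp_rw [← mul_assoc]
    rw [ENNReal.ofReal_sum_of_nonneg fun l _ => hterm l]
    exact Finset.sum_le_sum fun l hl => hEle l (Finset.mem_range.1 hl)

end SobolGenerator

end

/-! ### The nested estimator -/

section

/-- Taylor's formula with integral remainder. -/
theorem eq_add_taylorLinear_add_taylorRemainder {f : ℝ → ℝ} {D : Set ℝ} (hD : IsOpen D)
    (hDc : D.OrdConnected) (hf : ContDiffOn ℝ 2 f D) {a b : ℝ} (ha : a ∈ D) (hb : b ∈ D) :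
    f a = f b + taylorLinear f a b + taylorRemainder f a b := by
  have hf1 : ContDiffOn ℝ 1 (deriv f) D := hf.deriv_of_isOpen hD (by norm_num)
  have hf2 : ContinuousOn (deriv (deriv f)) D := hf1.continuousOn_deriv_of_isOpen hD le_rfl
  have hd0 : ∀ x ∈ D, HasDerivAt f (deriv f x) x := fun x hx =>
    ((hf.differentiableOn (by norm_num)).differentiableAt (hD.mem_nhds hx)).hasDerivAt
  have hd1 : ∀ x ∈ D, HasDerivAt (deriv f) (deriv (deriv f) x) x := fun x hx =>
    ((hf1.differentiableOn (by norm_num)).differentiableAt (hD.mem_nhds hx)).hasDerivAt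
  have hseg : ∀ s ∈ Icc (0 : ℝ) 1, b + s * (a - b) ∈ D := by
    intro s hs
    have := hDc.convex.add_smul_sub_mem hb ha hs
    simpa [smul_eq_mul] using this
  have hlin : ∀ s : ℝ, HasDerivAt (fun s => b + s * (a - b)) (a - b) s := fun s => by
    simpa using ((hasDerivAt_id s).mul_const (a - b)).const_add b
  -- the derivative of the Taylor polynomial in its centre telescopes
  have hder : ∀ s ∈ uIcc (0 : ℝ) 1, HasDerivAt
      (fun s => f (b + s * (a - b)) + (1 - s) * (a - b) * deriv f (b + s * (a - b)))
      ((a - b) ^ 2 * (deriv (deriv f) (b + s * (a - b)) * (1 - s))) s := by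
    intro s hs
    rw [uIcc_of_le zero_le_one] at hs
    have h1 := (hd0 _ (hseg s hs)).comp s (hlin s)
    have h2 := (hd1 _ (hseg s hs)).comp s (hlin s)
    have h3 : HasDerivAt (fun s : ℝ => (1 - s) * (a - b)) (-(a - b)) s := by
      simpa using ((hasDerivAt_id s).const_sub 1).mul_const (a - b)
    refine (h1.add (h3.mul h2)).congr_deriv ?_
    simp only [Function.comp_apply]
    ring
  have hcont : ContinuousOn (fun s => (a - b) ^ 2 * (deriv (deriv f) (b + s * (a - b)) * (1 - s)))
      (uIcc (0 : ℝ) 1) := by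
    rw [uIcc_of_le zero_le_one]
    refine continuousOn_const.mul ((hf2.comp (by fun_prop) hseg).mul (by fun_prop))
  have := intervalIntegral.integral_eq_sub_of_hasDerivAt hder hcont.intervalIntegrable
  rw [intervalIntegral.integral_const_mul] at this
  simp only [one_mul, sub_self, zero_mul, sub_zero, add_zero] at this
  unfold taylorLinear taylorRemainder
  rw [this, show b + (a - b) = a by ring]
  ring

variable {d₁ d₂ : ℕ}

/-- The mean of a function with values in an interval lies in the interval. -/
theorem innerIntegral_mem {D : Set ℝ} (hD : D.OrdConnected)
    {G : (Fin d₁ → ℝ) → (Fin d₂ → ℝ) → ℝ} {y : Fin d₁ → ℝ}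
    (hG : ∀ x ∈ Icc (0 : Fin d₂ → ℝ) 1, G y x ∈ D) (hi : IntegrableOn (G y) (Icc 0 1)) :
    innerIntegral G y ∈ D := by
  have := isProbabilityMeasure_unitCube d₂
  have hnull : volume.restrict (Icc (0 : Fin d₂ → ℝ) 1) (Icc 0 1)ᶜ = 0 := by
    rw [Measure.restrict_apply measurableSet_Icc.compl]; simp
  obtain ⟨x, hx, hle⟩ := exists_notMem_null_le_integral hi hnull
  obtain ⟨x', hx', hle'⟩ := exists_notMem_null_integral_le hi hnull
  exact hD.out (hG x (notMem_compl_iff.1 hx)) (hG x' (notMem_compl_iff.1 hx')) ⟨hle, hle'⟩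

theorem innerMean_mem {D : Set ℝ} (hD : D.OrdConnected)
    {G : (Fin d₁ → ℝ) → (Fin d₂ → ℝ) → ℝ} {y : Fin d₁ → ℝ} {M : ℕ} (hM : 1 ≤ M)
    {x : ℕ → Fin d₂ → ℝ} (hG : ∀ m, G y (x m) ∈ D) : innerMean G M x y ∈ D := by
  unfold innerMean
  rw [Finset.mul_sum]
  have hM' : (M : ℝ) ≠ 0 := by positivity
  have := hD.convex.sum_mem (t := Finset.range M) (w := fun _ => 1 / (M : ℝ))
    (z := fun m => G y (x m)) (fun _ _ => by positivity) (by simp [hM']) fun m _ => hG m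
  simpa only [smul_eq_mul] using this

namespace NestedData

variable (Q : NestedData d₁ d₂)

theorem one_le_M (hM₀ : 1 ≤ Q.M₀) (l : ℕ) : 1 ≤ Q.M l := by
  unfold M
  split_ifs
  exacts [hM₀, Nat.one_le_two_pow]

/-- The number of inner points is at least the number prescribed before rounding. -/
theorem two_rpow_le_M (hM₀ : 1 ≤ Q.M₀) (l : ℕ) :
    (2 : ℝ) ^ (Q.ηw / (1 - Q.ε) * l) ≤ Q.M l := by
  have hM1 : (1 : ℝ) ≤ Q.M₀ := by exact_mod_cast hM₀
  unfold M
  split_ifs with h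
  · simpa [h] using hM₀
  · have hx : 0 < (Q.M₀ : ℝ) * ((2 : ℝ) ^ (Q.ηw / (1 - Q.ε))) ^ l := by positivity
    have h1 := Nat.le_ceil (Real.logb 2 (Q.M₀ * ((2 : ℝ) ^ (Q.ηw / (1 - Q.ε))) ^ l))
    rw [Real.logb_le_iff_le_rpow one_lt_two hx, Real.rpow_natCast] at h1
    push_cast
    refine le_trans ?_ h1
    rw [Real.rpow_mul two_pos.le, Real.rpow_natCast]
    exact le_mul_of_one_le_left (by positivity) hM1

/-- Rounding up to a power of two at most doubles the number of inner points. -/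
theorem M_le (hM₀ : 1 ≤ Q.M₀) (hηw : 0 < Q.ηw) (hε : Q.ε < 1) (l : ℕ) :
    (Q.M l : ℝ) ≤ 2 * Q.M₀ * (2 : ℝ) ^ (Q.ηw / (1 - Q.ε) * l) := by
  have hM1 : (1 : ℝ) ≤ Q.M₀ := by exact_mod_cast hM₀
  unfold M
  split_ifs with h
  · rw [h]; simp; linarith
  · have hq : 0 ≤ Q.ηw / (1 - Q.ε) := div_nonneg hηw.le (by linarith)
    have hx1 : 1 ≤ (Q.M₀ : ℝ) * ((2 : ℝ) ^ (Q.ηw / (1 - Q.ε))) ^ l :=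
      one_le_mul_of_one_le_of_one_le hM1 (one_le_pow₀ (Real.one_le_rpow one_le_two hq))
    have hlog : 0 ≤ Real.logb 2 (Q.M₀ * ((2 : ℝ) ^ (Q.ηw / (1 - Q.ε))) ^ l) :=
      Real.logb_nonneg one_lt_two hx1
    have h1 := (Nat.ceil_lt_add_one hlog).le
    push_cast
    rw [← Real.rpow_natCast]
    refine (Real.rpow_le_rpow_of_exponent_le one_le_two h1).trans (le_of_eq ?_)
    rw [Real.rpow_add two_pos, Real.rpow_one, Real.rpow_logb two_pos (by norm_num) (by linarith),
      Real.rpow_mul two_pos.le, Real.rpow_natCast]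
    ring

theorem M_rpow_le (hM₀ : 1 ≤ Q.M₀) (hε : Q.ε < 1) (l : ℕ) :
    (Q.M l : ℝ) ^ (-1 + Q.ε) ≤ (2 : ℝ) ^ (-(Q.ηw * l)) := by
  refine (Real.rpow_le_rpow_of_nonpos (by positivity) (Q.two_rpow_le_M hM₀ l)
    (by linarith)).trans (le_of_eq ?_)
  rw [← Real.rpow_mul two_pos.le]
  congr 1
  have : 1 - Q.ε ≠ 0 := by linarith
  field_simp
  ring

theorem h_pos (hh₀ : 0 < Q.h₀) (l : ℕ) : 0 < Q.h l := by unfold h; positivity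

theorem h_rpow (hh₀ : 0 < Q.h₀) (l : ℕ) (s : ℝ) :
    Q.h l ^ s = Q.h₀ ^ s * (2 : ℝ) ^ (-(s * l)) := by
  unfold h
  rw [Real.div_rpow hh₀.le (by positivity), ← Real.rpow_natCast, ← Real.rpow_mul two_pos.le,
    Real.rpow_neg two_pos.le, div_eq_mul_inv, mul_comm (l : ℝ) s]

theorem two_rpow_neg_mul_le {a b : ℝ} (h : a ≤ b) (l : ℕ) :
    (2 : ℝ) ^ (-(b * l)) ≤ (2 : ℝ) ^ (-(a * l)) :=
  Real.rpow_le_rpow_of_exponent_le one_le_two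
    (neg_le_neg (mul_le_mul_of_nonneg_right h (Nat.cast_nonneg l)))

theorem M_rpow_two_mul (l : ℕ) :
    (Q.M l : ℝ) ^ (-2 + 2 * Q.ε) = ((Q.M l : ℝ) ^ (-1 + Q.ε)) ^ 2 := by
  rw [← Real.rpow_natCast, ← Real.rpow_mul (by positivity)]
  congr 1; push_cast; ring

theorem measurable_ranMean (hghm : ∀ l, Measurable (Function.uncurry (Q.gh (Q.h l)))) (l : ℕ) :
    Measurable fun z : (Fin d₁ → ℝ) × Scrambling d₂ => Q.ranMean l z.2 z.1 := by
  unfold ranMean innerMean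
  refine Measurable.const_mul (Finset.measurable_sum _ fun m _ => ?_) _
  exact (hghm l).comp (f := fun z : (Fin d₁ → ℝ) × Scrambling d₂ =>
    (z.1, Q.inner.scrambled z.2 m)) (measurable_fst.prodMk
      ((Q.inner.measurePreserving_scrambled m).measurable.comp measurable_snd))

theorem measurable_detMean (hghm : ∀ l, Measurable (Function.uncurry (Q.gh (Q.h l)))) (l : ℕ) :
    Measurable (Q.detMean l) := by
  unfold detMean innerMean
  refine Measurable.const_mul (Finset.measurable_sum _ fun m _ => ?_) _
  exact (hghm l).comp (measurable_id.prodMk measurable_const)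

/-- The integrand of level `l` of the telescoping sum. -/
noncomputable def levelIntegrand (l : ℕ) (y : Fin d₁ → ℝ) : ℝ :=
  if l = 0 then Q.f (Q.detMean 0 y) else Q.f (Q.detMean l y) - Q.f (Q.detMean (l - 1) y)

/-- The integrand of the finest level. -/
noncomputable def finestIntegrand (L : ℕ) (ρ : Scrambling d₂) (y : Fin d₁ → ℝ) : ℝ :=
  Q.f (Q.ranMean L ρ y) - Q.f (Q.detMean (L - 1) y)

theorem estimator_eq {L : ℕ} (hL : 1 ≤ L) (N : ℕ → ℕ) (ω : Sample d₁ d₂) :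
    Q.estimator L N ω =
      ∑ l ∈ Finset.range L, Q.outer.scrambledMean (N l) (Q.levelIntegrand l) (ω.1 l)
        + Q.outer.scrambledMean (N L) (Q.finestIntegrand L ω.2) (ω.1 L) := by
  rw [Finset.sum_range_eq_add_Ico _ hL]
  unfold estimator SobolGenerator.scrambledMean finestIntegrand
  congr 1
  congr 1
  refine Finset.sum_congr rfl fun l hl => ?_
  have : l ≠ 0 := by have := (Finset.mem_Ico.1 hl).1; omega
  simp [levelIntegrand, this]

/-- On the cube, `f` at an approximation of the inner integral is `f` at the exact inner integral
plus two Taylor terms, so the difference inherits the growth conditions of these. -/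
theorem boundaryGrowth_sub_of_taylor {f : ℝ → ℝ} {D : Set ℝ} (hD : IsOpen D)
    (hDc : D.OrdConnected) (hf : ContDiffOn ℝ 2 f D) {a b : (Fin d₁ → ℝ) → ℝ}
    (ha : ∀ y ∈ openCube d₁, a y ∈ D) (hb : ∀ y ∈ openCube d₁, b y ∈ D)
    {B₁ B₂ K : ℝ} {A₁ A₂ A : Fin d₁ → ℝ} (hK : B₁ + B₂ ≤ K)
    (h₁ : BoundaryGrowth (fun y => taylorLinear f (a y) (b y)) B₁ A₁)
    (h₂ : BoundaryGrowth (fun y => taylorRemainder f (a y) (b y)) B₂ A₂)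
    (hA₁ : ∀ i, A₁ i ≤ A i) (hA₂ : ∀ i, A₂ i ≤ A i) :
    BoundaryGrowth (fun y => f (a y) - f (b y)) K A := by
  have h := (h₁.mono h₁.nonneg le_rfl hA₁).add (h₂.mono h₂.nonneg le_rfl hA₂)
  refine (h.mono (h.nonneg.trans hK) hK fun _ => le_rfl).congr fun y hy => ?_
  rw [eq_add_taylorLinear_add_taylorRemainder hD hDc hf (ha y hy) (hb y hy)]
  ring

/-- The root mean square error of the estimator with `N l = 2 ^ k l` outer points on level `l`: the
level differences are of the order `2 ^ (-min ηw ηs l)`, and the bias is of the order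
`2 ^ (-ηw L)`. -/
theorem exists_eLpNorm_estimator_sub_le [NeZero d₁] (Q : NestedData d₁ d₂)
    {ηs : ℝ} (hM₀ : 1 ≤ Q.M₀) (hh₀ : 0 < Q.h₀) (hηw : 0 < Q.ηw) (hηs : 0 < ηs)
    {D : Set ℝ} (hDopen : IsOpen D) (hDconn : D.OrdConnected) (hf : ContDiffOn ℝ 2 Q.f D)
    (hgD : ∀ y ∈ openCube d₁, ∀ x ∈ Icc (0 : Fin d₂ → ℝ) 1, Q.g y x ∈ D)
    (hghD : ∀ l, ∀ y ∈ openCube d₁, ∀ x ∈ Icc (0 : Fin d₂ → ℝ) 1, Q.gh (Q.h l) y x ∈ D)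
    (hghm : ∀ l, Measurable (Function.uncurry (Q.gh (Q.h l))))
    (hgi : ∀ y ∈ openCube d₁, IntegrableOn (Q.g y) (Icc 0 1))
    (hghi : ∀ l, ∀ y ∈ openCube d₁, IntegrableOn (Q.gh (Q.h l) y) (Icc 0 1))
    (hfg : IntegrableOn (fun y => Q.f (innerIntegral Q.g y)) (Icc 0 1))
    {Cw : ℝ} (hCw : 0 < Cw)
    (hweak : ∀ l, 1 ≤ l →
      IntegrableOn (fun y => Q.f (innerIntegral (Q.gh (Q.h l)) y)) (Icc 0 1) ∧
      |(∫ y in Icc (0 : Fin d₁ → ℝ) 1, Q.f (innerIntegral (Q.gh (Q.h l)) y)) - Q.integral|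
        ≤ Cw * Q.h l ^ Q.ηw)
    {Cd Cs b₀ b₁ b₂ b₃ b₄ : ℝ} (hCd : 0 < Cd) (hCs : 0 < Cs)
    (hb₀ : 0 < b₀) (hb₁ : 0 < b₁) (hb₂ : 0 < b₂) (hb₃ : 0 < b₃) (hb₄ : 0 < b₄)
    {A₀ A₁ A₂ A₃ A₄ : Fin d₁ → ℝ} (hA₃ : maxExponent A₃ < 1) (hA₄ : maxExponent A₄ < 1)
    {A : ℝ} (hA0 : 0 ≤ A) (hAA₀ : maxExponent A₀ ≤ A) (hAA₁ : maxExponent A₁ ≤ A)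
    (hAA₂ : maxExponent A₂ ≤ A) (hε : Q.ε < 1)
    (hφ₀ : BoundaryGrowth (fun y => Q.f (Q.detMean 0 y)) b₀ A₀)
    (hφ₁ : ∀ l, BoundaryGrowth
      (fun y => taylorLinear Q.f (Q.detMean l y) (innerIntegral Q.g y))
      ((Cd * (Q.M l : ℝ) ^ (-1 + Q.ε) + Cs * Q.h l ^ ηs) * b₁) A₁)
    (hφ₂ : ∀ l, BoundaryGrowth
      (fun y => taylorRemainder Q.f (Q.detMean l y) (innerIntegral Q.g y))
      ((Cd ^ 2 * (Q.M l : ℝ) ^ (-2 + 2 * Q.ε) + Cs ^ 2 * Q.h l ^ (2 * ηs)) * b₂) A₂)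
    (hφ₁' : ∀ l, 1 ≤ l → ∀ᵐ ρ ∂owenLaw d₂, BoundaryGrowth
      (fun y => taylorLinear Q.f (Q.ranMean l ρ y) (innerIntegral Q.g y))
      ((Cd * (Q.M l : ℝ) ^ (-1 + Q.ε) + Cs * Q.h l ^ ηs) * b₁) A₁)
    (hφ₂' : ∀ l, 1 ≤ l → ∀ᵐ ρ ∂owenLaw d₂, BoundaryGrowth
      (fun y => taylorRemainder Q.f (Q.ranMean l ρ y) (innerIntegral Q.g y))
      ((Cd ^ 2 * (Q.M l : ℝ) ^ (-2 + 2 * Q.ε) + Cs ^ 2 * Q.h l ^ (2 * ηs)) * b₂) A₂)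
    (hφ₃ : ∀ l, 1 ≤ l → ∀ᵐ ρ ∂owenLaw d₂, ∀ y ∈ openCube d₁,
      |taylorLinear Q.f (Q.ranMean l ρ y) (innerIntegral (Q.gh (Q.h l)) y)|
        ≤ Cd * (Q.M l : ℝ) ^ (-1 + Q.ε) * b₃ * boundaryWeight A₃ ∅ y)
    (hφ₄ : ∀ l, 1 ≤ l → ∀ᵐ ρ ∂owenLaw d₂, ∀ y ∈ openCube d₁,
      |taylorRemainder Q.f (Q.ranMean l ρ y) (innerIntegral (Q.gh (Q.h l)) y)|
        ≤ Cd ^ 2 * (Q.M l : ℝ) ^ (-2 + 2 * Q.ε) * b₄ * boundaryWeight A₄ ∅ y)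
    {p : ℝ} (hp : 1 / 2 ≤ p) (hAp : p < 1 - A) :
    ∃ K, 0 < K ∧ ∀ L, 1 ≤ L → ∀ k : ℕ → ℕ,
      AEStronglyMeasurable (Q.estimator L fun l => 2 ^ k l) (law d₁ d₂) ∧
      eLpNorm (fun ω => Q.estimator L (fun l => 2 ^ k l) ω - Q.integral) 2 (law d₁ d₂) ≤
        ENNReal.ofReal (K * (∑ l ∈ Finset.range (L + 1),
          (2 : ℝ) ^ (-(min Q.ηw ηs * l)) * ((2 : ℝ) ^ k l) ^ (-p)
            + (2 : ℝ) ^ (-(Q.ηw * L)))) := by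
  set v := min Q.ηw ηs with hv
  have hle : ∀ {A' : Fin d₁ → ℝ}, maxExponent A' ≤ A → ∀ i, A' i ≤ A := fun h i =>
    (Finset.le_sup' _ (Finset.mem_univ i)).trans h
  have hgbar : ∀ y ∈ openCube d₁, innerIntegral Q.g y ∈ D := fun y hy =>
    innerIntegral_mem hDconn (hgD y hy) (hgi y hy)
  have hghbar : ∀ l, ∀ y ∈ openCube d₁, innerIntegral (Q.gh (Q.h l)) y ∈ D := fun l y hy =>
    innerIntegral_mem hDconn (hghD l y hy) (hghi l y hy)
  have hdet : ∀ l, ∀ y ∈ openCube d₁, Q.detMean l y ∈ D := fun l y hy =>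
    innerMean_mem hDconn (Q.one_le_M hM₀ l) fun m => hghD l y hy _ (Q.inner.point_mem_Icc m)
  have hran : ∀ l ρ, ∀ y ∈ openCube d₁, Q.ranMean l ρ y ∈ D := fun l ρ y hy =>
    innerMean_mem hDconn (Q.one_le_M hM₀ l) fun m => hghD l y hy _ (Q.inner.scrambled_mem_Icc ρ m)
  -- the size of the Taylor terms on level `l`
  set κ := (Cd + Cs * Q.h₀ ^ ηs) * b₁ + (Cd ^ 2 + Cs ^ 2 * Q.h₀ ^ (2 * ηs)) * b₂ with hκ
  have hκ0 : 0 < κ := by positivity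
  have hMle := Q.M_rpow_le hM₀ hε
  have hM2 : ∀ l : ℕ, (Q.M l : ℝ) ^ (-2 + 2 * Q.ε) ≤ (2 : ℝ) ^ (-(Q.ηw * l)) := fun l => by
    rw [Q.M_rpow_two_mul]
    have h1 : (2 : ℝ) ^ (-(Q.ηw * l)) ≤ 1 := by
      simpa using two_rpow_neg_mul_le (a := 0) hηw.le l
    have h0 : 0 ≤ (Q.M l : ℝ) ^ (-1 + Q.ε) := by positivity
    nlinarith [hMle l]
  have hsize : ∀ l, (Cd * (Q.M l : ℝ) ^ (-1 + Q.ε) + Cs * Q.h l ^ ηs) * b₁ +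
      (Cd ^ 2 * (Q.M l : ℝ) ^ (-2 + 2 * Q.ε) + Cs ^ 2 * Q.h l ^ (2 * ηs)) * b₂ ≤
      κ * (2 : ℝ) ^ (-(v * l)) := by
    intro l
    rw [Q.h_rpow hh₀, Q.h_rpow hh₀]
    have e1 := (hMle l).trans (two_rpow_neg_mul_le (min_le_left Q.ηw ηs) l)
    have e2 := (hM2 l).trans (two_rpow_neg_mul_le (min_le_left Q.ηw ηs) l)
    have e3 := two_rpow_neg_mul_le (min_le_right Q.ηw ηs) l
    have e4 := two_rpow_neg_mul_le ((min_le_right Q.ηw ηs).trans (by linarith : ηs ≤ 2 * ηs)) l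
    rw [← hv] at e1 e2 e3 e4
    calc _ ≤ (Cd * (2 : ℝ) ^ (-(v * l)) + Cs * (Q.h₀ ^ ηs * (2 : ℝ) ^ (-(v * l)))) * b₁ +
          (Cd ^ 2 * (2 : ℝ) ^ (-(v * l))
            + Cs ^ 2 * (Q.h₀ ^ (2 * ηs) * (2 : ℝ) ^ (-(v * l)))) * b₂ := by gcongr
      _ = _ := by rw [hκ]; ring
  have hdiff : ∀ l, BoundaryGrowth (fun y => Q.f (Q.detMean l y) - Q.f (innerIntegral Q.g y))
      (κ * (2 : ℝ) ^ (-(v * l))) fun _ => A := fun l =>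
    boundaryGrowth_sub_of_taylor hDopen hDconn hf (hdet l) hgbar (hsize l) (hφ₁ l) (hφ₂ l)
      (hle hAA₁) (hle hAA₂)
  have hdiff' : ∀ l, 1 ≤ l → ∀ᵐ ρ ∂owenLaw d₂, BoundaryGrowth
      (fun y => Q.f (Q.ranMean l ρ y) - Q.f (innerIntegral Q.g y))
      (κ * (2 : ℝ) ^ (-(v * l))) fun _ => A := fun l hl => by
    filter_upwards [hφ₁' l hl, hφ₂' l hl] with ρ h1 h2
    exact boundaryGrowth_sub_of_taylor hDopen hDconn hf (hran l ρ) hgbar (hsize l) h1 h2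
      (hle hAA₁) (hle hAA₂)
  set Kb := b₀ + κ * (1 + (2 : ℝ) ^ v) with hKb
  have hKb0 : 0 < Kb := by positivity
  set B : ℕ → ℝ := fun l => Kb * (2 : ℝ) ^ (-(v * l)) with hB
  have hB0 : ∀ l, 0 ≤ B l := fun l => by positivity
  have hstep : ∀ l : ℕ, 1 ≤ l →
      κ * (2 : ℝ) ^ (-(v * l)) + κ * (2 : ℝ) ^ (-(v * ((l - 1 : ℕ) : ℝ))) ≤ B l := by
    intro l hl
    have : (2 : ℝ) ^ (-(v * ((l - 1 : ℕ) : ℝ))) = (2 : ℝ) ^ v * (2 : ℝ) ^ (-(v * l)) := by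
      rw [← Real.rpow_add two_pos]; congr 1; push_cast [hl]; ring
    have h2 : 0 ≤ b₀ * (2 : ℝ) ^ (-(v * l)) := by positivity
    have h3 : B l = b₀ * (2 : ℝ) ^ (-(v * l)) + (κ * (2 : ℝ) ^ (-(v * l)) +
        κ * ((2 : ℝ) ^ v * (2 : ℝ) ^ (-(v * l)))) := by
      simp only [hB, hKb]; ring
    rw [this, h3]
    exact le_add_of_nonneg_left h2
  have hψ : ∀ l, BoundaryGrowth (Q.levelIntegrand l) (B l) fun _ => A := by
    intro l
    rcases Nat.eq_zero_or_pos l with rfl | hl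
    · have e : Q.levelIntegrand 0 = fun y => Q.f (Q.detMean 0 y) := by
        ext y; simp [levelIntegrand]
      rw [e]
      refine hφ₀.mono (hB0 0) ?_ (hle hAA₀)
      have h3 : B 0 = b₀ + κ * (1 + (2 : ℝ) ^ v) := by simp [hB, hKb]
      rw [h3]
      exact le_add_of_nonneg_right (by positivity)
    · refine (((hdiff l).add (hdiff (l - 1)).neg).mono (hB0 l) (hstep l hl)
        fun _ => le_rfl).congr fun y _ => ?_
      have : l ≠ 0 := by omega
      simp only [levelIntegrand, this, if_false]; ring
  have hψL : ∀ L, 1 ≤ L → ∀ᵐ ρ ∂owenLaw d₂, BoundaryGrowth (Q.finestIntegrand L ρ) (B L)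
      fun _ => A := by
    intro L hL
    filter_upwards [hdiff' L hL] with ρ hρ
    refine ((hρ.add (hdiff (L - 1)).neg).mono (hB0 L) (hstep L hL) fun _ => le_rfl).congr
      fun y _ => ?_
    simp only [finestIntegrand]; ring
  -- measurability of the finest level in both variables
  have hmeas : ∀ L, AEStronglyMeasurable
      (fun z : (Fin d₁ → ℝ) × Scrambling d₂ => Q.finestIntegrand L z.2 z.1)
      ((volume.restrict (Icc 0 1)).prod (owenLaw d₂)) := by
    intro L
    classical
    -- `f` is only known to be measurable on `D`, where the averages lie
    set F := D.indicator Q.f with hF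
    have hFm : Measurable F := by
      have := hf.continuousOn.measurable_piecewise (continuousOn_const (c := (0 : ℝ)))
        hDopen.measurableSet
      rwa [show (fun _ : ℝ => (0 : ℝ)) = 0 from rfl, piecewise_eq_indicator] at this
    have h1 : Measurable fun z : (Fin d₁ → ℝ) × Scrambling d₂ =>
        F (Q.ranMean L z.2 z.1) - F (Q.detMean (L - 1) z.1) :=
      (hFm.comp (Q.measurable_ranMean hghm L)).sub
        (hFm.comp ((Q.measurable_detMean hghm (L - 1)).comp measurable_fst))
    refine h1.aestronglyMeasurable.congr ?_
    have h2 : ∀ᵐ z ∂(volume.restrict (Icc (0 : Fin d₁ → ℝ) 1)).prod (owenLaw d₂),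
        z.1 ∈ openCube d₁ :=
      Measure.quasiMeasurePreserving_fst.ae (ae_mem_openCube d₁)
    filter_upwards [h2] with z hz
    simp only [finestIntegrand, hF, indicator_of_mem (hran L z.2 z.1 hz),
      indicator_of_mem (hdet (L - 1) z.1 hz)]
  -- the bias
  have hfdet : ∀ l, IntegrableOn (fun y => Q.f (Q.detMean l y)) (Icc 0 1) := fun l => by
    have := (hdiff l).integrableOn (by linarith)
    exact (this.add hfg).congr_fun (fun y _ => by simp) measurableSet_Icc
  have htel : ∀ L, 1 ≤ L → ∑ l ∈ Finset.range L,
      (∫ y in Icc (0 : Fin d₁ → ℝ) 1, Q.levelIntegrand l y) =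
      ∫ y in Icc (0 : Fin d₁ → ℝ) 1, Q.f (Q.detMean (L - 1) y) := by
    intro L hL
    induction L, hL using Nat.le_induction with
    | base => simp [levelIntegrand]
    | succ L hL ih =>
      rw [Finset.sum_range_succ, ih]
      have h0 : L ≠ 0 := by omega
      simp only [levelIntegrand, h0, if_false, Nat.add_sub_cancel]
      rw [integral_sub (hfdet L) (hfdet (L - 1))]
      ring
  set w₃ := ∫ y in Icc (0 : Fin d₁ → ℝ) 1, boundaryWeight (fun _ => maxExponent A₃) ∅ y with hw₃
  set w₄ := ∫ y in Icc (0 : Fin d₁ → ℝ) 1, boundaryWeight (fun _ => maxExponent A₄) ∅ y with hw₄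
  have hi₃ := integrableOn_boundaryWeight (d := d₁) hA₃
  have hi₄ := integrableOn_boundaryWeight (d := d₁) hA₄
  have hw₃0 : 0 ≤ w₃ := integral_nonneg_of_ae (by
    filter_upwards [ae_mem_openCube d₁] with y hy using (boundaryWeight_pos _ _ hy).le)
  have hw₄0 : 0 ≤ w₄ := integral_nonneg_of_ae (by
    filter_upwards [ae_mem_openCube d₁] with y hy using (boundaryWeight_pos _ _ hy).le)
  set Kc := Cd * b₃ * w₃ + Cd ^ 2 * b₄ * w₄ + Cw * Q.h₀ ^ Q.ηw with hKc
  have hKc0 : 0 < Kc := by positivity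
  have hbias : ∀ L, 1 ≤ L → ∀ᵐ ρ ∂owenLaw d₂, |∑ l ∈ Finset.range L,
      (∫ y in Icc (0 : Fin d₁ → ℝ) 1, Q.levelIntegrand l y)
      + (∫ y in Icc (0 : Fin d₁ → ℝ) 1, Q.finestIntegrand L ρ y) - Q.integral| ≤
      Kc * (2 : ℝ) ^ (-(Q.ηw * L)) := by
    intro L hL
    filter_upwards [hdiff' L hL, hφ₃ L hL, hφ₄ L hL] with ρ hρ h3 h4
    have hfran : IntegrableOn (fun y => Q.f (Q.ranMean L ρ y)) (Icc 0 1) := by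
      have := hρ.integrableOn (by linarith)
      exact (this.add hfg).congr_fun (fun y _ => by simp) measurableSet_Icc
    obtain ⟨hfh, hwk⟩ := hweak L hL
    have e1 : ∑ l ∈ Finset.range L, (∫ y in Icc (0 : Fin d₁ → ℝ) 1, Q.levelIntegrand l y)
        + (∫ y in Icc (0 : Fin d₁ → ℝ) 1, Q.finestIntegrand L ρ y) =
        ∫ y in Icc (0 : Fin d₁ → ℝ) 1, Q.f (Q.ranMean L ρ y) := by
      rw [htel L hL]
      simp only [finestIntegrand]
      rw [integral_sub hfran (hfdet (L - 1))]
      ring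
    rw [e1]
    have e2 : |(∫ y in Icc (0 : Fin d₁ → ℝ) 1, Q.f (Q.ranMean L ρ y)) -
        ∫ y in Icc (0 : Fin d₁ → ℝ) 1, Q.f (innerIntegral (Q.gh (Q.h L)) y)| ≤
        (Cd * b₃ * w₃ + Cd ^ 2 * b₄ * w₄) * (2 : ℝ) ^ (-(Q.ηw * L)) := by
      rw [← integral_sub hfran hfh]
      have hR : (Cd * b₃ * w₃ + Cd ^ 2 * b₄ * w₄) * (2 : ℝ) ^ (-(Q.ηw * L)) =
          ∫ y in Icc (0 : Fin d₁ → ℝ) 1,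
            (Cd * (2 : ℝ) ^ (-(Q.ηw * L)) * b₃ * boundaryWeight (fun _ => maxExponent A₃) ∅ y
            + Cd ^ 2 * (2 : ℝ) ^ (-(Q.ηw * L)) * b₄
              * boundaryWeight (fun _ => maxExponent A₄) ∅ y) := by
        rw [integral_add (hi₃.const_mul _) (hi₄.const_mul _), integral_const_mul,
          integral_const_mul, ← hw₃, ← hw₄]
        ring
      rw [hR]
      refine abs_integral_le_integral_abs.trans (integral_mono_ae (hfran.sub hfh).abs
        ((hi₃.const_mul _).add (hi₄.const_mul _)) ?_)
      filter_upwards [ae_mem_openCube d₁] with y hy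
      rw [eq_add_taylorLinear_add_taylorRemainder hDopen hDconn hf (hran L ρ y hy) (hghbar L y hy),
        add_assoc, add_sub_cancel_left]
      refine (abs_add_le _ _).trans (add_le_add ((h3 y hy).trans ?_) ((h4 y hy).trans ?_))
      · have := boundaryWeight_mono (A' := fun _ => maxExponent A₃)
          (fun i => Finset.le_sup' A₃ (Finset.mem_univ i)) ∅ hy
        have h0 := (boundaryWeight_pos A₃ ∅ hy).le
        have := hMle L
        gcongr
      · have := boundaryWeight_mono (A' := fun _ => maxExponent A₄)
          (fun i => Finset.le_sup' A₄ (Finset.mem_univ i)) ∅ hy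
        have h0 := (boundaryWeight_pos A₄ ∅ hy).le
        have := hM2 L
        gcongr
    rw [Q.h_rpow hh₀] at hwk
    refine (abs_sub_le _ (∫ y in Icc (0 : Fin d₁ → ℝ) 1,
      Q.f (innerIntegral (Q.gh (Q.h L)) y)) _).trans ((add_le_add e2 hwk).trans (le_of_eq ?_))
    rw [hKc]; ring
  obtain ⟨C, hC, hCle⟩ := Q.outer.exists_eLpNorm_scrambled_le hA0 hp hAp
  refine ⟨C * Kb + Kc, by positivity, fun L hL k => ?_⟩
  have hfin := Q.outer.eLpNorm_multilevel_le (p := p) (by linarith : A < 1) hCle hC.le hB0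
    (fun l _ => hψ l) (hψL L hL) (hmeas L) (by positivity : 0 ≤ Kc * (2 : ℝ) ^ (-(Q.ηw * L)))
    (hbias L hL) k
  have hest : Q.estimator L (fun l => 2 ^ k l) = fun ω : Sample d₁ d₂ =>
      ∑ l ∈ Finset.range L, Q.outer.scrambledMean (2 ^ k l) (Q.levelIntegrand l) (ω.1 l)
        + Q.outer.scrambledMean (2 ^ k L) (Q.finestIntegrand L ω.2) (ω.1 L) :=
    funext fun ω => Q.estimator_eq hL _ ω
  rw [hest]
  refine ⟨hfin.1, hfin.2.trans (ENNReal.ofReal_le_ofReal ?_)⟩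
  simp only [hB, mul_assoc]
  rw [← Finset.mul_sum]
  have hs : 0 ≤ ∑ l ∈ Finset.range (L + 1),
      (2 : ℝ) ^ (-(v * l)) * ((2 : ℝ) ^ k l) ^ (-p) := Finset.sum_nonneg fun _ _ => by positivity
  have ht : 0 ≤ (2 : ℝ) ^ (-(Q.ηw * L)) := by positivity
  nlinarith [mul_nonneg hKc0.le hs, mul_nonneg (mul_nonneg hC.le hKb0.le) ht]

end NestedData

end

/-! ### Balancing the levels -/

theorem sum_two_rpow_neg_mul_le {s : ℝ} (hs : 0 < s) (n : ℕ) :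
    ∑ l ∈ Finset.range n, (2 : ℝ) ^ (-(s * l)) ≤ (1 - (2 : ℝ) ^ (-s))⁻¹ := by
  have h1 : (2 : ℝ) ^ (-s) < 1 := Real.rpow_lt_one_of_one_lt_of_neg one_lt_two (by linarith)
  have h0 : (0 : ℝ) ≤ (2 : ℝ) ^ (-s) := by positivity
  rw [← tsum_geometric_of_lt_one h0 h1]
  refine le_trans (le_of_eq ?_)
    ((summable_geometric_of_lt_one h0 h1).sum_le_tsum (Finset.range n) fun _ _ => by positivity)
  refine Finset.sum_congr rfl fun l _ => ?_
  rw [← Real.rpow_natCast, ← Real.rpow_mul two_pos.le]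
  congr 1; ring

theorem sum_two_rpow_neg_mul_sub_le {s : ℝ} (hs : 0 < s) (L : ℕ) :
    ∑ l ∈ Finset.range (L + 1), (2 : ℝ) ^ (-(s * (L - l))) ≤ (1 - (2 : ℝ) ^ (-s))⁻¹ := by
  refine le_trans (le_of_eq ?_) (sum_two_rpow_neg_mul_le hs (L + 1))
  rw [← Finset.sum_range_reflect]
  refine Finset.sum_congr rfl fun l hl => ?_
  have : l ≤ L := by have := Finset.mem_range.1 hl; omega
  rw [show L + 1 - 1 - l = L - l by omega, Nat.cast_sub this]
  congr 2; ring

/-- The sum is geometric unless the two rates agree; the number of terms is absorbed into a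
slightly larger exponent. -/
theorem exists_sum_two_rpow_le (a : ℝ) {b : ℝ} (hb : 0 < b) :
    ∃ G, 0 < G ∧ ∀ L : ℕ, ∑ l ∈ Finset.range (L + 1), (2 : ℝ) ^ (a * l + b * (L - l)) ≤
      G * (2 : ℝ) ^ (max a (2 * b) * L) := by
  rcases le_or_gt a b with h | h
  · have h1 : (2 : ℝ) ^ (-b) < 1 := Real.rpow_lt_one_of_one_lt_of_neg one_lt_two (by linarith)
    refine ⟨(1 - (2 : ℝ) ^ (-b))⁻¹, inv_pos.2 (by linarith), fun L => ?_⟩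
    refine le_trans ?_ (mul_le_mul_of_nonneg_right (sum_two_rpow_neg_mul_le hb (L + 1))
      (by positivity))
    rw [Finset.sum_mul]
    refine Finset.sum_le_sum fun l hl => ?_
    rw [← Real.rpow_add two_pos]
    refine Real.rpow_le_rpow_of_exponent_le one_le_two ?_
    have hlL : (l : ℝ) ≤ L := by
      have := Finset.mem_range.1 hl
      exact_mod_cast Nat.lt_succ_iff.1 this
    have e1 : a * l ≤ b * l := mul_le_mul_of_nonneg_right h (Nat.cast_nonneg l)
    have e2 : 2 * b * L ≤ max a (2 * b) * L :=
      mul_le_mul_of_nonneg_right (le_max_right _ _) (Nat.cast_nonneg L)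
    have e3 : b * l ≤ b * L := mul_le_mul_of_nonneg_left hlL hb.le
    linarith
  · have hs : 0 < a - b := sub_pos.2 h
    have h1 : (2 : ℝ) ^ (-(a - b)) < 1 :=
      Real.rpow_lt_one_of_one_lt_of_neg one_lt_two (by linarith)
    refine ⟨(1 - (2 : ℝ) ^ (-(a - b)))⁻¹, inv_pos.2 (by linarith), fun L => ?_⟩
    refine le_trans ?_ (mul_le_mul_of_nonneg_right (sum_two_rpow_neg_mul_sub_le hs L)
      (by positivity))
    rw [Finset.sum_mul]
    refine Finset.sum_le_sum fun l hl => ?_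
    rw [← Real.rpow_add two_pos]
    refine Real.rpow_le_rpow_of_exponent_le one_le_two ?_
    have e2 : a * L ≤ max a (2 * b) * L :=
      mul_le_mul_of_nonneg_right (le_max_left _ _) (Nat.cast_nonneg L)
    linarith

theorem exists_le_two_pow_le {x : ℝ} (hx : 0 ≤ x) :
    ∃ k : ℕ, x ≤ 2 ^ k ∧ (2 : ℝ) ^ k ≤ 2 + 2 * x := by
  rcases le_total x 1 with h | h
  · exact ⟨0, by simpa using h, by rw [pow_zero]; linarith⟩
  · obtain ⟨n, h1, h2⟩ := exists_nat_pow_near h one_lt_two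
    exact ⟨n + 1, h2.le, by rw [pow_succ]; linarith⟩

/-- The level `L` and the sizes `2 ^ k l` of the levels that bring an error of the form
`∑ 2 ^ (-v l) (2 ^ k l) ^ (-p) + 2 ^ (-w L)` below `κ / T`, and their costs. The error budget is
distributed over the levels in proportion to `2 ^ (-δ (L - l))`, where `δ` is chosen so small that
the cost stays below the one for the smaller exponent `p₀` and an even distribution. -/
theorem exists_levels_cost_le {K κ c w η p₀ p : ℝ} (hK : 0 < K) (hκ : 0 < κ) (hc : 0 < c)
    (hw : 0 < w) (hp₀ : 0 < p₀) (hp : p₀ < p) :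
    ∃ C, 0 < C ∧ ∀ T : ℝ, 1 ≤ T → ∃ L : ℕ, 1 ≤ L ∧ ∃ k : ℕ → ℕ,
      K * (∑ l ∈ Finset.range (L + 1), (2 : ℝ) ^ (-(min w η * l)) * ((2 : ℝ) ^ k l) ^ (-p)
        + (2 : ℝ) ^ (-(w * L))) ≤ κ / T ∧
      ∑ l ∈ Finset.range (L + 1), ((2 : ℝ) ^ k l + 1) * (2 : ℝ) ^ (c * l) ≤
        C * (T ^ (c / w) + T ^ max (1 / p₀) (1 / p₀ + c / w - η / (w * p₀))) := by
  have hp0 : 0 < p := hp₀.trans hp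
  set v := min w η with hv
  set δ := w * (p - p₀) / (2 * p₀) with hδ
  have hδ0 : 0 < δ := by have := sub_pos.2 hp; positivity
  have h2δ : (2 : ℝ) ^ (-δ) < 1 := Real.rpow_lt_one_of_one_lt_of_neg one_lt_two (by linarith)
  have h2c : (2 : ℝ) ^ (-c) < 1 := Real.rpow_lt_one_of_one_lt_of_neg one_lt_two (by linarith)
  set S := (1 - (2 : ℝ) ^ (-δ))⁻¹ with hS
  have hS0 : 0 < S := inv_pos.2 (by linarith)
  set Sc := (1 - (2 : ℝ) ^ (-c))⁻¹ with hSc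
  have hSc0 : 0 < Sc := inv_pos.2 (by linarith)
  obtain ⟨G, hG, hGle⟩ := exists_sum_two_rpow_le (c - v / p) (b := δ / p) (by positivity)
  set m := max (c - v / p) (2 * (δ / p)) with hm
  have hm0 : 0 < m := lt_max_of_lt_right (by positivity)
  set R := 4 + 4 * (2 * K / κ) ^ (1 / w) with hR
  have hR0 : 0 < R := by positivity
  set X₀ := (2 * K * S / κ) ^ (1 / p) with hX₀
  have hX₀0 : 0 < X₀ := by positivity
  refine ⟨3 * Sc * R ^ c + 2 * X₀ * G * R ^ m + 2 * X₀ * G * R ^ m, by positivity,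
    fun T hT => ?_⟩
  have hT0 : 0 < T := one_pos.trans_le hT
  obtain ⟨L', hL1, hL2⟩ := exists_le_two_pow_le (x := (2 * K / κ * T) ^ (1 / w)) (by positivity)
  set L := L' + 1 with hL
  have hLR : (2 : ℝ) ^ (L : ℝ) ≤ R * T ^ (1 / w) := by
    rw [Real.rpow_natCast, hL, pow_succ]
    rw [Real.mul_rpow (by positivity) hT0.le] at hL2
    have : 1 ≤ T ^ (1 / w) := Real.one_le_rpow hT (by positivity)
    rw [hR]; nlinarith
  have hLpow : ∀ s : ℝ, 0 < s → (2 : ℝ) ^ (s * L) ≤ R ^ s * T ^ (s / w) := fun s hs => by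
    rw [mul_comm s, Real.rpow_mul two_pos.le]
    refine (Real.rpow_le_rpow (by positivity) hLR hs.le).trans (le_of_eq ?_)
    rw [Real.mul_rpow hR0.le (by positivity), ← Real.rpow_mul hT0.le]
    congr 2; ring
  set X : ℕ → ℝ := fun l =>
    (2 * K * S / κ * T * (2 : ℝ) ^ (-(v * l) + δ * (L - l))) ^ (1 / p) with hX
  have hX0 : ∀ l, 0 < X l := fun l => by positivity
  have hXe : ∀ l, X l = X₀ * T ^ (1 / p) * (2 : ℝ) ^ ((-(v * l) + δ * (L - l)) / p) := fun l => by
    simp only [hX]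
    rw [Real.mul_rpow (by positivity) (by positivity), Real.mul_rpow (by positivity) hT0.le,
      ← Real.rpow_mul two_pos.le]
    congr 2; ring
  choose k hk1 hk2 using fun l => exists_le_two_pow_le (hX0 l).le
  refine ⟨L, by omega, k, ?_, ?_⟩
  · -- the error
    have e1 : K * (2 : ℝ) ^ (-(w * L)) ≤ κ / T / 2 := by
      have h1 : 2 * K / κ * T ≤ (2 : ℝ) ^ (w * L) := by
        have h2 : (2 * K / κ * T) ^ (1 / w) ≤ (2 : ℝ) ^ (L : ℝ) := by
          rw [Real.rpow_natCast]
          exact hL1.trans (pow_le_pow_right₀ one_le_two (Nat.le_succ _))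
        have h3 := Real.rpow_le_rpow (by positivity) h2 hw.le
        rwa [← Real.rpow_mul (by positivity), ← Real.rpow_mul two_pos.le,
          one_div_mul_cancel hw.ne', Real.rpow_one, mul_comm (L : ℝ)] at h3
      rw [Real.rpow_neg two_pos.le]
      have h4 : 0 < 2 * K / κ * T := by positivity
      calc K * ((2 : ℝ) ^ (w * L))⁻¹ ≤ K * (2 * K / κ * T)⁻¹ := by gcongr
        _ = κ / T / 2 := by field_simp
    have e2 : ∀ l ∈ Finset.range (L + 1), (2 : ℝ) ^ (-(v * l)) * ((2 : ℝ) ^ k l) ^ (-p) ≤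
        κ / (2 * K * S * T) * (2 : ℝ) ^ (-(δ * (L - l))) := by
      intro l _
      have h1 : ((2 : ℝ) ^ k l) ^ (-p) ≤ (X l) ^ (-p) :=
        Real.rpow_le_rpow_of_nonpos (hX0 l) (hk1 l) (by linarith)
      refine (mul_le_mul_of_nonneg_left h1 (by positivity)).trans (le_of_eq ?_)
      simp only [hX]
      rw [← Real.rpow_mul (by positivity), show 1 / p * -p = -1 by field_simp,
        Real.rpow_neg_one, mul_inv, ← Real.rpow_neg two_pos.le, mul_left_comm,
        ← Real.rpow_add two_pos]
      congr 1
      · field_simp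
      · congr 1; ring
    have e3 : K * ∑ l ∈ Finset.range (L + 1), (2 : ℝ) ^ (-(v * l)) * ((2 : ℝ) ^ k l) ^ (-p) ≤
        κ / T / 2 := by
      calc _ ≤ K * (κ / (2 * K * S * T) * S) := by
            refine mul_le_mul_of_nonneg_left ((Finset.sum_le_sum e2).trans ?_) hK.le
            rw [← Finset.mul_sum]
            exact mul_le_mul_of_nonneg_left (sum_two_rpow_neg_mul_sub_le hδ0 L) (by positivity)
        _ = κ / T / 2 := by field_simp
    rw [mul_add]; linarith
  · -- the cost
    set Z := max (1 / p₀) (1 / p₀ + c / w - η / (w * p₀)) with hZ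
    have hexp : T ^ (1 / p) * T ^ (m / w) ≤ T ^ (c / w) + T ^ Z := by
      rw [← Real.rpow_add hT0]
      have h1 : 1 / p + m / w ≤ max (c / w) Z := by
        have hpp : 1 / p ≤ 1 / p₀ := one_div_le_one_div_of_le hp₀ hp.le
        rcases max_choice (c - v / p) (2 * (δ / p)) with h | h
        · rw [hm, h]
          rcases le_total w η with hwη | hwη
          · refine le_max_of_le_left (le_of_eq ?_)
            rw [hv, min_eq_left hwη]; field_simp; ring
          · refine le_max_of_le_right (le_max_of_le_right ?_)
            rw [hv, min_eq_right hwη]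
            have e : 0 ≤ 1 - η / w := sub_nonneg.2 ((div_le_one hw).2 hwη)
            have := mul_le_mul_of_nonneg_right hpp e
            calc 1 / p + (c - η / p) / w = c / w + 1 / p * (1 - η / w) := by field_simp; ring
              _ ≤ c / w + 1 / p₀ * (1 - η / w) := by linarith
              _ = _ := by field_simp; ring
        · refine le_max_of_le_right (le_max_of_le_left (le_of_eq ?_))
          rw [hm, h, hδ]; field_simp; ring
      rcases le_total (c / w) Z with h | h
      · rw [max_eq_right h] at h1
        exact (Real.rpow_le_rpow_of_exponent_le hT h1).trans
          (le_add_of_nonneg_left (by positivity))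
      · rw [max_eq_left h] at h1
        exact (Real.rpow_le_rpow_of_exponent_le hT h1).trans
          (le_add_of_nonneg_right (by positivity))
    have e1 : ∑ l ∈ Finset.range (L + 1), (2 : ℝ) ^ (c * l) ≤ Sc * R ^ c * T ^ (c / w) := by
      have h1 : ∀ l ∈ Finset.range (L + 1), (2 : ℝ) ^ (c * l) =
          (2 : ℝ) ^ (-(c * (L - l))) * (2 : ℝ) ^ (c * L) := fun l _ => by
        rw [← Real.rpow_add two_pos]; congr 1; ring
      rw [Finset.sum_congr rfl h1, ← Finset.sum_mul, mul_assoc]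
      exact mul_le_mul (sum_two_rpow_neg_mul_sub_le hc L) (hLpow c hc) (by positivity) hSc0.le
    have e2 : ∑ l ∈ Finset.range (L + 1), X l * (2 : ℝ) ^ (c * l) ≤
        X₀ * G * R ^ m * (T ^ (c / w) + T ^ Z) := by
      have h1 : ∀ l ∈ Finset.range (L + 1), X l * (2 : ℝ) ^ (c * l) =
          X₀ * T ^ (1 / p) * (2 : ℝ) ^ ((c - v / p) * l + δ / p * (L - l)) := fun l _ => by
        rw [hXe, mul_assoc, ← Real.rpow_add two_pos]; congr 2; field_simp; ring
      rw [Finset.sum_congr rfl h1, ← Finset.mul_sum]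
      calc _ ≤ X₀ * T ^ (1 / p) * (G * (R ^ m * T ^ (m / w))) := by
            refine mul_le_mul_of_nonneg_left ((hGle L).trans ?_) (by positivity)
            exact mul_le_mul_of_nonneg_left (hLpow m hm0) hG.le
        _ = X₀ * G * R ^ m * (T ^ (1 / p) * T ^ (m / w)) := by ring
        _ ≤ _ := mul_le_mul_of_nonneg_left hexp (by positivity)
    calc ∑ l ∈ Finset.range (L + 1), ((2 : ℝ) ^ k l + 1) * (2 : ℝ) ^ (c * l)
        ≤ ∑ l ∈ Finset.range (L + 1),
            (3 * (2 : ℝ) ^ (c * l) + 2 * (X l * (2 : ℝ) ^ (c * l))) := by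
          refine Finset.sum_le_sum fun l _ => ?_
          have : 0 < (2 : ℝ) ^ (c * l) := by positivity
          nlinarith [hk2 l]
      _ ≤ 3 * (Sc * R ^ c * T ^ (c / w)) + 2 * (X₀ * G * R ^ m * (T ^ (c / w) + T ^ Z)) := by
          rw [Finset.sum_add_distrib, ← Finset.mul_sum, ← Finset.mul_sum]
          linarith
      _ ≤ _ := by
          have a1 : 0 ≤ T ^ (c / w) := by positivity
          have a2 : 0 ≤ T ^ Z := by positivity
          have a3 : 0 ≤ Sc * R ^ c * T ^ Z := by positivity
          have a4 : 0 ≤ X₀ * G * R ^ m * (T ^ (c / w) + T ^ Z) := by positivity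
          nlinarith

/-! ### Admissible choices and their work -/

namespace NestedData

variable {d₁ d₂ : ℕ} (Q : NestedData d₁ d₂)

/-- A small root mean square error makes a choice admissible: the mean square error is the sum of
the squared bias and the variance. -/
theorem admissible_of_eLpNorm_sub_le {α TOL : ℝ} (hα : 0 < α) (hTOL : 0 < TOL) {L : ℕ}
    {N : ℕ → ℕ} (hL : 1 ≤ L) (hN : ∀ l ≤ L, 1 ≤ N l)
    (hm : AEStronglyMeasurable (Q.estimator L N) (law d₁ d₂))
    (hle : eLpNorm (fun ω => Q.estimator L N ω - Q.integral) 2 (law d₁ d₂) ≤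
      ENNReal.ofReal (min (1 / 2) (√α / 2) * TOL)) :
    Q.Admissible α TOL L N := by
  set Y : Sample d₁ d₂ → ℝ := fun ω => Q.estimator L N ω - Q.integral with hY
  have hYL : MemLp Y 2 (law d₁ d₂) :=
    ⟨hm.sub aestronglyMeasurable_const, hle.trans_lt ENNReal.ofReal_lt_top⟩
  have hXL : MemLp (Q.estimator L N) 2 (law d₁ d₂) := by
    have := hYL.add (memLp_const Q.integral)
    refine this.ae_eq (ae_of_all _ fun ω => ?_)
    simp [hY]
  have hα' : 0 < √α := Real.sqrt_pos.2 hα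
  have hr : 0 ≤ min (1 / 2) (√α / 2) * TOL := by positivity
  have hsq : ∫ ω, (Y ^ 2) ω ∂law d₁ d₂ ≤ (min (1 / 2) (√α / 2) * TOL) ^ 2 := by
    rw [hYL.eLpNorm_eq_integral_rpow_norm two_ne_zero ENNReal.ofNat_ne_top,
      ENNReal.ofReal_le_ofReal_iff hr] at hle
    have h0 : 0 ≤ ∫ ω, ‖Y ω‖ ^ (2 : ENNReal).toReal ∂law d₁ d₂ :=
      integral_nonneg fun _ => by positivity
    have h1 := Real.rpow_le_rpow (by positivity) hle (zero_le_two (α := ℝ))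
    rw [← Real.rpow_mul h0] at h1
    simpa using h1
  have hvar := variance_eq_sub hYL
  have hvar' : variance Y (law d₁ d₂) = variance (Q.estimator L N) (law d₁ d₂) :=
    variance_sub_const hm _
  have hmean : ∫ ω, Y ω ∂law d₁ d₂ = (∫ ω, Q.estimator L N ω ∂law d₁ d₂) - Q.integral := by
    simp only [hY]
    rw [integral_sub (hXL.integrable one_le_two) (integrable_const _)]
    simp
  rw [hvar', hmean] at hvar
  have hvar0 := variance_nonneg (Q.estimator L N) (law d₁ d₂)
  have m1 : min (1 / 2) (√α / 2) * TOL ≤ TOL / 2 := by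
    have := mul_le_mul_of_nonneg_right (min_le_left (1 / 2) (√α / 2)) hTOL.le
    linarith
  have m2 : min (1 / 2) (√α / 2) * TOL ≤ TOL / 2 / (1 / √α) := by
    have := mul_le_mul_of_nonneg_right (min_le_right (1 / 2) (√α / 2)) hTOL.le
    rw [div_div_eq_mul_div, div_one]
    linarith
  refine ⟨hL, hN, hXL, abs_le_of_sq_le_sq (by nlinarith) (by positivity), ?_⟩
  have := pow_le_pow_left₀ hr m2 2
  nlinarith [sq_nonneg ((∫ ω, Q.estimator L N ω ∂law d₁ d₂) - Q.integral)]

/-- Chebyshev's inequality: an admissible choice reaches the tolerance with probability at least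
`1 - α`. -/
theorem Admissible.le_measureReal {α TOL : ℝ} (hα : 0 < α) (hTOL : 0 < TOL) {L : ℕ}
    {N : ℕ → ℕ} (h : Q.Admissible α TOL L N) :
    1 - α ≤ (law d₁ d₂).real {ω | |Q.estimator L N ω - Q.integral| ≤ TOL} := by
  obtain ⟨-, -, hXL, hb, hv⟩ := h
  set E := ∫ ω, Q.estimator L N ω ∂law d₁ d₂
  have hcheb : (law d₁ d₂).real {ω | TOL / 2 ≤ |Q.estimator L N ω - E|} ≤ α := by
    refine ENNReal.toReal_le_of_le_ofReal hα.le
      ((meas_ge_le_variance_div_sq hXL (half_pos hTOL)).trans (ENNReal.ofReal_le_ofReal ?_))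
    rw [div_le_iff₀ (by positivity)]
    refine hv.trans (le_of_eq ?_)
    rw [div_div_eq_mul_div, div_one, mul_pow, Real.sq_sqrt hα.le, mul_comm]
  have hun : (univ : Set (Sample d₁ d₂)) ⊆ {ω | |Q.estimator L N ω - Q.integral| ≤ TOL} ∪
      {ω | TOL / 2 ≤ |Q.estimator L N ω - E|} := by
    intro ω _
    by_contra hc
    simp only [mem_union, mem_ofPred_eq, not_or, not_le] at hc
    have := abs_sub_le (Q.estimator L N ω) E Q.integral
    linarith
  have h1 := (measureReal_mono hun).trans
    (measureReal_union_le (μ := law d₁ d₂) _ _)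
  rw [probReal_univ] at h1
  linarith

theorem work_congr {L : ℕ} {N N' : ℕ → ℕ} (h : ∀ l ≤ L, N l = N' l) :
    Q.work L N = Q.work L N' := by
  unfold work
  congr 1
  exact Finset.sum_congr rfl fun l hl => by rw [h l (Nat.lt_succ_iff.1 (Finset.mem_range.1 hl))]

theorem work_nonneg (hh₀ : 0 < Q.h₀) (L : ℕ) (N : ℕ → ℕ) : 0 ≤ Q.work L N := by
  unfold work
  have := Q.h_pos hh₀
  exact add_nonneg (Finset.sum_nonneg fun l _ => by have := this l; positivity)
    (Finset.sum_nonneg fun l _ => by have := this l; positivity)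

theorem optimalWork_le (hh₀ : 0 < Q.h₀) {α TOL : ℝ} {L : ℕ} {N : ℕ → ℕ}
    (h : Q.Admissible α TOL L N) : Q.optimalWork α TOL ≤ Q.work L N := by
  refine csInf_le ⟨0, ?_⟩ ⟨L, N, h, rfl⟩
  rintro _ ⟨L, N, -, rfl⟩
  exact Q.work_nonneg hh₀ L N

theorem optimalWork_nonneg (hh₀ : 0 < Q.h₀) (α TOL : ℝ) : 0 ≤ Q.optimalWork α TOL := by
  refine Real.sInf_nonneg ?_
  rintro _ ⟨L, N, -, rfl⟩
  exact Q.work_nonneg hh₀ L N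

/-- Only finitely many works lie below a given bound, since every additional level and every
additional point costs at least a fixed amount. -/
theorem finite_work_le (hM₀ : 1 ≤ Q.M₀) (hh₀ : 0 < Q.h₀) (hγ : 0 < Q.γ) (w₀ : ℝ) :
    {w | (∃ L N, w = Q.work L N) ∧ w ≤ w₀}.Finite := by
  set q := Q.h₀ ^ (-Q.γ) with hq
  have hq0 : 0 < q := by positivity
  have hcost : ∀ l, q ≤ (Q.M l : ℝ) * Q.h l ^ (-Q.γ) := fun l => by
    have h1 : (1 : ℝ) ≤ Q.M l := by exact_mod_cast Q.one_le_M hM₀ l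
    have h2 : q ≤ Q.h l ^ (-Q.γ) := by
      refine Real.rpow_le_rpow_of_nonpos (Q.h_pos hh₀ l) ?_ (by linarith)
      exact div_le_self hh₀.le (one_le_pow₀ one_le_two)
    nlinarith
  set B := ⌊w₀ / q⌋₊ with hB
  have hfin : (⋃ L ∈ Iic B, (fun n : Fin (L + 1) → ℕ =>
      Q.work L fun l => if hl : l < L + 1 then n ⟨l, hl⟩ else 0) ''
        Icc 0 (fun _ => B)).Finite :=
    (finite_Iic B).biUnion fun L _ => (finite_Icc _ _).image _
  refine hfin.subset ?_
  rintro _ ⟨⟨L, N, rfl⟩, hw⟩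
  have hL : ((L + 1 : ℕ) : ℝ) * q ≤ Q.work L N := by
    have h1 : ((L + 1 : ℕ) : ℝ) * q ≤
        ∑ l ∈ Finset.range (L + 1), (Q.M l : ℝ) * Q.h l ^ (-Q.γ) := by
      have := Finset.card_nsmul_le_sum (Finset.range (L + 1)) _ q fun l _ => hcost l
      simpa [nsmul_eq_mul] using this
    have h2 : 0 ≤ ∑ l ∈ Finset.range (L + 1), (N l : ℝ) * (Q.M l : ℝ) * Q.h l ^ (-Q.γ) :=
      Finset.sum_nonneg fun l _ => by have := Q.h_pos hh₀ l; positivity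
    unfold work; linarith
  have hN : ∀ l < L + 1, (N l : ℝ) * q ≤ Q.work L N := fun l hl => by
    have h1 : (N l : ℝ) * Q.M l * Q.h l ^ (-Q.γ) ≤
        ∑ l ∈ Finset.range (L + 1), (N l : ℝ) * (Q.M l : ℝ) * Q.h l ^ (-Q.γ) :=
      Finset.single_le_sum (f := fun l => (N l : ℝ) * (Q.M l : ℝ) * Q.h l ^ (-Q.γ))
        (fun l _ => by have := Q.h_pos hh₀ l; positivity) (Finset.mem_range.2 hl)
    have h2 : 0 ≤ ∑ l ∈ Finset.range (L + 1), (Q.M l : ℝ) * Q.h l ^ (-Q.γ) :=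
      Finset.sum_nonneg fun l _ => by have := Q.h_pos hh₀ l; positivity
    have h3 := mul_le_mul_of_nonneg_left (hcost l) (Nat.cast_nonneg (N l))
    unfold work; linarith [mul_assoc (N l : ℝ) (Q.M l : ℝ) (Q.h l ^ (-Q.γ))]
  have hLB : L ≤ B := by
    refine Nat.le_floor ((le_div_iff₀ hq0).2 ?_)
    push_cast at hL
    linarith [hw]
  have hNB : (fun l : Fin (L + 1) => N l) ∈ Icc 0 (fun _ => B) :=
    ⟨fun _ => Nat.zero_le _, fun l => Nat.le_floor ((le_div_iff₀ hq0).2 ((hN l l.2).trans hw))⟩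
  refine mem_biUnion (mem_Iic.2 hLB) ⟨_, hNB, Q.work_congr fun l hl => ?_⟩
  exact dif_pos (Nat.lt_succ_of_le hl)

/-- The least work is attained as soon as there is an admissible choice. -/
theorem exists_work_eq_optimalWork (hM₀ : 1 ≤ Q.M₀) (hh₀ : 0 < Q.h₀) (hγ : 0 < Q.γ) {α TOL : ℝ}
    (h : ∃ L N, Q.Admissible α TOL L N) :
    ∃ L N, Q.Admissible α TOL L N ∧ Q.work L N = Q.optimalWork α TOL := by
  obtain ⟨L₀, N₀, h₀⟩ := h
  set F := {w | ∃ L N, Q.Admissible α TOL L N ∧ w = Q.work L N} ∩ Iic (Q.work L₀ N₀)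
  have hF : F.Finite := by
    refine (Q.finite_work_le hM₀ hh₀ hγ (Q.work L₀ N₀)).subset ?_
    rintro w ⟨⟨L, N, -, e⟩, hw⟩
    exact ⟨⟨L, N, e⟩, hw⟩
  obtain ⟨w, ⟨⟨L, N, hLN, rfl⟩, hw⟩, hmin⟩ := exists_min_image F id hF
    ⟨Q.work L₀ N₀, ⟨L₀, N₀, h₀, rfl⟩, mem_Iic.2 le_rfl⟩
  have hleast : IsLeast {w | ∃ L N, Q.Admissible α TOL L N ∧ w = Q.work L N} (Q.work L N) := by
    refine ⟨⟨L, N, hLN, rfl⟩, ?_⟩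
    rintro _ ⟨L', N', h', rfl⟩
    rcases le_total (Q.work L' N') (Q.work L₀ N₀) with h1 | h1
    · exact hmin _ ⟨⟨L', N', h', rfl⟩, h1⟩
    · exact le_trans hw h1
  exact ⟨L, N, hLN, hleast.csInf_eq.symm⟩

theorem work_le (hM₀ : 1 ≤ Q.M₀) (hh₀ : 0 < Q.h₀) (hηw : 0 < Q.ηw) (hε : Q.ε < 1) (L : ℕ)
    (k : ℕ → ℕ) :
    Q.work L (fun l => 2 ^ k l) ≤ 2 * Q.M₀ * Q.h₀ ^ (-Q.γ) *
      ∑ l ∈ Finset.range (L + 1),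
        ((2 : ℝ) ^ k l + 1) * (2 : ℝ) ^ ((Q.ηw / (1 - Q.ε) + Q.γ) * l) := by
  unfold work
  rw [← Finset.sum_add_distrib, Finset.mul_sum]
  refine Finset.sum_le_sum fun l _ => ?_
  rw [Q.h_rpow hh₀, add_mul (Q.ηw / (1 - Q.ε)), Real.rpow_add two_pos, neg_mul, neg_neg]
  have h1 := Q.M_le hM₀ hηw hε l
  have h2 : 0 ≤ ((2 : ℝ) ^ k l + 1) * (Q.h₀ ^ (-Q.γ) * (2 : ℝ) ^ (Q.γ * l)) := by positivity
  push_cast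
  nlinarith [mul_le_mul_of_nonneg_left h1 h2]

/-- For small tolerances the rate of the theorem dominates a power of the tolerance in all three
cases. -/
theorem eventually_rpow_le_samplingRate {A ηs : ℝ} (hηw : 0 < Q.ηw) :
    ∀ᶠ TOL in 𝓝[>] (0 : ℝ), TOL⁻¹ ^ max (1 / (1 - Q.ε - A)) (1 / (1 - Q.ε - A) +
      (1 / (1 - Q.ε) + Q.γ / Q.ηw) - ηs / (Q.ηw * (1 - Q.ε - A))) ≤ Q.samplingRate A ηs TOL := by
  set p₀ := 1 - Q.ε - A with hp
  set c := 1 / (1 - Q.ε) + Q.γ / Q.ηw with hc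
  set r := ηs / (Q.ηw * p₀) with hr
  set m := max (1 / Q.ηw) (1 / (1 - Q.ε)) with hm
  have hm0 : 0 < m := lt_max_of_lt_left (by positivity)
  have hlog : ∀ᶠ TOL in 𝓝[>] (0 : ℝ), TOL < (2 : ℝ) ^ (-(1 / m)) :=
    nhdsWithin_le_nhds (Iio_mem_nhds (by positivity))
  filter_upwards [self_mem_nhdsWithin, hlog] with TOL hT hT1
  have hT0 : (0 : ℝ) < TOL := hT
  have hinv : ∀ s : ℝ, TOL⁻¹ ^ s = TOL ^ (-s) := fun s => by
    rw [Real.inv_rpow hT0.le, Real.rpow_neg hT0.le]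
  rw [hinv]
  unfold samplingRate
  rw [← hp, ← hc, ← hr, ← hm]
  split_ifs with h1 h2
  · rw [max_eq_left (by linarith)]
  · rw [max_eq_left (by linarith)]
    refine le_mul_of_one_le_right (by positivity) ?_
    rw [Real.le_logb_iff_rpow_le one_lt_two (by positivity), Real.rpow_one]
    have := Real.rpow_le_rpow_of_nonpos hT0 hT1.le (by linarith : -m ≤ 0)
    rwa [← Real.rpow_mul two_pos.le, neg_mul_neg, one_div_mul_cancel hm0.ne',
      Real.rpow_one] at this
  · have h3 : r < c := lt_of_le_of_ne (not_lt.1 h1) h2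
    rw [max_eq_right (by linarith)]
    refine le_of_eq ?_
    congr 1; ring

end NestedData

/-! ### The optimal work -/

theorem mainTheorem1 {d₁ d₂ : ℕ} [NeZero d₁] [NeZero d₂] (Q : NestedData d₁ d₂)
    -- the parameters
    (ηs α : ℝ) (hM₀ : 1 ≤ Q.M₀) (hh₀ : 0 < Q.h₀) (hηw : 0 < Q.ηw) (hηs : 0 < ηs)
    (hγ : 0 < Q.γ) (hε : 0 < Q.ε) (hα : α ∈ Ioo (0 : ℝ) 1)
    -- `f` is twice continuously differentiable on an open interval `D` that contains all values
    -- of `g` and of its approximations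
    (D : Set ℝ) (hDopen : IsOpen D) (hDconn : D.OrdConnected) (hf : ContDiffOn ℝ 2 Q.f D)
    (hgD : ∀ y ∈ openCube d₁, ∀ x ∈ Icc (0 : Fin d₂ → ℝ) 1, Q.g y x ∈ D)
    (hghD : ∀ l, ∀ y ∈ openCube d₁, ∀ x ∈ Icc (0 : Fin d₂ → ℝ) 1, Q.gh (Q.h l) y x ∈ D)
    -- the integrals are well defined
    (hgm : Measurable (Function.uncurry Q.g))
    (hghm : ∀ l, Measurable (Function.uncurry (Q.gh (Q.h l))))
    (hgi : ∀ y ∈ openCube d₁, IntegrableOn (Q.g y) (Icc 0 1))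
    (hghi : ∀ l, ∀ y ∈ openCube d₁, IntegrableOn (Q.gh (Q.h l) y) (Icc 0 1))
    (hfg : IntegrableOn (fun y => Q.f (innerIntegral Q.g y)) (Icc 0 1))
    -- weak rate of the approximations
    (Cw : ℝ) (hCw : 0 < Cw)
    (hweak : ∀ l, 1 ≤ l →
      IntegrableOn (fun y => Q.f (innerIntegral (Q.gh (Q.h l)) y)) (Icc 0 1) ∧
      |(∫ y in Icc (0 : Fin d₁ → ℝ) 1, Q.f (innerIntegral (Q.gh (Q.h l)) y)) - Q.integral|
        ≤ Cw * Q.h l ^ Q.ηw)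
    -- constants and exponents of the growth conditions
    (Cd Cs b₀ b₁ b₂ b₃ b₄ : ℝ) (hCd : 0 < Cd) (hCs : 0 < Cs)
    (hb₀ : 0 < b₀) (hb₁ : 0 < b₁) (hb₂ : 0 < b₂) (hb₃ : 0 < b₃) (hb₄ : 0 < b₄)
    (A₀ A₁ A₂ A₃ A₄ : Fin d₁ → ℝ)
    (hA₀ : maxExponent A₀ ∈ Ioo (0 : ℝ) (1 / 2)) (hA₁ : maxExponent A₁ ∈ Ioo (0 : ℝ) (1 / 2))
    (hA₂ : maxExponent A₂ ∈ Ioo (0 : ℝ) (1 / 2)) (hA₃ : maxExponent A₃ ∈ Ioo (0 : ℝ) 1)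
    (hA₄ : maxExponent A₄ ∈ Ioo (0 : ℝ) 1)
    (A : ℝ) (hA : A = max (maxExponent A₀) (max (maxExponent A₁) (maxExponent A₂)))
    (hεA : Q.ε < 1 - A)
    -- growth condition for level zero
    (hφ₀ : BoundaryGrowth (fun y => Q.f (Q.detMean 0 y)) b₀ A₀)
    -- growth conditions for the Taylor terms about the exact inner integral, with the
    -- deterministic inner points on all levels
    (hφ₁ : ∀ l, BoundaryGrowth
      (fun y => taylorLinear Q.f (Q.detMean l y) (innerIntegral Q.g y))
      ((Cd * (Q.M l : ℝ) ^ (-1 + Q.ε) + Cs * Q.h l ^ ηs) * b₁) A₁)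
    (hφ₂ : ∀ l, BoundaryGrowth
      (fun y => taylorRemainder Q.f (Q.detMean l y) (innerIntegral Q.g y))
      ((Cd ^ 2 * (Q.M l : ℝ) ^ (-2 + 2 * Q.ε) + Cs ^ 2 * Q.h l ^ (2 * ηs)) * b₂) A₂)
    -- the same with the scrambled inner points, which the finest level uses
    (hφ₁' : ∀ l, 1 ≤ l → ∀ᵐ ρ ∂owenLaw d₂, BoundaryGrowth
      (fun y => taylorLinear Q.f (Q.ranMean l ρ y) (innerIntegral Q.g y))
      ((Cd * (Q.M l : ℝ) ^ (-1 + Q.ε) + Cs * Q.h l ^ ηs) * b₁) A₁)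
    (hφ₂' : ∀ l, 1 ≤ l → ∀ᵐ ρ ∂owenLaw d₂, BoundaryGrowth
      (fun y => taylorRemainder Q.f (Q.ranMean l ρ y) (innerIntegral Q.g y))
      ((Cd ^ 2 * (Q.M l : ℝ) ^ (-2 + 2 * Q.ε) + Cs ^ 2 * Q.h l ^ (2 * ηs)) * b₂) A₂)
    -- pointwise bounds for the Taylor terms about the approximate inner integral
    (hφ₃ : ∀ l, 1 ≤ l → ∀ᵐ ρ ∂owenLaw d₂, ∀ y ∈ openCube d₁,
      |taylorLinear Q.f (Q.ranMean l ρ y) (innerIntegral (Q.gh (Q.h l)) y)|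
        ≤ Cd * (Q.M l : ℝ) ^ (-1 + Q.ε) * b₃ * boundaryWeight A₃ ∅ y)
    (hφ₄ : ∀ l, 1 ≤ l → ∀ᵐ ρ ∂owenLaw d₂, ∀ y ∈ openCube d₁,
      |taylorRemainder Q.f (Q.ranMean l ρ y) (innerIntegral (Q.gh (Q.h l)) y)|
        ≤ Cd ^ 2 * (Q.M l : ℝ) ^ (-2 + 2 * Q.ε) * b₄ * boundaryWeight A₄ ∅ y) :
    -- for small tolerances an optimal choice exists and reaches the tolerance
    (∀ᶠ TOL in 𝓝[>] (0 : ℝ), ∃ L N, Q.Admissible α TOL L N ∧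
      Q.work L N = Q.optimalWork α TOL ∧
      1 - α ≤ (NestedData.law d₁ d₂).real {ω | |Q.estimator L N ω - Q.integral| ≤ TOL}) ∧
    -- and its work obeys the rate
    Q.optimalWork α =O[𝓝[>] (0 : ℝ)]
      fun TOL => TOL ^ (-(1 / (1 - Q.ε) + Q.γ / Q.ηw)) + Q.samplingRate A ηs TOL := by
  have hA0 : 0 < A := hA ▸ lt_max_of_lt_left hA₀.1
  have hA2 : A < 1 / 2 := by rw [hA]; exact max_lt hA₀.2 (max_lt hA₁.2 hA₂.2)
  have hε1 : Q.ε < 1 := by linarith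
  set p₀ := 1 - Q.ε - A with hp₀
  have hp₀0 : 0 < p₀ := by linarith
  -- the variance decays with every exponent below `1 - A`, so there is room above `1 - ε - A`
  obtain ⟨p, hp1, hp2⟩ := exists_between
    (max_lt (by linarith : 1 / 2 < 1 - A) (by linarith : p₀ < 1 - A))
  obtain ⟨K, hK, hKle⟩ := NestedData.exists_eLpNorm_estimator_sub_le Q hM₀ hh₀ hηw hηs hDopen
    hDconn hf hgD hghD hghm hgi hghi hfg hCw hweak hCd hCs hb₀ hb₁ hb₂ hb₃ hb₄ hA₃.2 hA₄.2 hA0.le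
    (hA ▸ le_max_left _ _) (hA ▸ (le_max_left _ _).trans (le_max_right _ _))
    (hA ▸ (le_max_right _ _).trans (le_max_right _ _)) hε1 hφ₀ hφ₁ hφ₂ hφ₁' hφ₂' hφ₃ hφ₄
    ((le_max_left _ _).trans hp1.le) hp2
  set c := Q.ηw / (1 - Q.ε) + Q.γ with hc
  have hc0 : 0 < c := by have := sub_pos.2 hε1; positivity
  have hα' : 0 < √α := Real.sqrt_pos.2 hα.1
  obtain ⟨C, hC, hCle⟩ := exists_levels_cost_le (η := ηs) hK
    (by positivity : 0 < min (1 / 2) (√α / 2)) hc0 hηw hp₀0 ((le_max_right _ _).trans_lt hp1)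
  have hchoice : ∀ TOL : ℝ, 0 < TOL → TOL < 1 → ∃ L N, Q.Admissible α TOL L N ∧
      Q.work L N ≤ 2 * Q.M₀ * Q.h₀ ^ (-Q.γ) * (C * (TOL⁻¹ ^ (c / Q.ηw) +
        TOL⁻¹ ^ max (1 / p₀) (1 / p₀ + c / Q.ηw - ηs / (Q.ηw * p₀)))) := by
    intro TOL hT0 hT1
    obtain ⟨L, hL, k, hk, hcost⟩ := hCle TOL⁻¹ ((one_le_inv₀ hT0).2 hT1.le)
    rw [div_inv_eq_mul] at hk
    refine ⟨L, fun l => 2 ^ k l, Q.admissible_of_eLpNorm_sub_le hα.1 hT0 hL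
      (fun l _ => Nat.one_le_two_pow) (hKle L hL k).1
      ((hKle L hL k).2.trans (ENNReal.ofReal_le_ofReal hk)), ?_⟩
    exact (Q.work_le hM₀ hh₀ hηw hε1 L k).trans
      (mul_le_mul_of_nonneg_left hcost (by positivity))
  have hsmall : ∀ᶠ TOL in 𝓝[>] (0 : ℝ), TOL < 1 :=
    nhdsWithin_le_nhds (Iio_mem_nhds one_pos)
  refine ⟨?_, ?_⟩
  · filter_upwards [self_mem_nhdsWithin, hsmall] with TOL hT0 hT1
    obtain ⟨L, N, hLN, -⟩ := hchoice TOL hT0 hT1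
    obtain ⟨L, N, hLN, hw⟩ := Q.exists_work_eq_optimalWork hM₀ hh₀ hγ ⟨L, N, hLN⟩
    exact ⟨L, N, hLN, hw, hLN.le_measureReal Q hα.1 hT0⟩
  · refine IsBigO.of_bound (2 * Q.M₀ * Q.h₀ ^ (-Q.γ) * C) ?_
    filter_upwards [self_mem_nhdsWithin, hsmall,
      Q.eventually_rpow_le_samplingRate (A := A) (ηs := ηs) hηw] with TOL hT0 hT1 hrate
    have hT : (0 : ℝ) < TOL := hT0
    obtain ⟨L, N, hLN, hw⟩ := hchoice TOL hT hT1
    have e : c / Q.ηw = 1 / (1 - Q.ε) + Q.γ / Q.ηw := by rw [hc]; field_simp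
    rw [e, Real.inv_rpow hT.le (1 / (1 - Q.ε) + Q.γ / Q.ηw), ← Real.rpow_neg hT.le] at hw
    rw [Real.norm_of_nonneg (Q.optimalWork_nonneg hh₀ α TOL)]
    refine (Q.optimalWork_le hh₀ hLN).trans (hw.trans ?_)
    rw [← mul_assoc]
    refine mul_le_mul_of_nonneg_left (le_trans ?_ (le_abs_self _)) (by positivity)
    linarith
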